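/- **Setup.** Let $\mathfrak H_2$ be the Siegel upper half space of degree two. For $F:\mathfrak H_2\to\mathbb C$, $k\in\mathbb Z_{>0}$ and $g=\begin{bmatrix}A&B\\C&D\end{bmatrix}\in\mathrm{Sp}(4,\mathbb Q)$ (defined by ${}^tgJg=J$, $J=\begin{bmatrix}&1_2\\-1_2&\end{bmatrix}$) put $(F|_kg)(Z)=\det(CZ+D)^{-k}F((AZ+B)(CZ+D)^{-1})$. For a positive integer $N$ let $$\Gamma^{\rm para}(N)=\mathrm{Sp}(4,\mathbb Q)\cap\begin{bmatrix}\mathbb Z&\mathbb Z&N^{-1}\mathbb Z&\mathbb Z\\N\mathbb Z&\mathbb Z&\mathbb Z&\mathbb Z\\N\mathbb Z&N\mathbb Z&\mathbb Z&N\mathbb Z\\N\mathbb Z&\mathbb Z&\mathbb Z&\mathbb Z\end{bmatrix},$$ and let $S_k(\Gamma^{\rm para}(N))$ be the space of Siegel cusp forms of weight $k$ for this group: holomorphic $F$ with $F|_kg=F$ for $g\in\Gamma^{\rm para}(N)$ and $\lim_{t\to\infty}(F|_kg)(\mathrm{diag}(\tau,it))=0$ for all $g\in\mathrm{Sp}(4,\mathbb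 Q)$ and $\tau$ in the upper half plane. Let $A(N)^+$ be the set of $S=\begin{bmatrix}\alpha&\beta\\\beta&\gamma\end{bmatrix}$ with $\alpha\in N\mathbb Z$, $2\beta,\gamma\in\mathbb Z$, $\alpha>0$, $\det S>0$. Write $S[P]={}^tPSP$. Let $p$ be an odd prime, $\chi=\left(\frac{\cdot}{p}\right)$, $\mathbf 1$ the trivial character mod $p$, $W(\xi,a)=\sum_{b\in(\mathbb Z/p)^\times}\xi(b)e^{2\pi iab/p}$ and $W(\chi)=W(\chi,1)$. For a symmetric rational matrix $Q$ and $P\in\mathrm{GL}(2,\mathbb Q)$ put $[Q;P]=\begin{bmatrix}1&Q\\&1\end{bmatrix}\begin{bmatrix}P&\\&{}^tP^{-1}\end{bmatrix}$, and write $Q=(q_1,q_2,q_3)$ for $\begin{bmatrix}q_1&q_2\\q_2&q_3\end{bmatrix}$ and $P=(r,s,t)$ for $\begin{bmatrix}r&s\\&t\end{bmatrix}$. Put $R_n=\mathbb Z/p^n\mathbb Z$; residue classes (including inverses, which are formed in $R_n$) are represented by integers in $\{0,\dots,p^n-1\}$. The twisting map of Johnson-Leung and Roberts is $\mathcal T_\chi(F)=\sum_{l=1}^{14}F|_k\mathcal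 T^l_\chi$, with the formal sums - $\mathcal T^1_\chi=p^{-11}\sum_{a,b,x\in R_3^\times,\,z\in R_4}\chi(ab)\,[(zp^{-4},-bp^{-2},-x^{-1}p^{-1});(1,(a+xb)p^{-1},1)]$ - $\mathcal T^2_\chi=p^{-11}\sum_{a,b,x,y\in R_3^\times,\;x,y\not\equiv1(p)}\chi(abxy)\,[(-ab(1-(1-y)^{-1}x)p^{-3},-ap^{-2},-ab^{-1}(1-x)^{-1}p^{-1});(p,bp^{-1},1)]$ - $\mathcal T^3_\chi=p^{-6}\sum_{a\in R_2^\times,\,b\in R_3^\times,\,z\in R_1^\times,\;z\not\equiv1(p)}\chi(b(1-z))\,[(-bp^{-3},ap^{-2},-a^2b^{-1}zp^{-1});(p,0,1)]$ - $\mathcal T^4_\chi=p^{-10}\sum_{a\in R_4,\,b\in R_3^\times,\,x\in R_4^\times}\chi(b)\,[((ax-bp)p^{-4},ap^{-2},0);(p,xp^{-2},1)]$ - $\mathcal T^5_\chi=p^{-9}\sum_{a,b\in R_3^\times,\,x\in R_3}\chi(b)\,[((ax-b)p^{-3},ap^{-2},0);(p,xp^{-1},1)]$ - $\mathcal T^6_\chi=p^{-6}\sum_{a,b\in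 R_2^\times,\,x\in R_1^\times}\chi(bx)\,[(b(1+xp)p^{-2},ap^{-2},a^2b^{-1}p^{-2});(p^2,0,1)]$ - $\mathcal T^7_\chi=p^{-7}\sum_{a\in R_3^\times,\,b\in R_1^\times,\,z\in R_4}\chi(ab)\,[(zp^{-4},bp^{-1},0);(1,-ap^{-1},p)]$ - $\mathcal T^8_\chi=p^{-9}\sum_{a,b,z\in R_3^\times,\;z\not\equiv1(p)}\chi(abz(1-z))\,[(ab(1-z)p^{-3},ap^{-1},0);(p,bp^{-1},p)]$ - $\mathcal T^9_\chi=p^{-6}\sum_{a\in R_2^\times,\,b,x\in R_1^\times}\chi(b)\,[(bp^{-1},0,xp^{-1});(p^2,a,p)]$ - $\mathcal T^{10}_\chi=p^{-6}\sum_{a\in R_2^\times,\,b\in R_1^\times}\chi(b)\,[(bp^{-1},0,0);(p^2,a,p^2)]$ - $\mathcal T^{11}_\chi=p^{-10}\sum_{a\in R_2^\times,\,b\in R_4^\times,\,x\in R_3,\,z\in R_4}\chi(ab)\,[(zp^{-4},(ap+xb)p^{-3},xp^{-2});(1,bp^{-2},p^{-1})]$ - $\mathcal T^{12}_\chi=p^{-12}\sum_{a\in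 R_4^\times,\,b,z\in R_3^\times,\,y\in R_4,\;z\not\equiv1(p)}\chi(abz(1-z))\,[(a(y-b(1-z)p)p^{-4},yp^{-3},a^{-1}(y+bp)p^{-2});(p,ap^{-2},p^{-1})]$ - $\mathcal T^{13}_\chi=p^{-6}\sum_{a\in R_2^\times,\,b\in R_3^\times,\,x\in R_1^\times}\chi(bx)\,[(b(1+x)p^{-1},ap^{-2},a^2b^{-1}p^{-3});(p^2,0,p^{-1})]$ - $\mathcal T^{14}_\chi=p^{-6}\sum_{a\in R_2^\times,\,b\in R_1^\times,\,x\in R_4}\chi(b)\,[(bp^{-1},ap^{-2},xp^{-4});(p^2,0,p^{-2})]$ **Theorem.** Let $N,k$ be positive integers, $p\nmid N$ an odd prime, and let $F\in S_k(\Gamma^{\rm para}(N))$ have the Fourier expansion $F(Z)=\sum_{S\in A(N)^+}a(S)e^{2\pi i\,{\rm tr}(SZ)}$. Then $$\mathcal T_\chi(F)(Z)=\sum_{S\in A(Np^4)^+}W(\chi)\,a_\chi(S)\,e^{2\pi i\,{\rm tr}(SZ)}\qquad(Z\in\mathfrak H_2),$$ where $a_\chi(S)$, for $S=\begin{bmatrix}\alpha&\beta\\\beta&\gamma\end{bmatrix}\in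 A(Np^4)^+$ (so $p^4\mid\alpha$), is given as follows. Unless stated otherwise, summation variables run over $(\mathbb Z/p)^\times$. (i) If $p\nmid2\beta$, then $$a_\chi(S)=p^{1-k}\chi(2\beta)\sum_{b}\chi(b)\,a(S[\begin{bmatrix}1&-bp^{-1}\\&p\end{bmatrix}]).$$ (ii) If $p\,\|\,2\beta$ and $p^4\,\|\,\alpha$, then for all integers $x,y$ with $x\alpha p^{-4}\equiv2\beta p^{-1}$ and $y\,2\beta p^{-1}\equiv-\gamma$ modulo $p^2$, $$\begin{aligned}a_\chi(S)=\;&p^{-1}\sum_{a,b}\chi(ab(2\beta p^{-1}a-\gamma))\,a(S[\begin{bmatrix}1&-(a+b)p^{-1}\\&1\end{bmatrix}])\\&+p^{-1}\sum_{a,z;\,z\ne1}\chi(az(1-z)(az\alpha p^{-4}-2\beta p^{-1}))\,a(S[\begin{bmatrix}p^{-1}&-ap^{-2}\\&p\end{bmatrix}])\\&-p^{-1}\chi(\alpha p^{-4})\,a(S[\begin{bmatrix}p^{-2}&\\&p^2\end{bmatrix}])+p^{k-2}\chi(-\alpha p^{-4})\,a(S[\begin{bmatrix}p^{-1}&-xp^{-3}\\&1\end{bmatrix}])\\&+p^{k-2}\chi(-\gamma)\,a(S[\begin{bmatrix}1&yp^{-2}\\&p^{-1}\end{bmatrix}]).\end{aligned}$$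 (iii) If $p\,\|\,2\beta$ and $p^5\mid\alpha$, then for all integers $y$ with $y\,2\beta p^{-1}\equiv-\gamma$ modulo $p^2$, $$\begin{aligned}a_\chi(S)=\;&p^{-1}\sum_{a,b}\chi(ab(2\beta p^{-1}a-\gamma))\,a(S[\begin{bmatrix}1&-(a+b)p^{-1}\\&1\end{bmatrix}])+p^{k-2}\chi(-\gamma)\,a(S[\begin{bmatrix}1&yp^{-2}\\&p^{-1}\end{bmatrix}])\\&-p^{-1}\chi(2\beta p^{-1})\sum_a\chi(a)\,a(S[\begin{bmatrix}p^{-1}&-ap^{-2}\\&p\end{bmatrix}]).\end{aligned}$$ (iv) If $p^2\mid2\beta$ and $p^4\,\|\,\alpha$, then $a_\chi(S)=b_\chi(S)+c_\chi(S)+d_\chi(S)$, where $$\begin{aligned}b_\chi(S)=\;&(1-p^{-1})\chi(\gamma)a(S)-p^{-1}\chi(\gamma)\sum_ba(S[\begin{bmatrix}1&-bp^{-1}\\&1\end{bmatrix}])\\ &+p^{k-3}\sum_{b,x,y;\,x,y\ne1}\chi\Big(y(1-x)\big(\alpha p^{-4}\tfrac{y-x}{1-y}b^2+2\beta p^{-2}b-\gamma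 x^{-1}\big)\Big)a(S[\begin{bmatrix}p^{-1}&-bp^{-2}\\&1\end{bmatrix}])\\ &+p^{k-3}\big(\chi(\gamma)+p\chi(-4\det(S)p^{-4}\gamma)-\chi(-\alpha p^{-4})W(\mathbf1,2\beta p^{-2})\big)a(S[\begin{bmatrix}p^{-1}&\\&1\end{bmatrix}])\\ &+p^{k-3}\chi(-\alpha p^{-4})\sum_{x\in\mathbb Z/p}W(\mathbf1,2\beta p^{-2}-x\alpha p^{-4})\,a(S[\begin{bmatrix}p^{-1}&-xp^{-2}\\&1\end{bmatrix}])\\ &+p^{2k-4}\sum_{\substack{b\in(\mathbb Z/p^2)^\times\\p^2\mid\alpha p^{-4}b^2-2\beta p^{-2}b+\gamma}}\;\sum_{z\ne1}\chi\big(z(1-z)(\gamma-z\alpha p^{-4}b^2)\big)a(S[\begin{bmatrix}p^{-1}&-bp^{-3}\\&p^{-1}\end{bmatrix}])\\ &-p^{-1}\chi(\alpha p^{-4})\sum_aa(S[\begin{bmatrix}p^{-1}&-ap^{-2}\\&p\end{bmatrix}])\\ &+p^{k-3}\chi(\alpha p^{-4})\big(p\chi(-4\det(S)p^{-4})-W(\mathbf1,\gamma)\big)a(S[\begin{bmatrix}p^{-2}&\\&p\end{bmatrix}])\\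 &+(1-p^{-1})\chi(\alpha p^{-4})\,a(S[\begin{bmatrix}p^{-2}&\\&p^2\end{bmatrix}]);\end{aligned}$$ $c_\chi(S)=p^{2k-4}\chi(\alpha p^{-4})W(\mathbf1,4\det(S)p^{-5})\,a(S[\begin{bmatrix}p^{-2}&\\&1\end{bmatrix}])$ if $p^5\mid4\det(S)$ and $\chi(\gamma\alpha p^{-4})=1$, and $c_\chi(S)=0$ otherwise; and $$d_\chi(S)=\begin{cases}p^{3k-5}\chi(\alpha p^{-4})\chi(-4\det(S)p^{-6})\,a(S[\begin{bmatrix}p^{-2}&-ap^{-3}\\&p^{-1}\end{bmatrix}])&\text{if }p^6\mid4\det(S),\ p^8\nmid4\det(S),\\p^{4k-6}\chi(\alpha p^{-4})\,a(S[\begin{bmatrix}p^{-2}&-bp^{-4}\\&p^{-2}\end{bmatrix}])&\text{if }p^8\mid4\det(S),\\0&\text{otherwise,}\end{cases}$$ where $a\in(\mathbb Z/p)^\times$ satisfies $2\alpha p^{-4}a\equiv2\beta p^{-2}\ (p)$ and $b\in(\mathbb Z/p^2)^\times$ satisfies $2\alpha p^{-4}b\equiv2\beta p^{-2}\ (p^2)$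 (if $a$ or $b$ does not exist, the corresponding term is $0$). (v) If $p^2\mid2\beta$ and $p^5\mid\alpha$, then $$\begin{aligned}a_\chi(S)=\;&(1-p^{-1})\chi(\gamma)a(S)-p^{-1}\chi(\gamma)\sum_ba(S[\begin{bmatrix}1&-bp^{-1}\\&1\end{bmatrix}])\\&-p^{k-3}\sum_{b,x;\,x\ne1}\chi\big((1-x)(2\beta p^{-2}b-\gamma x^{-1})\big)a(S[\begin{bmatrix}p^{-1}&-bp^{-2}\\&1\end{bmatrix}])\\&+p^{k-3}\chi(\gamma)\big(1-p+p\chi(-4\det(S)p^{-4})\big)a(S[\begin{bmatrix}p^{-1}&\\&1\end{bmatrix}])\\&-p^{2k-4}\chi(-\gamma)\sum_{\substack{b\in(\mathbb Z/p^2)^\times\\p^2\mid\alpha p^{-4}b^2-2\beta p^{-2}b+\gamma}}a(S[\begin{bmatrix}p^{-1}&-bp^{-3}\\&p^{-1}\end{bmatrix}]).\end{aligned}$$ -/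

import Mathlib

open Matrix Filter Topology

noncomputable section

namespace Paramodular

/-- The Siegel upper half space of degree two: complex symmetric `2 × 2` matrices with positive
definite imaginary part. -/
def siegelH2 : Set (Matrix (Fin 2) (Fin 2) ℂ) :=
  {Z | Z.IsSymm ∧ (Z.map Complex.im).PosDef}

/-- A rational matrix viewed as a complex one. -/
def toC {m n : Type*} (A : Matrix m n ℚ) : Matrix m n ℂ := A.map (algebraMap ℚ ℂ)

/-- `C Z + D` for `g = [A, B; C, D]`. -/
def cocycle (g : Matrix (Fin 2 ⊕ Fin 2) (Fin 2 ⊕ Fin 2) ℚ) (Z : Matrix (Fin 2) (Fin 2) ℂ) :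
    Matrix (Fin 2) (Fin 2) ℂ :=
  toC g.toBlocks₂₁ * Z + toC g.toBlocks₂₂

/-- `g⟨Z⟩ = (A Z + B) (C Z + D)⁻¹` for `g = [A, B; C, D]`. -/
def moebius (g : Matrix (Fin 2 ⊕ Fin 2) (Fin 2 ⊕ Fin 2) ℚ) (Z : Matrix (Fin 2) (Fin 2) ℂ) :
    Matrix (Fin 2) (Fin 2) ℂ :=
  (toC g.toBlocks₁₁ * Z + toC g.toBlocks₁₂) * (cocycle g Z)⁻¹

/-- The slash operator `(F |_k g)(Z) = det(C Z + D)^(-k) F(g⟨Z⟩)`, used only for `g` in `Sp(4, ℚ)`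
(so that the similitude factor is `1`). -/
def slash (k : ℕ) (F : Matrix (Fin 2) (Fin 2) ℂ → ℂ)
    (g : Matrix (Fin 2 ⊕ Fin 2) (Fin 2 ⊕ Fin 2) ℚ) (Z : Matrix (Fin 2) (Fin 2) ℂ) : ℂ :=
  (cocycle g Z).det ^ (-(k : ℤ)) * F (moebius g Z)

/-- The paramodular group of level `N`: the elements of `Sp(4, ℚ)` with entries in
`[ℤ, ℤ, N⁻¹ℤ, ℤ; Nℤ, ℤ, ℤ, ℤ; Nℤ, Nℤ, ℤ, Nℤ; Nℤ, ℤ, ℤ, ℤ]`. -/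
def paramodularGroup (N : ℕ) : Set (Matrix (Fin 2 ⊕ Fin 2) (Fin 2 ⊕ Fin 2) ℚ) :=
  {g | g ∈ symplecticGroup (Fin 2) ℚ ∧ ∃ a b c d : Matrix (Fin 2) (Fin 2) ℤ,
    g = fromBlocks
      !![(a 0 0 : ℚ), (a 0 1 : ℚ); N * (a 1 0 : ℚ), (a 1 1 : ℚ)]
      !![(b 0 0 : ℚ) / N, (b 0 1 : ℚ); (b 1 0 : ℚ), (b 1 1 : ℚ)]
      !![N * (c 0 0 : ℚ), N * (c 0 1 : ℚ); N * (c 1 0 : ℚ), (c 1 1 : ℚ)]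
      !![(d 0 0 : ℚ), N * (d 0 1 : ℚ); (d 1 0 : ℚ), (d 1 1 : ℚ)]}

/-- Siegel cusp forms of degree two, weight `k` and paramodular level `N`, as functions whose values
outside the Siegel upper half space are irrelevant. Holomorphy is in the coordinates
`[τ, z; z, τ']`; the form is cuspidal if the Siegel operator annihilates `F |_k g` for all
`g ∈ Sp(4, ℚ)` (growth conditions are automatic in degree two). -/
structure IsParamodularCuspForm (N k : ℕ) (F : Matrix (Fin 2) (Fin 2) ℂ → ℂ) : Prop where
  holomorphic : DifferentiableOn ℂ
    (fun v : ℂ × ℂ × ℂ => F !![v.1, v.2.1; v.2.1, v.2.2])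
    {v | !![v.1, v.2.1; v.2.1, v.2.2] ∈ siegelH2}
  invariant : ∀ g ∈ paramodularGroup N, ∀ Z ∈ siegelH2, slash k F g Z = F Z
  cuspidal : ∀ g ∈ symplecticGroup (Fin 2) ℚ, ∀ τ : ℂ, 0 < τ.im →
    Tendsto (fun t : ℝ => slash k F g !![τ, 0; 0, (t : ℂ) * Complex.I]) atTop (𝓝 0)

/-- The matrix `[α, m/2; m/2, γ]`, so that `m = 2β`. -/
def halfMat (α m γ : ℤ) : Matrix (Fin 2) (Fin 2) ℚ :=
  !![(α : ℚ), (m : ℚ) / 2; (m : ℚ) / 2, (γ : ℚ)]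

/-- The index set `A(N)⁺`. -/
def APlus (N : ℕ) : Set (Matrix (Fin 2) (Fin 2) ℚ) :=
  {S | ∃ α m γ : ℤ, S = halfMat α m γ ∧ (N : ℤ) ∣ α ∧ 0 < α ∧ 0 < S.det}

/-- `S[P] = ᵗP S P`. -/
def subst (S P : Matrix (Fin 2) (Fin 2) ℚ) : Matrix (Fin 2) (Fin 2) ℚ := Pᵀ * S * P

/-- `e^{2 π i tr(S Z)}`. -/
def expTr (S : Matrix (Fin 2) (Fin 2) ℚ) (Z : Matrix (Fin 2) (Fin 2) ℂ) : ℂ :=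
  Complex.exp (2 * Real.pi * Complex.I * (toC S * Z).trace)

/-- `F(Z) = ∑_{S ∈ A(N)⁺} a(S) e^{2 π i tr(S Z)}` for all `Z` in the Siegel upper half space. -/
def HasFourierExpansion (N : ℕ) (F : Matrix (Fin 2) (Fin 2) ℂ → ℂ)
    (a : Matrix (Fin 2) (Fin 2) ℚ → ℂ) : Prop :=
  ∀ Z ∈ siegelH2, HasSum (fun S : APlus N => a S * expTr S Z) (F Z)

section twist

variable (p : ℕ) [Fact p.Prime]

/-- The nontrivial quadratic Dirichlet character modulo an odd prime `p` (the Legendre symbol). -/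
def χ : DirichletCharacter ℂ p := (quadraticChar (ZMod p)).ringHomComp (Int.castRingHom ℂ)

/-- The Gauss sum `W(ξ, a) = ∑_{b ∈ (ℤ/p)ˣ} ξ(b) e^{2 π i a b / p}`. -/
def W (ξ : DirichletCharacter ℂ p) (a : ℤ) : ℂ :=
  ∑ b : (ZMod p)ˣ, ξ b * Complex.exp (2 * Real.pi * Complex.I * a * (b : ZMod p).val / p)

/-- The representative in `{0, …, n - 1}` of a residue class modulo `n`. -/
def rep {n : ℕ} (x : ZMod n) : ℚ := (x.val : ℚ)

/-- Reduction modulo `p`, used for residue classes modulo powers of `p`. -/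
def red {n : ℕ} (x : ZMod n) : ZMod p := (x.val : ZMod p)

/-- `χ` on residue classes modulo powers of `p`. -/
def chi {n : ℕ} (x : ZMod n) : ℂ := χ p (red p x)

/-- `F |_k [1, Q; 0, 1] [P, 0; 0, ᵗP⁻¹]` for `Q = [q₁, q₂; q₂, q₃]`. -/
def slashQP (k : ℕ) (F : Matrix (Fin 2) (Fin 2) ℂ → ℂ) (q₁ q₂ q₃ : ℚ)
    (P : Matrix (Fin 2) (Fin 2) ℚ) : Matrix (Fin 2) (Fin 2) ℂ → ℂ :=
  slash k F (fromBlocks 1 !![q₁, q₂; q₂, q₃] 0 1 * fromBlocks P 0 0 (P⁻¹)ᵀ)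

variable (k : ℕ) (F : Matrix (Fin 2) (Fin 2) ℂ → ℂ) (Z : Matrix (Fin 2) (Fin 2) ℂ)

def twist1 : ℂ :=
  (p : ℂ) ^ (-11 : ℤ) *
    ∑ a : (ZMod (p ^ 3))ˣ, ∑ b : (ZMod (p ^ 3))ˣ, ∑ x : (ZMod (p ^ 3))ˣ, ∑ z : ZMod (p ^ 4),
      chi p (a * b : ZMod (p ^ 3)) *
        slashQP k F (rep z / p ^ 4) (-rep b.1 / p ^ 2) (-rep x⁻¹.1 / p)
          !![1, (rep a.1 + rep x.1 * rep b.1) / p; 0, 1] Z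

def twist2 : ℂ :=
  (p : ℂ) ^ (-11 : ℤ) *
    ∑ a : (ZMod (p ^ 3))ˣ, ∑ b : (ZMod (p ^ 3))ˣ,
      ∑ x : (ZMod (p ^ 3))ˣ with red p x.1 ≠ 1, ∑ y : (ZMod (p ^ 3))ˣ with red p y.1 ≠ 1,
        chi p (a * b * x * y : ZMod (p ^ 3)) *
          slashQP k F
            (-rep (a * b * (1 - (1 - (y : ZMod (p ^ 3)))⁻¹ * x) : ZMod (p ^ 3)) / p ^ 3)
            (-rep a.1 / p ^ 2)
            (-rep (a * (b : ZMod (p ^ 3))⁻¹ * (1 - (x : ZMod (p ^ 3)))⁻¹ : ZMod (p ^ 3)) / p)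
            !![(p : ℚ), rep b.1 / p; 0, 1] Z

def twist3 : ℂ :=
  (p : ℂ) ^ (-6 : ℤ) *
    ∑ a : (ZMod (p ^ 2))ˣ, ∑ b : (ZMod (p ^ 3))ˣ, ∑ z : (ZMod p)ˣ with z ≠ 1,
      chi p b.1 * chi p (1 - z : ZMod p) *
        slashQP k F (-rep b.1 / p ^ 3) (rep a.1 / p ^ 2)
          (-(rep a.1 ^ 2 * rep b⁻¹.1 * rep z.1) / p)
          !![(p : ℚ), 0; 0, 1] Z

def twist4 : ℂ :=
  (p : ℂ) ^ (-10 : ℤ) *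
    ∑ a : ZMod (p ^ 4), ∑ b : (ZMod (p ^ 3))ˣ, ∑ x : (ZMod (p ^ 4))ˣ,
      chi p b.1 *
        slashQP k F ((rep a * rep x.1 - rep b.1 * p) / p ^ 4) (rep a / p ^ 2) 0
          !![(p : ℚ), rep x.1 / p ^ 2; 0, 1] Z

def twist5 : ℂ :=
  (p : ℂ) ^ (-9 : ℤ) *
    ∑ a : (ZMod (p ^ 3))ˣ, ∑ b : (ZMod (p ^ 3))ˣ, ∑ x : ZMod (p ^ 3),
      chi p b.1 *
        slashQP k F ((rep a.1 * rep x - rep b.1) / p ^ 3) (rep a.1 / p ^ 2) 0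
          !![(p : ℚ), rep x / p; 0, 1] Z

def twist6 : ℂ :=
  (p : ℂ) ^ (-6 : ℤ) *
    ∑ a : (ZMod (p ^ 2))ˣ, ∑ b : (ZMod (p ^ 2))ˣ, ∑ x : (ZMod p)ˣ,
      chi p b.1 * chi p x.1 *
        slashQP k F (rep b.1 * (1 + rep x.1 * p) / p ^ 2) (rep a.1 / p ^ 2)
          (rep a.1 ^ 2 * rep b⁻¹.1 / p ^ 2)
          !![(p : ℚ) ^ 2, 0; 0, 1] Z

def twist7 : ℂ :=
  (p : ℂ) ^ (-7 : ℤ) *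
    ∑ a : (ZMod (p ^ 3))ˣ, ∑ b : (ZMod p)ˣ, ∑ z : ZMod (p ^ 4),
      chi p a.1 * chi p b.1 *
        slashQP k F (rep z / p ^ 4) (rep b.1 / p) 0
          !![1, -rep a.1 / p; 0, (p : ℚ)] Z

def twist8 : ℂ :=
  (p : ℂ) ^ (-9 : ℤ) *
    ∑ a : (ZMod (p ^ 3))ˣ, ∑ b : (ZMod (p ^ 3))ˣ, ∑ z : (ZMod (p ^ 3))ˣ with red p z.1 ≠ 1,
      chi p (a * b * z * (1 - z) : ZMod (p ^ 3)) *
        slashQP k F (rep (a * b * (1 - z) : ZMod (p ^ 3)) / p ^ 3) (rep a.1 / p) 0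
          !![(p : ℚ), rep b.1 / p; 0, (p : ℚ)] Z

def twist9 : ℂ :=
  (p : ℂ) ^ (-6 : ℤ) *
    ∑ a : (ZMod (p ^ 2))ˣ, ∑ b : (ZMod p)ˣ, ∑ x : (ZMod p)ˣ,
      chi p b.1 *
        slashQP k F (rep b.1 / p) 0 (rep x.1 / p)
          !![(p : ℚ) ^ 2, rep a.1; 0, (p : ℚ)] Z

def twist10 : ℂ :=
  (p : ℂ) ^ (-6 : ℤ) *
    ∑ a : (ZMod (p ^ 2))ˣ, ∑ b : (ZMod p)ˣ,
      chi p b.1 *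
        slashQP k F (rep b.1 / p) 0 0
          !![(p : ℚ) ^ 2, rep a.1; 0, (p : ℚ) ^ 2] Z

def twist11 : ℂ :=
  (p : ℂ) ^ (-10 : ℤ) *
    ∑ a : (ZMod (p ^ 2))ˣ, ∑ b : (ZMod (p ^ 4))ˣ, ∑ x : ZMod (p ^ 3), ∑ z : ZMod (p ^ 4),
      chi p a.1 * chi p b.1 *
        slashQP k F (rep z / p ^ 4) ((rep a.1 * p + rep x * rep b.1) / p ^ 3) (rep x / p ^ 2)
          !![1, rep b.1 / p ^ 2; 0, (p : ℚ)⁻¹] Z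

def twist12 : ℂ :=
  (p : ℂ) ^ (-12 : ℤ) *
    ∑ a : (ZMod (p ^ 4))ˣ, ∑ b : (ZMod (p ^ 3))ˣ, ∑ y : ZMod (p ^ 4),
      ∑ z : (ZMod (p ^ 3))ˣ with red p z.1 ≠ 1,
        chi p a.1 * chi p (b * z * (1 - z) : ZMod (p ^ 3)) *
          slashQP k F
            (rep a.1 * (rep y - rep b.1 * (1 - rep z.1) * p) / p ^ 4)
            (rep y / p ^ 3)
            (rep a⁻¹.1 * (rep y + rep b.1 * p) / p ^ 2)
            !![(p : ℚ), rep a.1 / p ^ 2; 0, (p : ℚ)⁻¹] Z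

def twist13 : ℂ :=
  (p : ℂ) ^ (-6 : ℤ) *
    ∑ a : (ZMod (p ^ 2))ˣ, ∑ b : (ZMod (p ^ 3))ˣ, ∑ x : (ZMod p)ˣ,
      chi p b.1 * chi p x.1 *
        slashQP k F (rep b.1 * (1 + rep x.1) / p) (rep a.1 / p ^ 2)
          (rep a.1 ^ 2 * rep b⁻¹.1 / p ^ 3)
          !![(p : ℚ) ^ 2, 0; 0, (p : ℚ)⁻¹] Z

def twist14 : ℂ :=
  (p : ℂ) ^ (-6 : ℤ) *
    ∑ a : (ZMod (p ^ 2))ˣ, ∑ b : (ZMod p)ˣ, ∑ x : ZMod (p ^ 4),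
      chi p b.1 *
        slashQP k F (rep b.1 / p) (rep a.1 / p ^ 2) (rep x / p ^ 4)
          !![(p : ℚ) ^ 2, 0; 0, ((p : ℚ) ^ 2)⁻¹] Z

/-- The twisting map `F ↦ ∑_{l = 1}^{14} F |_k 𝒯_χ^l` of Johnson-Leung and Roberts. -/
def twist : ℂ :=
  twist1 p k F Z + twist2 p k F Z + twist3 p k F Z + twist4 p k F Z + twist5 p k F Z +
  twist6 p k F Z + twist7 p k F Z + twist8 p k F Z + twist9 p k F Z + twist10 p k F Z +
  twist11 p k F Z + twist12 p k F Z + twist13 p k F Z + twist14 p k F Z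

end twist

section coefficients

variable (p : ℕ) [Fact p.Prime] (k : ℕ) (a : Matrix (Fin 2) (Fin 2) ℚ → ℂ) (α m γ : ℤ)

/-- The term `b_χ(S)` for `S = [α, m/2; m/2, γ]`; to be used when `p² ∣ m`, `p⁴ ∣ α`, so that
`A = α p⁻⁴`, `B = m p⁻²` and `E = 4 det(S) p⁻⁴` are integers. -/
def bCoeff : ℂ :=
  let S := halfMat α m γ
  let A : ℤ := α / (p : ℤ) ^ 4
  let B : ℤ := m / (p : ℤ) ^ 2
  let E : ℤ := (4 * α * γ - m ^ 2) / (p : ℤ) ^ 4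
  (1 - (p : ℂ)⁻¹) * χ p γ * a S
  - (p : ℂ)⁻¹ * χ p γ * ∑ b : (ZMod p)ˣ, a (subst S !![1, -rep b.1 / p; 0, 1])
  + (p : ℂ) ^ ((k : ℤ) - 3) *
      ∑ b : (ZMod p)ˣ, ∑ x : (ZMod p)ˣ with x ≠ 1, ∑ y : (ZMod p)ˣ with y ≠ 1,
        χ p (y * (1 - x) * (A * ((y - x) / (1 - y)) * b ^ 2 + B * b - γ * (x : ZMod p)⁻¹)) *
          a (subst S !![(p : ℚ)⁻¹, -rep b.1 / p ^ 2; 0, 1])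
  + (p : ℂ) ^ ((k : ℤ) - 3) *
      (χ p γ + p * χ p (-E * γ) - χ p (-A) * W p 1 B) *
        a (subst S !![(p : ℚ)⁻¹, 0; 0, 1])
  + (p : ℂ) ^ ((k : ℤ) - 3) * χ p (-A) *
      ∑ x : ZMod p, W p 1 (B - x.val * A) * a (subst S !![(p : ℚ)⁻¹, -rep x / p ^ 2; 0, 1])
  + (p : ℂ) ^ (2 * (k : ℤ) - 4) *
      ∑ b ∈ Finset.univ.filter
            (fun b : (ZMod (p ^ 2))ˣ => A * (b : ZMod (p ^ 2)) ^ 2 - B * (b : ZMod (p ^ 2)) + γ = 0),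
        ∑ z : (ZMod p)ˣ with z ≠ 1,
          χ p (z * (1 - z) * (γ - z * A * red p b.1 ^ 2)) *
            a (subst S !![(p : ℚ)⁻¹, -rep b.1 / p ^ 3; 0, (p : ℚ)⁻¹])
  - (p : ℂ)⁻¹ * χ p A *
      ∑ x : (ZMod p)ˣ, a (subst S !![(p : ℚ)⁻¹, -rep x.1 / p ^ 2; 0, (p : ℚ)])
  + (p : ℂ) ^ ((k : ℤ) - 3) * χ p A * (p * χ p (-E) - W p 1 γ) *
      a (subst S !![((p : ℚ) ^ 2)⁻¹, 0; 0, (p : ℚ)])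
  + (1 - (p : ℂ)⁻¹) * χ p A * a (subst S !![((p : ℚ) ^ 2)⁻¹, 0; 0, (p : ℚ) ^ 2])

/-- The term `c_χ(S)` for `S = [α, m/2; m/2, γ]`. -/
def cCoeff : ℂ :=
  let S := halfMat α m γ
  let A : ℤ := α / (p : ℤ) ^ 4
  let D : ℤ := 4 * α * γ - m ^ 2
  open Classical in
  if (p : ℤ) ^ 5 ∣ D ∧ χ p (γ * A) = 1 then
    (p : ℂ) ^ (2 * (k : ℤ) - 4) * χ p A * W p 1 (D / (p : ℤ) ^ 5) *
      a (subst S !![((p : ℚ) ^ 2)⁻¹, 0; 0, 1])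
  else 0

/-- The term `d_χ(S)` for `S = [α, m/2; m/2, γ]`. Each sum has at most one term (and is empty when
the congruence has no solution). -/
def dCoeff : ℂ :=
  let S := halfMat α m γ
  let A : ℤ := α / (p : ℤ) ^ 4
  let B : ℤ := m / (p : ℤ) ^ 2
  let D : ℤ := 4 * α * γ - m ^ 2
  if (p : ℤ) ^ 8 ∣ D then
    (p : ℂ) ^ (4 * (k : ℤ) - 6) * χ p A *
      ∑ b ∈ Finset.univ.filter (fun b : (ZMod (p ^ 2))ˣ => 2 * A * (b : ZMod (p ^ 2)) = B),
        a (subst S !![((p : ℚ) ^ 2)⁻¹, -rep b.1 / p ^ 4; 0, ((p : ℚ) ^ 2)⁻¹])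
  else if (p : ℤ) ^ 6 ∣ D then
    (p : ℂ) ^ (3 * (k : ℤ) - 5) * χ p A * χ p (-(D / (p : ℤ) ^ 6 : ℤ)) *
      ∑ x ∈ Finset.univ.filter (fun x : (ZMod p)ˣ => 2 * A * (x : ZMod p) = B),
        a (subst S !![((p : ℚ) ^ 2)⁻¹, -rep x.1 / p ^ 3; 0, (p : ℚ)⁻¹])
  else 0

end coefficients

end Paramodular

end

/-! For `P = [r, s; 0, t]`, the operator `[Q; P]` turns coefficients `a(S)` into the coefficients
`det(P)^k a(S) e(tr(SQ))` at `T = S[P]`. A coefficient of the twist is therefore a finite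
combination of values `a(T[P⁻¹])`, in which all terms sharing one `P` are weighted by an exponential
sum over the parameters of `Q`. The theorem amounts to evaluating these sums, operator by operator.

A few mechanisms suffice. If a parameter modulo `pⁿ⁺¹` has a weight seen only modulo `p`, summing
over the fibres of reduction forces a divisibility by `pⁿ` (`sum_units_red_mul_e_eq_zero`), after
which everything lives modulo `p` (`sum_units_red_mul_e`). A parameter weighted by `χ` in which the
phase is linear yields `W(χ)` times a value of `χ` (`sum_units_χ_mul_stdAddChar`). What remains is a
Ramanujan sum or a sum of `χ` over a quadratic polynomial, evaluated by completing the square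
(`sum_ramanujan_quadratic`, `sum_χ_mul_add`); the sixth operator needs a stationary phase modulo
`p²` (`sum_e_quadratic`). Invariance of the coefficients under `S ↦ S[1, n; 0, 1]` makes `s` matter
only modulo `t`, which collapses the sums over `P`.

The result for operator `l` is `isTwistCoef` followed by `l`: its contribution is supported on `p⁴ ∣
α` and `pʲ ∣ m`, with `j = 0` for `l = 11`, `j = 1` for `l = 1, 4, 7, 12, 14` and `j = 2` otherwise.
This explains the case division. If `p ∤ m` only operator 11 survives. If `p ∥ m` the five operators
with `j = 1` survive, since operator 11 carries `χ(m)`. If `p² ∣ m`, operators 4, 7 and 11 drop out.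
Whether `p` divides `α p⁻⁴` decides the rest, and integrality of `T[P⁻¹]` reduces several sums over
`s` to the solutions of a congruence.

Uniqueness of Fourier coefficients gives the unipotent invariance (`isCoefFun_coefExt`), and `p ∤ N`
places the support of the twist in `A(Np⁴)⁺`. The given family `a` is arbitrary outside `A(N)⁺`, so
the computation uses its extension by zero, `coefExt`; at the end each value in the formulas is
shown to be taken at a matrix in `A(N)⁺`, or else to be multiplied by zero. -/

noncomputable section

namespace Paramodular

/-! ### The additive character of `ℚ`, residue sums, Gauss and Ramanujan sums -/

section

/-- The additive character `x ↦ e^{2 π i x}` of `ℚ`. -/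
def e (x : ℚ) : ℂ := Complex.exp (2 * Real.pi * Complex.I * x)

lemma e_add (x y : ℚ) : e (x + y) = e x * e y := by
  rw [e, e, e, ← Complex.exp_add]; push_cast; ring_nf

lemma e_intCast (n : ℤ) : e n = 1 := by
  rw [e, Complex.exp_eq_one_iff]
  exact ⟨n, by push_cast; ring⟩

lemma e_zero : e 0 = 1 := by simpa using e_intCast 0

lemma e_eq_of_sub {x y : ℚ} (n : ℤ) (h : x - y = n) : e x = e y := by
  rw [← sub_add_cancel x y, e_add, h, e_intCast, one_mul]

lemma e_div_natCast {N : ℕ} [NeZero N] (c : ℤ) : e ((c : ℚ) / N) = ZMod.stdAddChar (c : ZMod N) := by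
  rw [ZMod.stdAddChar_coe, e]; push_cast; ring_nf

lemma e_eq_one_iff (x : ℚ) : e x = 1 ↔ ∃ n : ℤ, x = n := by
  constructor
  · intro h
    rw [e, Complex.exp_eq_one_iff] at h
    obtain ⟨n, hn⟩ := h
    refine ⟨n, ?_⟩
    have h2 : (2 * Real.pi * Complex.I : ℂ) ≠ 0 := Complex.two_pi_I_ne_zero
    have : (x : ℂ) = n := by
      apply mul_left_cancel₀ h2; rw [hn]; ring
    exact_mod_cast this
  · rintro ⟨n, rfl⟩; exact e_intCast n

/-- Allows the canonical representative to be exchanged for any integer of the same class; the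
multiple of `N` disappears later by periodicity of `e` or of the coefficients. -/
lemma exists_rep_eq {N : ℕ} [NeZero N] {x : ZMod N} {n : ℤ} (h : (n : ZMod N) = x) :
    ∃ j : ℤ, rep x = n + N * j := by
  have : ((x.val : ℤ) : ZMod N) = (n : ZMod N) := by rw [h]; simp
  rw [ZMod.intCast_eq_intCast_iff_dvd_sub] at this
  obtain ⟨j, hj⟩ := this
  refine ⟨-j, ?_⟩
  have h2 : (x.val : ℤ) = n + N * (-j) := by linarith
  rw [rep]; exact_mod_cast h2

lemma e_rep {N : ℕ} [NeZero N] (c : ℤ) (x : ZMod N) :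
    e (c * rep x / N) = ZMod.stdAddChar ((c : ZMod N) * x) := by
  have := e_div_natCast (N := N) (c * x.val)
  push_cast at this
  rw [rep, this]; simp

/-! ### Sums over residue classes -/

lemma sum_range_mul_add (d q : ℕ) (g : ℕ → ℂ) :
    ∑ x ∈ Finset.range (d * q), g x =
      ∑ v ∈ Finset.range d, ∑ j ∈ Finset.range q, g (v + d * j) := by
  rcases Nat.eq_zero_or_pos d with rfl | hd
  · simp
  rw [← Finset.sum_product']
  symm
  refine Finset.sum_nbij' (fun x => x.1 + d * x.2) (fun x => (x % d, x / d)) ?_ ?_ ?_ ?_ ?_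
  · rintro ⟨v, j⟩ h
    simp only [Finset.mem_product, Finset.mem_range] at h ⊢
    nlinarith
  · intro x h
    simp only [Finset.mem_product, Finset.mem_range] at h ⊢
    exact ⟨Nat.mod_lt _ hd, Nat.div_lt_of_lt_mul h⟩
  · rintro ⟨v, j⟩ h
    simp only [Finset.mem_product, Finset.mem_range] at h ⊢
    simp [Nat.mod_eq_of_lt h.1, Nat.add_mul_div_left _ _ hd, Nat.div_eq_of_lt h.1]
  · intro x _; simp [Nat.mod_add_div]
  · intros; rfl

lemma sum_zmod_eq_sum_range {N : ℕ} [NeZero N] (f : ℕ → ℂ) :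
    ∑ u : ZMod N, f u.val = ∑ x ∈ Finset.range N, f x := by
  refine Finset.sum_nbij' (fun u => u.val) (fun x => (x : ZMod N)) ?_ ?_ ?_ ?_ ?_
  · intro u _; simpa using ZMod.val_lt u
  · intros; simp
  · intros; simp
  · intro x hx; simp only [Finset.mem_range] at hx; simp [ZMod.val_natCast, Nat.mod_eq_of_lt hx]
  · intros; rfl

lemma sum_units_eq_sum_range {N : ℕ} [NeZero N] (f : ℕ → ℂ) :
    ∑ u : (ZMod N)ˣ, f u.1.val = ∑ x ∈ Finset.range N, if x.Coprime N then f x else 0 := by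
  rw [← sum_zmod_eq_sum_range (fun x => if x.Coprime N then f x else 0), ← Finset.sum_filter]
  refine Finset.sum_bij (fun u _ => (u : ZMod N)) ?_ ?_ ?_ ?_
  · intro u _; simpa using ZMod.val_coe_unit_coprime u
  · intro u _ v _ h; exact Units.ext h
  · intro x hx
    simp only [Finset.mem_filter, Finset.mem_univ, true_and] at hx
    exact ⟨ZMod.unitOfCoprime x.val hx, Finset.mem_univ _, by simp⟩
  · intros; rfl

/-- Digit expansion `x = v + d j`: by `h` the condition of being a unit is decided by `v` alone, so
`j` runs freely. -/
lemma sum_units_fiber {N d q : ℕ} [NeZero N] [NeZero d] (hN : N = d * q)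
    (h : ∀ x : ℕ, x.Coprime N ↔ x.Coprime d) (f : ℕ → ℂ) :
    ∑ u : (ZMod N)ˣ, f u.1.val =
      ∑ v : (ZMod d)ˣ, ∑ j ∈ Finset.range q, f (v.1.val + d * j) := by
  rw [sum_units_eq_sum_range, sum_units_eq_sum_range (N := d)
    (fun x => ∑ j ∈ Finset.range q, f (x + d * j)), hN, sum_range_mul_add]
  refine Finset.sum_congr rfl fun v _ => ?_
  split_ifs with hv
  · refine Finset.sum_congr rfl fun j _ => ?_
    rw [if_pos]
    rw [← hN, h]; simpa using hv
  · refine Finset.sum_eq_zero fun j _ => ?_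
    rw [if_neg]
    rw [← hN, h]; simpa using hv

lemma sum_range_e {q : ℕ} (hq : q ≠ 0) (c : ℤ) :
    ∑ j ∈ Finset.range q, e (c * j / q) = if (q : ℤ) ∣ c then (q : ℂ) else 0 := by
  have hq' : (q : ℚ) ≠ 0 := by exact_mod_cast hq
  split_ifs with h
  · obtain ⟨d, rfl⟩ := h
    rw [Finset.sum_congr rfl (g := fun _ => (1 : ℂ))]
    · simp
    · intro j _
      rw [show ((q * d : ℤ) : ℚ) * j / q = ((d * j : ℤ) : ℚ) by push_cast; field_simp, e_intCast]
  · have h1 : ∀ j : ℕ, e (c * j / q) = e (c / q) ^ j := by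
      intro j
      induction j with
      | zero => simp [e_zero]
      | succ j ih => rw [pow_succ, ← ih, ← e_add]; congr 1; push_cast; ring
    simp_rw [h1]
    have hne : e ((c : ℚ) / q) ≠ 1 := by
      rw [Ne, e_eq_one_iff]
      rintro ⟨n, hn⟩
      apply h
      refine ⟨n, ?_⟩
      field_simp at hn
      exact_mod_cast hn
    rw [geom_sum_eq hne, ← h1]
    rw [show (c : ℚ) * q / q = (c : ℤ) by field_simp, e_intCast]; simp

lemma sum_zmod_e {N : ℕ} [NeZero N] (c : ℤ) :
    ∑ z : ZMod N, e (c * rep z / N) = if (N : ℤ) ∣ c then (N : ℂ) else 0 := by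
  rw [← sum_range_e (NeZero.ne N) c]
  exact sum_zmod_eq_sum_range (fun x => e (c * x / N))

lemma coprime_pow_succ_iff (p n m x : ℕ) : x.Coprime (p ^ (n + 1)) ↔ x.Coprime (p ^ (m + 1)) := by
  rw [Nat.coprime_pow_right_iff (by omega), Nat.coprime_pow_right_iff (by omega)]

lemma coprime_pow_succ_iff' (p n x : ℕ) : x.Coprime (p ^ (n + 1)) ↔ x.Coprime p := by
  rw [Nat.coprime_pow_right_iff (by omega)]

variable (p : ℕ) [Fact p.Prime]

lemma red_eq_castHom {n : ℕ} (x : ZMod (p ^ (n + 1))) :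
    red p x = ZMod.castHom (dvd_pow_self p (Nat.succ_ne_zero n)) (ZMod p) x := by
  simp [red, ZMod.natCast_val]

/-- Lifting along `ℤ/pⁿ⁺¹ → ℤ/p`: every unit is `v + p j`. -/
lemma sum_units_lift (n : ℕ) (f : ℚ → ZMod p → ℂ) :
    ∑ u : (ZMod (p ^ (n + 1)))ˣ, f (rep u.1) (red p u.1) =
      ∑ v : (ZMod p)ˣ, ∑ j ∈ Finset.range (p ^ n), f (rep v.1 + p * j) v.1 := by
  have := sum_units_fiber (N := p ^ (n + 1)) (d := p) (q := p ^ n) (by ring)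
    (coprime_pow_succ_iff' p n) (fun x => f x x)
  simp only [red, rep]
  rw [this]
  simp

lemma sum_units_red (n : ℕ) (G : ZMod p → ℂ) :
    ∑ u : (ZMod (p ^ (n + 1)))ˣ, G (red p u.1) = (p : ℂ) ^ n * ∑ v : (ZMod p)ˣ, G v := by
  rw [sum_units_lift p n (fun _ x => G x), Finset.mul_sum]
  simp

/-- Writing `u = v + p j`, the weight depends on `v` only, and the sum over `j` is a full sum of the
character `j ↦ e(c j / pⁿ)`, which is nontrivial. Most divisibility conditions below come from here.
-/
lemma sum_units_red_mul_e_eq_zero (n : ℕ) (G : ZMod p → ℂ) {c : ℤ} (hc : ¬ (p : ℤ) ^ n ∣ c) :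
    ∑ u : (ZMod (p ^ (n + 1)))ˣ, G (red p u.1) * e (c * rep u.1 / p ^ (n + 1)) = 0 := by
  have hp : (p : ℚ) ≠ 0 := by exact_mod_cast (Fact.out : p.Prime).ne_zero
  rw [sum_units_lift p n (fun r x => G x * e (c * r / p ^ (n + 1)))]
  refine Finset.sum_eq_zero fun v _ => ?_
  have h1 : ∀ j : ℕ, e (c * (rep v.1 + p * j) / p ^ (n + 1)) =
      e (c * rep v.1 / p ^ (n + 1)) * e (c * j / (p ^ n : ℕ)) := by
    intro j; rw [← e_add]; congr 1; push_cast; field_simp; ring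
  simp_rw [h1, ← mul_assoc, ← Finset.mul_sum]
  rw [sum_range_e (pow_ne_zero _ (Fact.out : p.Prime).ne_zero), if_neg (by exact_mod_cast hc), mul_zero]

/-- Once `pⁿ` divides the frequency the phase also depends on `u` modulo `p` only, and every residue
is hit `pⁿ` times. -/
lemma sum_units_red_mul_e (n : ℕ) (G : ZMod p → ℂ) (c : ℤ) :
    ∑ u : (ZMod (p ^ (n + 1)))ˣ, G (red p u.1) * e (((p : ℤ) ^ n * c : ℤ) * rep u.1 / p ^ (n + 1)) =
      (p : ℂ) ^ n * ∑ v : (ZMod p)ˣ, G v * ZMod.stdAddChar ((c : ZMod p) * v.1) := by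
  have hp : (p : ℚ) ≠ 0 := by exact_mod_cast (Fact.out : p.Prime).ne_zero
  rw [← sum_units_red p n (fun x => G x * ZMod.stdAddChar ((c : ZMod p) * x))]
  refine Finset.sum_congr rfl fun u _ => ?_
  congr 1
  have := e_div_natCast (N := p) (c * u.1.val)
  push_cast at this
  rw [red, ← this, rep]
  congr 1; push_cast; field_simp; ring

/-- Summing over units of `ℤ/pⁿ⁺ᵐ⁺¹` a function with period `pᵐ⁺¹`. -/
lemma sum_units_periodic {N d q : ℕ} [NeZero N] [NeZero d] (hN : N = d * q)
    (h : ∀ x : ℕ, x.Coprime N ↔ x.Coprime d) (f : ℚ → ℂ)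
    (hf : ∀ (x : ℚ) (j : ℤ), f (x + d * j) = f x) :
    ∑ u : (ZMod N)ˣ, f (rep u.1) = q * ∑ v : (ZMod d)ˣ, f (rep v.1) := by
  have := sum_units_fiber hN h (fun x => f x)
  simp only [rep]
  rw [this, Finset.mul_sum]
  refine Finset.sum_congr rfl fun v _ => ?_
  rw [Finset.sum_congr rfl (g := fun _ => f (v.1.val : ℚ))]
  · simp
  · intro j _
    have := hf v.1.val j
    push_cast at this ⊢; exact this

lemma sum_zmod_periodic {N d q : ℕ} [NeZero N] [NeZero d] (hN : N = d * q) (f : ℚ → ℂ)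
    (hf : ∀ (x : ℚ) (j : ℤ), f (x + d * j) = f x) :
    ∑ u : ZMod N, f (rep u) = q * ∑ v : ZMod d, f (rep v) := by
  have h1 := sum_zmod_eq_sum_range (N := N) (fun x => f x)
  have h2 := sum_zmod_eq_sum_range (N := d) (fun x => f x)
  simp only [rep]
  rw [h1, h2, hN, sum_range_mul_add, Finset.mul_sum]
  refine Finset.sum_congr rfl fun v _ => ?_
  rw [Finset.sum_congr rfl (g := fun _ => f (v : ℚ))]
  · simp
  · intro j _
    have := hf v j
    push_cast at this ⊢; exact this

/-! ### Character sums modulo `p` -/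

/-- The Gauss sum `W(χ)`. -/
abbrev gaussW : ℂ := W p (χ p) 1

/-- The Ramanujan sum modulo `p`. -/
def ramanujan (c : ZMod p) : ℂ := if c = 0 then (p : ℂ) - 1 else -1

lemma exp_val_eq_stdAddChar (a : ℤ) (b : ZMod p) :
    Complex.exp (2 * Real.pi * Complex.I * a * b.val / p) = ZMod.stdAddChar ((a : ZMod p) * b) := by
  have := ZMod.stdAddChar_coe (N := p) (a * b.val)
  push_cast at this
  rw [ZMod.natCast_zmod_val] at this
  rw [this]; congr 1; ring

lemma sum_units_eq_sum_erase (f : ZMod p → ℂ) :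
    ∑ u : (ZMod p)ˣ, f u = (∑ x : ZMod p, f x) - f 0 := by
  rw [← Finset.sum_erase_eq_sub (Finset.mem_univ 0)]
  refine Finset.sum_bij (fun u _ => (u : ZMod p)) ?_ ?_ ?_ ?_
  · intro u _; simp
  · intro u _ v _ h; exact Units.ext h
  · intro x hx; simp at hx; exact ⟨Units.mk0 x hx, Finset.mem_univ _, rfl⟩
  · intros; rfl

lemma sum_units_stdAddChar (c : ZMod p) :
    ∑ u : (ZMod p)ˣ, ZMod.stdAddChar (c * u.1) = ramanujan p c := by
  rw [sum_units_eq_sum_erase p (fun x => ZMod.stdAddChar (c * x)), ramanujan]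
  have h := AddChar.sum_mulShift c (ZMod.isPrimitive_stdAddChar p)
  simp_rw [mul_comm c]
  rw [h]; split_ifs <;> simp [ZMod.card]

lemma W_one_eq (a : ℤ) : W p 1 a = ramanujan p a := by
  rw [W, ← sum_units_stdAddChar]
  refine Finset.sum_congr rfl fun u _ => ?_
  rw [exp_val_eq_stdAddChar, MulChar.one_apply_coe, one_mul]

lemma gaussW_eq : gaussW p = gaussSum (χ p) ZMod.stdAddChar := by
  rw [gaussW, W, gaussSum]
  have := sum_units_eq_sum_erase p (fun x => χ p x * ZMod.stdAddChar x)
  rw [MulChar.map_zero, zero_mul, sub_zero] at this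
  rw [← this]
  refine Finset.sum_congr rfl fun u _ => ?_
  rw [exp_val_eq_stdAddChar]; simp

variable {p}

lemma χ_eq (x : ZMod p) : χ p x = ((quadraticChar (ZMod p) x : ℤ) : ℂ) := rfl

lemma χ_sq {x : ZMod p} (hx : x ≠ 0) : χ p x * χ p x = 1 := by
  rw [χ_eq, ← sq]; exact_mod_cast quadraticChar_sq_one hx

lemma χ_mul_sq (y : ZMod p) {x : ZMod p} (hx : x ≠ 0) : χ p (y * x ^ 2) = χ p y := by
  rw [map_mul, sq, map_mul, χ_sq hx, mul_one]

lemma χ_inv (x : ZMod p) : χ p x⁻¹ = χ p x := by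
  rcases eq_or_ne x 0 with rfl | hx
  · simp
  · have h := χ_mul_sq x⁻¹ hx
    rw [← h]; congr 1; field_simp

lemma χ_ne_one (hp : p ≠ 2) : χ p ≠ 1 := by
  intro h
  obtain ⟨a, ha⟩ := quadraticChar_exists_neg_one (F := ZMod p) (by rwa [ZMod.ringChar_zmod_n])
  have h0 : a ≠ 0 := by rintro rfl; simp at ha
  have : χ p a = 1 := by rw [h]; exact MulChar.one_apply h0.isUnit
  rw [χ_eq, ha] at this; norm_num at this

lemma sum_χ (hp : p ≠ 2) : ∑ x : ZMod p, χ p x = 0 := MulChar.sum_eq_zero_of_ne_one (χ_ne_one hp)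

lemma sum_units_χ (hp : p ≠ 2) : ∑ u : (ZMod p)ˣ, χ p u = 0 := by
  rw [sum_units_eq_sum_erase p (fun x => χ p x), sum_χ hp, MulChar.map_zero, sub_zero]

lemma gaussW_ne_zero (hp : p ≠ 2) : gaussW p ≠ 0 := by
  rw [gaussW_eq]
  refine gaussSum_ne_zero_of_nontrivial ?_ (χ_ne_one hp) (ZMod.isPrimitive_stdAddChar p)
  rw [ZMod.card]; exact_mod_cast (Fact.out : p.Prime).ne_zero

/-- For `c ≠ 0` substitute `x ↦ c x` in the Gauss sum and use `χ(c)² = 1`; for `c = 0` both sides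
vanish because `χ` is nontrivial. Validity at `c = 0` spares later evaluations a case distinction.
-/
lemma sum_units_χ_mul_stdAddChar (hp : p ≠ 2) (c : ZMod p) :
    ∑ u : (ZMod p)ˣ, χ p u * ZMod.stdAddChar (c * u.1) = χ p c * gaussW p := by
  rcases eq_or_ne c 0 with rfl | hc
  · simp [sum_units_χ hp, MulChar.map_zero]
  · rw [gaussW_eq, gaussSum, ← Equiv.sum_comp (Equiv.mulLeft₀ c hc) (fun x => χ p x * ZMod.stdAddChar x),
      Finset.mul_sum]
    have := sum_units_eq_sum_erase p (fun x => χ p x * ZMod.stdAddChar (c * x))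
    rw [MulChar.map_zero, zero_mul, sub_zero] at this
    rw [this]
    refine Finset.sum_congr rfl fun x _ => ?_
    simp only [Equiv.mulLeft₀_apply, map_mul]
    rw [← mul_assoc, ← mul_assoc, χ_sq hc, one_mul]

end

/-! ### The twisting map as a formal sum, and functions of Fourier coefficients -/

section

section sums

variable (p : ℕ) [Fact p.Prime]

/-- With an arbitrary `Φ` in place of the slash operator, one expression serves both for the twisted
function and for each of its Fourier coefficients. -/
def twistSum1 (Φ : ℚ → ℚ → ℚ → ℚ → ℚ → ℚ → ℂ) : ℂ :=
  (p : ℂ) ^ (-11 : ℤ) *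
    ∑ a : (ZMod (p ^ 3))ˣ, ∑ b : (ZMod (p ^ 3))ˣ, ∑ x : (ZMod (p ^ 3))ˣ, ∑ z : ZMod (p ^ 4),
      chi p (a * b : ZMod (p ^ 3)) *
        Φ (rep z / p ^ 4) (-rep b.1 / p ^ 2) (-rep x⁻¹.1 / p)
          1 ((rep a.1 + rep x.1 * rep b.1) / p) 1

def twistSum2 (Φ : ℚ → ℚ → ℚ → ℚ → ℚ → ℚ → ℂ) : ℂ :=
  (p : ℂ) ^ (-11 : ℤ) *
    ∑ a : (ZMod (p ^ 3))ˣ, ∑ b : (ZMod (p ^ 3))ˣ,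
      ∑ x : (ZMod (p ^ 3))ˣ with red p x.1 ≠ 1, ∑ y : (ZMod (p ^ 3))ˣ with red p y.1 ≠ 1,
        chi p (a * b * x * y : ZMod (p ^ 3)) *
          Φ
            (-rep (a * b * (1 - (1 - (y : ZMod (p ^ 3)))⁻¹ * x) : ZMod (p ^ 3)) / p ^ 3)
            (-rep a.1 / p ^ 2)
            (-rep (a * (b : ZMod (p ^ 3))⁻¹ * (1 - (x : ZMod (p ^ 3)))⁻¹ : ZMod (p ^ 3)) / p)
            p (rep b.1 / p) 1

def twistSum3 (Φ : ℚ → ℚ → ℚ → ℚ → ℚ → ℚ → ℂ) : ℂ :=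
  (p : ℂ) ^ (-6 : ℤ) *
    ∑ a : (ZMod (p ^ 2))ˣ, ∑ b : (ZMod (p ^ 3))ˣ, ∑ z : (ZMod p)ˣ with z ≠ 1,
      chi p b.1 * chi p (1 - z : ZMod p) *
        Φ (-rep b.1 / p ^ 3) (rep a.1 / p ^ 2)
          (-(rep a.1 ^ 2 * rep b⁻¹.1 * rep z.1) / p)
          p 0 1

def twistSum4 (Φ : ℚ → ℚ → ℚ → ℚ → ℚ → ℚ → ℂ) : ℂ :=
  (p : ℂ) ^ (-10 : ℤ) *
    ∑ a : ZMod (p ^ 4), ∑ b : (ZMod (p ^ 3))ˣ, ∑ x : (ZMod (p ^ 4))ˣ,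
      chi p b.1 *
        Φ ((rep a * rep x.1 - rep b.1 * p) / p ^ 4) (rep a / p ^ 2) 0
          p (rep x.1 / p ^ 2) 1

def twistSum5 (Φ : ℚ → ℚ → ℚ → ℚ → ℚ → ℚ → ℂ) : ℂ :=
  (p : ℂ) ^ (-9 : ℤ) *
    ∑ a : (ZMod (p ^ 3))ˣ, ∑ b : (ZMod (p ^ 3))ˣ, ∑ x : ZMod (p ^ 3),
      chi p b.1 *
        Φ ((rep a.1 * rep x - rep b.1) / p ^ 3) (rep a.1 / p ^ 2) 0
          p (rep x / p) 1

def twistSum6 (Φ : ℚ → ℚ → ℚ → ℚ → ℚ → ℚ → ℂ) : ℂ :=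
  (p : ℂ) ^ (-6 : ℤ) *
    ∑ a : (ZMod (p ^ 2))ˣ, ∑ b : (ZMod (p ^ 2))ˣ, ∑ x : (ZMod p)ˣ,
      chi p b.1 * chi p x.1 *
        Φ (rep b.1 * (1 + rep x.1 * p) / p ^ 2) (rep a.1 / p ^ 2)
          (rep a.1 ^ 2 * rep b⁻¹.1 / p ^ 2)
          ((p : ℚ) ^ 2) 0 1

def twistSum7 (Φ : ℚ → ℚ → ℚ → ℚ → ℚ → ℚ → ℂ) : ℂ :=
  (p : ℂ) ^ (-7 : ℤ) *
    ∑ a : (ZMod (p ^ 3))ˣ, ∑ b : (ZMod p)ˣ, ∑ z : ZMod (p ^ 4),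
      chi p a.1 * chi p b.1 *
        Φ (rep z / p ^ 4) (rep b.1 / p) 0
          1 (-rep a.1 / p) p

def twistSum8 (Φ : ℚ → ℚ → ℚ → ℚ → ℚ → ℚ → ℂ) : ℂ :=
  (p : ℂ) ^ (-9 : ℤ) *
    ∑ a : (ZMod (p ^ 3))ˣ, ∑ b : (ZMod (p ^ 3))ˣ, ∑ z : (ZMod (p ^ 3))ˣ with red p z.1 ≠ 1,
      chi p (a * b * z * (1 - z) : ZMod (p ^ 3)) *
        Φ (rep (a * b * (1 - z) : ZMod (p ^ 3)) / p ^ 3) (rep a.1 / p) 0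
          p (rep b.1 / p) p

def twistSum9 (Φ : ℚ → ℚ → ℚ → ℚ → ℚ → ℚ → ℂ) : ℂ :=
  (p : ℂ) ^ (-6 : ℤ) *
    ∑ a : (ZMod (p ^ 2))ˣ, ∑ b : (ZMod p)ˣ, ∑ x : (ZMod p)ˣ,
      chi p b.1 *
        Φ (rep b.1 / p) 0 (rep x.1 / p)
          ((p : ℚ) ^ 2) (rep a.1) p

def twistSum10 (Φ : ℚ → ℚ → ℚ → ℚ → ℚ → ℚ → ℂ) : ℂ :=
  (p : ℂ) ^ (-6 : ℤ) *
    ∑ a : (ZMod (p ^ 2))ˣ, ∑ b : (ZMod p)ˣ,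
      chi p b.1 *
        Φ (rep b.1 / p) 0 0
          ((p : ℚ) ^ 2) (rep a.1) ((p : ℚ) ^ 2)

def twistSum11 (Φ : ℚ → ℚ → ℚ → ℚ → ℚ → ℚ → ℂ) : ℂ :=
  (p : ℂ) ^ (-10 : ℤ) *
    ∑ a : (ZMod (p ^ 2))ˣ, ∑ b : (ZMod (p ^ 4))ˣ, ∑ x : ZMod (p ^ 3), ∑ z : ZMod (p ^ 4),
      chi p a.1 * chi p b.1 *
        Φ (rep z / p ^ 4) ((rep a.1 * p + rep x * rep b.1) / p ^ 3) (rep x / p ^ 2)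
          1 (rep b.1 / p ^ 2) ((p : ℚ)⁻¹)

def twistSum12 (Φ : ℚ → ℚ → ℚ → ℚ → ℚ → ℚ → ℂ) : ℂ :=
  (p : ℂ) ^ (-12 : ℤ) *
    ∑ a : (ZMod (p ^ 4))ˣ, ∑ b : (ZMod (p ^ 3))ˣ, ∑ y : ZMod (p ^ 4),
      ∑ z : (ZMod (p ^ 3))ˣ with red p z.1 ≠ 1,
        chi p a.1 * chi p (b * z * (1 - z) : ZMod (p ^ 3)) *
          Φ
            (rep a.1 * (rep y - rep b.1 * (1 - rep z.1) * p) / p ^ 4)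
            (rep y / p ^ 3)
            (rep a⁻¹.1 * (rep y + rep b.1 * p) / p ^ 2)
            p (rep a.1 / p ^ 2) ((p : ℚ)⁻¹)

def twistSum13 (Φ : ℚ → ℚ → ℚ → ℚ → ℚ → ℚ → ℂ) : ℂ :=
  (p : ℂ) ^ (-6 : ℤ) *
    ∑ a : (ZMod (p ^ 2))ˣ, ∑ b : (ZMod (p ^ 3))ˣ, ∑ x : (ZMod p)ˣ,
      chi p b.1 * chi p x.1 *
        Φ (rep b.1 * (1 + rep x.1) / p) (rep a.1 / p ^ 2)
          (rep a.1 ^ 2 * rep b⁻¹.1 / p ^ 3)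
          ((p : ℚ) ^ 2) 0 ((p : ℚ)⁻¹)

def twistSum14 (Φ : ℚ → ℚ → ℚ → ℚ → ℚ → ℚ → ℂ) : ℂ :=
  (p : ℂ) ^ (-6 : ℤ) *
    ∑ a : (ZMod (p ^ 2))ˣ, ∑ b : (ZMod p)ˣ, ∑ x : ZMod (p ^ 4),
      chi p b.1 *
        Φ (rep b.1 / p) (rep a.1 / p ^ 2) (rep x / p ^ 4)
          ((p : ℚ) ^ 2) 0 (((p : ℚ) ^ 2)⁻¹)


/-- The formal sum underlying the twisting map, with `Φ q₁ q₂ q₃ r s t` in place of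
`F |_k [q₁, q₂, q₃; r, s, t]`. -/
def twistSum (Φ : ℚ → ℚ → ℚ → ℚ → ℚ → ℚ → ℂ) : ℂ :=
  twistSum1 p Φ + twistSum2 p Φ + twistSum3 p Φ + twistSum4 p Φ + twistSum5 p Φ +
  twistSum6 p Φ + twistSum7 p Φ + twistSum8 p Φ + twistSum9 p Φ + twistSum10 p Φ +
  twistSum11 p Φ + twistSum12 p Φ + twistSum13 p Φ + twistSum14 p Φ

lemma twist_eq_twistSum (k : ℕ) (F : Matrix (Fin 2) (Fin 2) ℂ → ℂ) (Z : Matrix (Fin 2) (Fin 2) ℂ) :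
    twist p k F Z =
      twistSum p (fun q₁ q₂ q₃ r s t => slashQP k F q₁ q₂ q₃ !![r, s; 0, t] Z) := rfl

/-- Finite linear combinations of convergent expansions converge. The conditions on `r` and `t`
record what the fourteen shapes of `P` share; that `r` is a nonnegative power of `p` matters later
for divisibility by `N`. -/
lemma hasSum_twistSum {ι : Type*} {Φ : ι → ℚ → ℚ → ℚ → ℚ → ℚ → ℚ → ℂ}
    {Ψ : ℚ → ℚ → ℚ → ℚ → ℚ → ℚ → ℂ}
    (h : ∀ q₁ q₂ q₃ r s t, (∃ i : ℕ, r = (p : ℚ) ^ i) → t ≠ 0 →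
      HasSum (fun i => Φ i q₁ q₂ q₃ r s t) (Ψ q₁ q₂ q₃ r s t)) :
    HasSum (fun i => twistSum p (Φ i)) (twistSum p Ψ) := by
  have hp : (p : ℚ) ≠ 0 := by exact_mod_cast (Fact.out : p.Prime).ne_zero
  have hp1 : (p : ℚ)⁻¹ ≠ 0 := inv_ne_zero hp
  have hp2 : (p : ℚ) ^ 2 ≠ 0 := pow_ne_zero 2 hp
  have hp3 : ((p : ℚ) ^ 2)⁻¹ ≠ 0 := inv_ne_zero hp2
  have h1 : ∃ i : ℕ, (1 : ℚ) = p ^ i := ⟨0, by simp⟩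
  have h2 : ∃ i : ℕ, (p : ℚ) = p ^ i := ⟨1, by simp⟩
  have h3 : ∃ i : ℕ, (p : ℚ) ^ 2 = p ^ i := ⟨2, rfl⟩
  unfold twistSum
  refine HasSum.add (HasSum.add (HasSum.add (HasSum.add (HasSum.add (HasSum.add (HasSum.add
    (HasSum.add (HasSum.add (HasSum.add (HasSum.add (HasSum.add (HasSum.add
    ?_ ?_) ?_) ?_) ?_) ?_) ?_) ?_) ?_) ?_) ?_) ?_) ?_) ?_
  · exact HasSum.mul_left _ (hasSum_sum fun _ _ => hasSum_sum fun _ _ => hasSum_sum fun _ _ =>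
      hasSum_sum fun _ _ => HasSum.mul_left _ (h _ _ _ _ _ _ h1 one_ne_zero))
  · exact HasSum.mul_left _ (hasSum_sum fun _ _ => hasSum_sum fun _ _ => hasSum_sum fun _ _ =>
      hasSum_sum fun _ _ => HasSum.mul_left _ (h _ _ _ _ _ _ h2 one_ne_zero))
  · exact HasSum.mul_left _ (hasSum_sum fun _ _ => hasSum_sum fun _ _ => hasSum_sum fun _ _ =>
      HasSum.mul_left _ (h _ _ _ _ _ _ h2 one_ne_zero))
  · exact HasSum.mul_left _ (hasSum_sum fun _ _ => hasSum_sum fun _ _ => hasSum_sum fun _ _ =>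
      HasSum.mul_left _ (h _ _ _ _ _ _ h2 one_ne_zero))
  · exact HasSum.mul_left _ (hasSum_sum fun _ _ => hasSum_sum fun _ _ => hasSum_sum fun _ _ =>
      HasSum.mul_left _ (h _ _ _ _ _ _ h2 one_ne_zero))
  · exact HasSum.mul_left _ (hasSum_sum fun _ _ => hasSum_sum fun _ _ => hasSum_sum fun _ _ =>
      HasSum.mul_left _ (h _ _ _ _ _ _ h3 one_ne_zero))
  · exact HasSum.mul_left _ (hasSum_sum fun _ _ => hasSum_sum fun _ _ => hasSum_sum fun _ _ =>
      HasSum.mul_left _ (h _ _ _ _ _ _ h1 hp))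
  · exact HasSum.mul_left _ (hasSum_sum fun _ _ => hasSum_sum fun _ _ => hasSum_sum fun _ _ =>
      HasSum.mul_left _ (h _ _ _ _ _ _ h2 hp))
  · exact HasSum.mul_left _ (hasSum_sum fun _ _ => hasSum_sum fun _ _ => hasSum_sum fun _ _ =>
      HasSum.mul_left _ (h _ _ _ _ _ _ h3 hp))
  · exact HasSum.mul_left _ (hasSum_sum fun _ _ => hasSum_sum fun _ _ =>
      HasSum.mul_left _ (h _ _ _ _ _ _ h3 hp2))
  · exact HasSum.mul_left _ (hasSum_sum fun _ _ => hasSum_sum fun _ _ => hasSum_sum fun _ _ =>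
      hasSum_sum fun _ _ => HasSum.mul_left _ (h _ _ _ _ _ _ h1 hp1))
  · exact HasSum.mul_left _ (hasSum_sum fun _ _ => hasSum_sum fun _ _ => hasSum_sum fun _ _ =>
      hasSum_sum fun _ _ => HasSum.mul_left _ (h _ _ _ _ _ _ h2 hp1))
  · exact HasSum.mul_left _ (hasSum_sum fun _ _ => hasSum_sum fun _ _ => hasSum_sum fun _ _ =>
      HasSum.mul_left _ (h _ _ _ _ _ _ h3 hp1))
  · exact HasSum.mul_left _ (hasSum_sum fun _ _ => hasSum_sum fun _ _ => hasSum_sum fun _ _ =>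
      HasSum.mul_left _ (h _ _ _ _ _ _ h3 hp3))

/-- The zero function is an empty sum, so `hasSum_twistSum` over an empty index type gives the claim
without revisiting the fourteen sums. -/
lemma twistSum_eq_zero {Ψ : ℚ → ℚ → ℚ → ℚ → ℚ → ℚ → ℂ}
    (h : ∀ q₁ q₂ q₃ r s t, (∃ i : ℕ, r = (p : ℚ) ^ i) → t ≠ 0 → Ψ q₁ q₂ q₃ r s t = 0) :
    twistSum p Ψ = 0 := by
  have h1 : HasSum (fun i : Empty => twistSum p ((Empty.elim : Empty → ℚ → ℚ → ℚ → ℚ → ℚ → ℚ → ℂ) i))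
      (twistSum p Ψ) := by
    refine hasSum_twistSum p fun q₁ q₂ q₃ r s t hr ht => ?_
    rw [h q₁ q₂ q₃ r s t hr ht]
    exact hasSum_empty
  exact h1.unique hasSum_empty

end sums

/-- The coefficient index of `S = T[P⁻¹]`, for `T = [α, m/2; m/2, γ]` and `P = [r, s; 0, t]`. -/
def coefAt (A : ℚ → ℚ → ℚ → ℂ) (r s t α m γ : ℚ) : ℂ :=
  A (α / r ^ 2) (m / (r * t) - 2 * α * s / (r ^ 2 * t))
    (γ / t ^ 2 - m * s / (r * t ^ 2) + α * s ^ 2 / (r ^ 2 * t ^ 2))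

/-- The coefficient at `T = [α, m/2; m/2, γ]` of `F |_k [Q; P]` for a function `F` with Fourier
coefficients `A`. -/
def coefQP (A : ℚ → ℚ → ℚ → ℂ) (k : ℕ) (α m γ q₁ q₂ q₃ r s t : ℚ) : ℂ :=
  ((r * t : ℚ) : ℂ) ^ k * (coefAt A r s t α m γ *
    e (α / r ^ 2 * q₁ + (m / (r * t) - 2 * α * s / (r ^ 2 * t)) * q₂ +
      (γ / t ^ 2 - m * s / (r * t ^ 2) + α * s ^ 2 / (r ^ 2 * t ^ 2)) * q₃))

/-- Functions on symmetric matrices `[α, m/2; m/2, γ]` that are supported on half-integral ones and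
invariant under `S ↦ S[1, n; 0, 1]`. -/
structure IsCoefFun (A : ℚ → ℚ → ℚ → ℂ) : Prop where
  integral : ∀ α m γ, A α m γ ≠ 0 → ∃ a b c : ℤ, α = a ∧ m = b ∧ γ = c
  translate : ∀ α m γ (n : ℤ), A α (m + 2 * α * n) (γ + m * n + α * n ^ 2) = A α m γ

variable {A : ℚ → ℚ → ℚ → ℂ}

/-- `[r, s + n t; 0, t] = [1, n; 0, 1] [r, s; 0, t]`, so `T[P⁻¹]` changes by an integral unipotent
matrix. Thus `s` matters only modulo `t`. -/
lemma IsCoefFun.coefAt_add (hA : IsCoefFun A) {r t : ℚ} (ht : t ≠ 0) (hr : r ≠ 0) (s : ℚ) (n : ℤ)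
    (α m γ : ℚ) : coefAt A r (s + n * t) t α m γ = coefAt A r s t α m γ := by
  rw [coefAt, coefAt, ← hA.translate (α / r ^ 2) _ _ n]
  congr 1 <;> field_simp <;> ring

lemma IsCoefFun.coefAt_eq_of (hA : IsCoefFun A) {r t : ℚ} (ht : t ≠ 0) (hr : r ≠ 0) {s s' : ℚ}
    (n : ℤ) (h : s - s' = n * t) (α m γ : ℚ) :
    coefAt A r s t α m γ = coefAt A r s' t α m γ := by
  rw [← hA.coefAt_add ht hr s' n, ← h]; congr 1; ring

/-- Inverts `S = T[P⁻¹]` to `T = S[P]` in coordinates. Divisibility of the entries of `T` and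
congruences for `s` are both read off from the integrality of `S`. -/
lemma IsCoefFun.coefAt_integral (hA : IsCoefFun A) {r s t : ℚ} (hr : r ≠ 0) (ht : t ≠ 0)
    {α m γ : ℚ} (h : coefAt A r s t α m γ ≠ 0) :
    ∃ a b c : ℤ, α = r ^ 2 * a ∧ m = r * t * b + 2 * r * s * a ∧
      γ = t ^ 2 * c + s * t * b + s ^ 2 * a ∧ α / r ^ 2 = a ∧
      m / (r * t) - 2 * α * s / (r ^ 2 * t) = b ∧
      γ / t ^ 2 - m * s / (r * t ^ 2) + α * s ^ 2 / (r ^ 2 * t ^ 2) = c := by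
  obtain ⟨a, b, c, ha, hb, hc⟩ := hA.integral _ _ _ h
  refine ⟨a, b, c, ?_, ?_, ?_, ha, hb, hc⟩
  · rw [← ha]; field_simp
  · rw [← ha, ← hb]; field_simp; ring
  · rw [← ha, ← hb, ← hc]; field_simp; ring

/-- `c` is supported on `(p⁴ a, pʲ b, g)` with integers `a, b, g`, where its value is
`W(χ) f(a, b, g)`. -/
structure IsTwistCoef (p : ℕ) [Fact p.Prime] (j : ℕ) (c : ℚ → ℚ → ℚ → ℂ) (f : ℤ → ℤ → ℤ → ℂ) :
    Prop where
  support : ∀ α m γ, c α m γ ≠ 0 → ∃ a b g : ℤ, α = p ^ 4 * a ∧ m = p ^ j * b ∧ γ = g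
  eval : ∀ a b g : ℤ, c (p ^ 4 * a) (p ^ j * b) g = gaussW p * f a b g

variable {p : ℕ} [Fact p.Prime]

lemma IsTwistCoef.sum {ι : Type*} {s : Finset ι} {j : ℕ} {c : ι → ℚ → ℚ → ℚ → ℂ}
    {f : ι → ℤ → ℤ → ℤ → ℂ} (h : ∀ i ∈ s, IsTwistCoef p j (c i) (f i)) :
    IsTwistCoef p j (fun α m γ => ∑ i ∈ s, c i α m γ) (fun a b g => ∑ i ∈ s, f i a b g) where
  support α m γ hne := by
    obtain ⟨i, hi, hne⟩ := Finset.exists_ne_zero_of_sum_ne_zero hne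
    exact (h i hi).support _ _ _ hne
  eval a b g := by
    rw [Finset.mul_sum]
    exact Finset.sum_congr rfl fun i hi => (h i hi).eval a b g

lemma IsTwistCoef.const_mul {j : ℕ} {c : ℚ → ℚ → ℚ → ℂ} {f : ℤ → ℤ → ℤ → ℂ}
    (h : IsTwistCoef p j c f) (x : ℂ) :
    IsTwistCoef p j (fun α m γ => x * c α m γ) (fun a b g => x * f a b g) where
  support α m γ hne := h.support _ _ _ (right_ne_zero_of_mul hne)
  eval a b g := by rw [h.eval]; ring

lemma IsTwistCoef.congr {j : ℕ} {c c' : ℚ → ℚ → ℚ → ℂ} {f f' : ℤ → ℤ → ℤ → ℂ}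
    (h : IsTwistCoef p j c f) (hc : ∀ α m γ, c' α m γ = c α m γ)
    (hf : ∀ a b g, f' a b g = f a b g) : IsTwistCoef p j c' f' where
  support α m γ hne := h.support _ _ _ (by rwa [← hc])
  eval a b g := by rw [hc, hf, h.eval]

/-- The contribution of all terms with the same matrix `P = [r, s; 0, t]`: the coefficient at
`S = T[P⁻¹]` times an exponential sum depending on the integral matrix `S`. -/
lemma IsTwistCoef.of_coefAt (hA : IsCoefFun A) {r s t : ℚ} (hr : r ≠ 0) (ht : t ≠ 0) {j : ℕ}
    (J : ℚ → ℚ → ℚ → ℂ) (h : ℤ → ℤ → ℤ → ℂ)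
    (support : ∀ a b c : ℤ, J a b c ≠ 0 → ∃ a' b' g' : ℤ, r ^ 2 * a = (p : ℚ) ^ 4 * a' ∧
      r * t * b + 2 * r * s * a = (p : ℚ) ^ j * b' ∧ t ^ 2 * c + s * t * b + s ^ 2 * a = g')
    (eval : ∀ a b c a' b' g' : ℤ, r ^ 2 * a = (p : ℚ) ^ 4 * a' →
      r * t * b + 2 * r * s * a = (p : ℚ) ^ j * b' → t ^ 2 * c + s * t * b + s ^ 2 * a = g' →
      J a b c = gaussW p * h a' b' g') :
    IsTwistCoef p j
      (fun α m γ => coefAt A r s t α m γ * J (α / r ^ 2) (m / (r * t) - 2 * α * s / (r ^ 2 * t))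
        (γ / t ^ 2 - m * s / (r * t ^ 2) + α * s ^ 2 / (r ^ 2 * t ^ 2)))
      (fun a b g => h a b g * coefAt A r s t (p ^ 4 * a) (p ^ j * b) g) where
  support α m γ hne := by
    obtain ⟨a, b, c, h1, h2, h3, ha, hb, hc⟩ :=
      hA.coefAt_integral hr ht (left_ne_zero_of_mul hne)
    rw [ha, hb, hc] at hne
    rw [h1, h2, h3]
    exact support a b c (right_ne_zero_of_mul hne)
  eval a' b' g' := by
    -- Where the coefficient vanishes both sides do; elsewhere `S` is integral, which is why `eval`
    -- is only required at integers.
    by_cases h0 : coefAt A r s t (p ^ 4 * a') (p ^ j * b') g' = 0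
    · rw [h0]; ring
    obtain ⟨a, b, c, h1, h2, h3, ha, hb, hc⟩ := hA.coefAt_integral hr ht h0
    rw [ha, hb, hc, eval a b c a' b' g' h1.symm h2.symm h3.symm]; ring

/-- As `IsTwistCoef.of_coefAt`, for a finite linear combination `L` of terms `[q₁, q₂, q₃; P]`. -/
lemma IsTwistCoef.of_functional (hA : IsCoefFun A) (k : ℕ) {r s t : ℚ} (hr : r ≠ 0) (ht : t ≠ 0)
    {j : ℕ} (L : (ℚ → ℚ → ℚ → ℂ) → ℂ) (hL : ∀ x Φ, L (fun a b c => x * Φ a b c) = x * L Φ)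
    (h : ℤ → ℤ → ℤ → ℂ)
    (support : ∀ a b c : ℤ, L (fun q₁ q₂ q₃ => e (a * q₁ + b * q₂ + c * q₃)) ≠ 0 →
      ∃ a' b' g' : ℤ, r ^ 2 * a = (p : ℚ) ^ 4 * a' ∧
        r * t * b + 2 * r * s * a = (p : ℚ) ^ j * b' ∧ t ^ 2 * c + s * t * b + s ^ 2 * a = g')
    (eval : ∀ a b c a' b' g' : ℤ, r ^ 2 * a = (p : ℚ) ^ 4 * a' →
      r * t * b + 2 * r * s * a = (p : ℚ) ^ j * b' → t ^ 2 * c + s * t * b + s ^ 2 * a = g' →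
      L (fun q₁ q₂ q₃ => e (a * q₁ + b * q₂ + c * q₃)) = gaussW p * h a' b' g') :
    IsTwistCoef p j (fun α m γ => L (fun q₁ q₂ q₃ => coefQP A k α m γ q₁ q₂ q₃ r s t))
      (fun a b g => ((r * t : ℚ) : ℂ) ^ k * h a b g *
        coefAt A r s t (p ^ 4 * a) (p ^ j * b) g) := by
  -- The determinant factor and the coefficient do not involve `Q`, so homogeneity of `L` is enough
  -- to pull them out.
  refine ((IsTwistCoef.of_coefAt hA hr ht (fun x y z => L (fun q₁ q₂ q₃ =>
    e (x * q₁ + y * q₂ + z * q₃))) h support eval).const_mul (((r * t : ℚ) : ℂ) ^ k)).congr ?_ ?_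
  · intro α m γ
    simp only [coefQP, hL]
  · intros; ring

end

/-! ### Operators 14, 10 and 5 -/

section

variable (p : ℕ) [Fact p.Prime]

lemma natCast_prime_ne_zero (R : Type*) [AddMonoidWithOne R] [CharZero R] : (p : R) ≠ 0 := by
  exact_mod_cast (Fact.out : p.Prime).ne_zero

lemma rep_eq_intCast {n : ℕ} (x : ZMod n) : rep x = ((x.val : ℤ) : ℚ) := by simp [rep]

lemma red_self (x : ZMod p) : red p x = x := by simp [red]

lemma intCast_val_eq_red {n : ℕ} (x : ZMod n) : ((x.val : ℤ) : ZMod p) = red p x := by simp [red]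

lemma not_dvd_val_unit {n : ℕ} (u : (ZMod (p ^ (n + 1)))ˣ) : ¬ (p : ℤ) ∣ u.1.val := by
  have h := ZMod.val_coe_unit_coprime u
  rw [coprime_pow_succ_iff'] at h
  intro hd
  have hd : p ∣ u.1.val := by exact_mod_cast hd
  have := Nat.dvd_gcd hd dvd_rfl
  rw [h] at this
  exact (Fact.out : p.Prime).one_lt.ne' (Nat.dvd_one.1 this)

lemma isCoprime_val_unit {n : ℕ} (u : (ZMod (p ^ (n + 1)))ˣ) : IsCoprime (p : ℤ) u.1.val := by
  rw [Nat.isCoprime_iff_coprime, Nat.coprime_comm, ← coprime_pow_succ_iff' p n]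
  exact ZMod.val_coe_unit_coprime u

lemma red_unit_ne_zero {n : ℕ} (u : (ZMod (p ^ (n + 1)))ˣ) : red p u.1 ≠ 0 := by
  rw [← intCast_val_eq_red, Ne, ZMod.intCast_zmod_eq_zero_iff_dvd]
  exact not_dvd_val_unit p u

lemma sum_chi_mul_e (hp : p ≠ 2) (c : ℤ) :
    ∑ u : (ZMod p)ˣ, chi p u.1 * e (c * rep u.1 / p) = χ p c * gaussW p := by
  rw [← sum_units_χ_mul_stdAddChar hp]
  refine Finset.sum_congr rfl fun u _ => ?_
  rw [e_rep, chi, red_self]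

lemma sum_e_unit (c : ℤ) : ∑ u : (ZMod p)ˣ, e (c * rep u.1 / p) = ramanujan p c := by
  rw [← sum_units_stdAddChar]
  exact Finset.sum_congr rfl fun u _ => e_rep _ _

lemma sum_chi_mul_e_pow_eq_zero (n : ℕ) {c : ℤ} (hc : ¬ (p : ℤ) ^ n ∣ c) :
    ∑ u : (ZMod (p ^ (n + 1)))ˣ, chi p u.1 * e (c * rep u.1 / p ^ (n + 1)) = 0 :=
  sum_units_red_mul_e_eq_zero p n (fun x => χ p x) hc

lemma sum_chi_mul_e_pow (hp : p ≠ 2) (n : ℕ) (c : ℤ) :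
    ∑ u : (ZMod (p ^ (n + 1)))ˣ, chi p u.1 * e (((p : ℤ) ^ n * c : ℤ) * rep u.1 / p ^ (n + 1)) =
      (p : ℂ) ^ n * (χ p c * gaussW p) := by
  rw [← sum_units_χ_mul_stdAddChar hp]
  exact sum_units_red_mul_e p n (fun x => χ p x) c

lemma sum_e_pow_eq_zero (n : ℕ) {c : ℤ} (hc : ¬ (p : ℤ) ^ n ∣ c) :
    ∑ u : (ZMod (p ^ (n + 1)))ˣ, e (c * rep u.1 / p ^ (n + 1)) = 0 := by
  simpa using sum_units_red_mul_e_eq_zero p n (fun _ => 1) hc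

lemma sum_e_pow (n : ℕ) (c : ℤ) :
    ∑ u : (ZMod (p ^ (n + 1)))ˣ, e (((p : ℤ) ^ n * c : ℤ) * rep u.1 / p ^ (n + 1)) =
      (p : ℂ) ^ n * ramanujan p c := by
  rw [← sum_units_stdAddChar]
  simpa using sum_units_red_mul_e p n (fun _ => 1) c

lemma sum_zmod_e_pow (n : ℕ) (c : ℤ) :
    ∑ z : ZMod (p ^ n), e (c * rep z / p ^ n) = if (p : ℤ) ^ n ∣ c then (p : ℂ) ^ n else 0 := by
  have := sum_zmod_e (N := p ^ n) c
  push_cast at this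
  exact this

lemma sum_units_chi_periodic (n : ℕ) (G : ZMod p → ℂ) (f : ℚ → ℂ)
    (hf : ∀ (x : ℚ) (j : ℤ), f (x + p * j) = f x) :
    ∑ u : (ZMod (p ^ (n + 1)))ˣ, G (red p u.1) * f (rep u.1) =
      (p : ℂ) ^ n * ∑ v : (ZMod p)ˣ, G v * f (rep v.1) := by
  rw [sum_units_lift p n (fun x y => G y * f x), Finset.mul_sum]
  refine Finset.sum_congr rfl fun v _ => ?_
  rw [Finset.sum_congr rfl (g := fun _ => G v * f (rep v.1))]
  · simp
  · intro j _
    have := hf (rep v.1) j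
    push_cast at this
    rw [this]

lemma sum_mul_sum_mul_sum {ι κ μ : Type*} [Fintype ι] [Fintype κ] [Fintype μ] (f : ι → ℂ)
    (g : κ → ℂ) (h : μ → ℂ) :
    ∑ i, ∑ j, ∑ l, f i * (g j * h l) = (∑ i, f i) * ((∑ j, g j) * ∑ l, h l) := by
  simp_rw [← Finset.mul_sum, ← Finset.sum_mul]

lemma sum_mul_sum' {ι κ : Type*} [Fintype ι] [Fintype κ] (f : ι → ℂ) (g : κ → ℂ) :
    ∑ i, ∑ j, f i * g j = (∑ i, f i) * ∑ j, g j := by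
  simp_rw [← Finset.mul_sum, ← Finset.sum_mul]

lemma zpow_neg_natCast_prime (p n : ℕ) : (p : ℂ) ^ (-(n : ℤ)) = ((p : ℂ) ^ n)⁻¹ := by
  rw [_root_.zpow_neg, zpow_natCast]

lemma zpow_sub_natCast_prime (k n : ℕ) : (p : ℂ) ^ ((k : ℤ) - n) = (p : ℂ) ^ k / (p : ℂ) ^ n := by
  rw [zpow_sub₀ (natCast_prime_ne_zero p ℂ), zpow_natCast, zpow_natCast]

variable {p} {A : ℚ → ℚ → ℚ → ℂ}

/-- Each parameter occurs in a single entry of `Q`, so the sum is a product: a sum over units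
forcing `p ∣ b`, a Gauss sum, and a full sum forcing `p⁴ ∣ c`. For `P = diag(p², p⁻²)` these
conditions make the entries of `T = S[P]` integral with `p ∣ m`. -/
lemma isTwistCoef14 (hp : p ≠ 2) (hA : IsCoefFun A) (k : ℕ) :
    IsTwistCoef p 1 (fun α m γ => twistSum14 p (coefQP A k α m γ))
      (fun a b g => (p : ℂ)⁻¹ * χ p a * ramanujan p b *
        coefAt A (p ^ 2) 0 (((p : ℚ) ^ 2)⁻¹) (p ^ 4 * a) (p ^ 1 * b) g) := by
  have hq : (p : ℚ) ≠ 0 := natCast_prime_ne_zero p ℚ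
  have hc : (p : ℂ) ≠ 0 := natCast_prime_ne_zero p ℂ
  let L : (ℚ → ℚ → ℚ → ℂ) → ℂ := fun Φ =>
    ∑ a : (ZMod (p ^ 2))ˣ, ∑ b : (ZMod p)ˣ, ∑ x : ZMod (p ^ 4),
      chi p b.1 * Φ (rep b.1 / p) (rep a.1 / p ^ 2) (rep x / p ^ 4)
  have hL : ∀ a b c : ℤ, L (fun q₁ q₂ q₃ => e (a * q₁ + b * q₂ + c * q₃)) =
      (∑ u : (ZMod (p ^ 2))ˣ, e (b * rep u.1 / p ^ 2)) * (χ p a * gaussW p *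
        ∑ x : ZMod (p ^ 4), e (c * rep x / p ^ 4)) := by
    intro a b c
    rw [← sum_chi_mul_e p hp, ← sum_mul_sum_mul_sum]
    refine Finset.sum_congr rfl fun _ _ => Finset.sum_congr rfl fun _ _ =>
      Finset.sum_congr rfl fun _ _ => ?_
    dsimp only; rw [e_add, e_add]; ring_nf
  refine ((IsTwistCoef.of_functional hA k (r := p ^ 2) (s := 0) (t := ((p : ℚ) ^ 2)⁻¹)
    (by positivity) (by positivity) L ?_
    (fun a b _ => (p : ℂ) ^ 5 * χ p a * ramanujan p b) ?_ ?_).const_mul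
      ((p : ℂ) ^ (-6 : ℤ))).congr (fun _ _ _ => rfl) ?_
  · intro x Φ
    simp only [L, Finset.mul_sum, mul_left_comm]
  · intro a b c h
    rw [hL, sum_zmod_e_pow] at h
    have h3 := right_ne_zero_of_mul (right_ne_zero_of_mul h)
    rw [ite_ne_right_iff] at h3
    obtain ⟨c, rfl⟩ := h3.1
    obtain ⟨b, rfl⟩ : (p : ℤ) ^ 1 ∣ b := by
      by_contra hb; exact h (by rw [sum_e_pow_eq_zero p 1 hb, zero_mul])
    refine ⟨a, b, c, ?_, ?_, ?_⟩ <;> push_cast <;> field_simp <;> ring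
  · intro a b c a' b' g' h1 h2 h3
    field_simp at h1 h2 h3
    obtain rfl : a = a' := by exact_mod_cast h1
    obtain rfl : b = (p : ℤ) ^ 1 * b' := by
      have : (b : ℚ) = p * b' := by linear_combination h2
      rw [pow_one]; exact_mod_cast this
    obtain rfl : c = (p : ℤ) ^ 4 * g' := by
      have : (c : ℚ) = p ^ 4 * g' := by linear_combination h3
      exact_mod_cast this
    rw [hL, sum_e_pow p 1, sum_zmod_e_pow, if_pos (dvd_mul_right _ _)]
    ring
  · intro a b g
    rw [mul_inv_cancel₀ (by positivity : (p : ℚ) ^ 2 ≠ 0),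
      show (-6 : ℤ) = -(6 : ℕ) from rfl, zpow_neg_natCast_prime]
    field_simp
    simp

/-- Only `q₁` is nonzero, so a bare Gauss sum appears; the shape of `P` alone makes `T` divisible
enough, and the sum over `s` remains. -/
lemma isTwistCoef10 (hp : p ≠ 2) (hA : IsCoefFun A) (k : ℕ) :
    IsTwistCoef p 2 (fun α m γ => twistSum10 p (coefQP A k α m γ))
      (fun a b g => (p : ℂ) ^ (4 * (k : ℤ) - 6) * χ p a * ∑ u : (ZMod (p ^ 2))ˣ,
        coefAt A (p ^ 2) (rep u.1) (p ^ 2) (p ^ 4 * a) (p ^ 2 * b) g) := by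
  have hq : (p : ℚ) ≠ 0 := natCast_prime_ne_zero p ℚ
  have hc : (p : ℂ) ≠ 0 := natCast_prime_ne_zero p ℂ
  let L : (ℚ → ℚ → ℚ → ℂ) → ℂ := fun Φ => ∑ b : (ZMod p)ˣ, chi p b.1 * Φ (rep b.1 / p) 0 0
  have hL : ∀ a b c : ℤ, L (fun q₁ q₂ q₃ => e (a * q₁ + b * q₂ + c * q₃)) =
      χ p a * gaussW p := by
    intro a b c
    rw [← sum_chi_mul_e p hp]
    refine Finset.sum_congr rfl fun _ _ => ?_
    dsimp only; ring_nf
  refine ((IsTwistCoef.sum (s := Finset.univ) fun (u : (ZMod (p ^ 2))ˣ) _ =>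
    IsTwistCoef.of_functional hA k (r := p ^ 2) (s := rep u.1) (t := (p : ℚ) ^ 2)
    (by positivity) (by positivity) L ?_
    (fun a _ _ => χ p a) ?_ ?_).const_mul ((p : ℂ) ^ (-6 : ℤ))).congr (fun _ _ _ => rfl) ?_
  · intro x Φ
    simp only [L, Finset.mul_sum, mul_left_comm]
  · intro a b c h
    rw [rep_eq_intCast]
    refine ⟨a, p ^ 2 * b + 2 * u.1.val * a, p ^ 4 * c + u.1.val * p ^ 2 * b + u.1.val ^ 2 * a,
      ?_, ?_, ?_⟩ <;> push_cast <;> ring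
  · intro a b c a' b' g' h1 h2 h3
    obtain rfl : a = a' := by
      have : (a : ℚ) = a' := mul_left_cancel₀ (pow_ne_zero 4 hq) (by linear_combination h1)
      exact_mod_cast this
    rw [hL, mul_comm]
  · intro a b g
    simp only [Finset.mul_sum]
    refine Finset.sum_congr rfl fun u _ => ?_
    rw [show (4 * (k : ℤ) - 6) = ((4 * k : ℕ) : ℤ) - (6 : ℕ) by push_cast; ring,
      zpow_sub_natCast_prime, show (-6 : ℤ) = -(6 : ℕ) from rfl, zpow_neg_natCast_prime]
    push_cast
    field_simp
    ring

/-- The phase separates in the two parameters of `Q`. The sum with `χ` forces `p² ∣ a`, after which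
the other one forces `p² ∣ a x + p b`. As `t = 1`, the parameter `x` of `s = x/p` then matters only
modulo `p`. -/
lemma isTwistCoef5 (hp : p ≠ 2) (hA : IsCoefFun A) (k : ℕ) :
    IsTwistCoef p 2 (fun α m γ => twistSum5 p (coefQP A k α m γ))
      (fun a b g => (p : ℂ) ^ ((k : ℤ) - 3) * χ p (-a : ℤ) * ∑ x : ZMod p,
        ramanujan p (b - x * a) * coefAt A p (rep x / p) 1 (p ^ 4 * a) (p ^ 2 * b) g) := by
  have hq : (p : ℚ) ≠ 0 := natCast_prime_ne_zero p ℚ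
  have hc : (p : ℂ) ≠ 0 := natCast_prime_ne_zero p ℂ
  let L : ZMod (p ^ 3) → (ℚ → ℚ → ℚ → ℂ) → ℂ := fun x Φ =>
    ∑ a : (ZMod (p ^ 3))ˣ, ∑ b : (ZMod (p ^ 3))ˣ,
      chi p b.1 * Φ ((rep a.1 * rep x - rep b.1) / p ^ 3) (rep a.1 / p ^ 2) 0
  have hL : ∀ x, ∀ a b c : ℤ, L x (fun q₁ q₂ q₃ => e (a * q₁ + b * q₂ + c * q₃)) =
      (∑ u : (ZMod (p ^ 3))ˣ, e ((a * x.val + p * b : ℤ) * rep u.1 / p ^ 3)) *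
      (∑ u : (ZMod (p ^ 3))ˣ, chi p u.1 * e ((-a : ℤ) * rep u.1 / p ^ 3)) := by
    intro x a b c
    rw [← sum_mul_sum']
    refine Finset.sum_congr rfl fun _ _ => Finset.sum_congr rfl fun _ _ => ?_
    dsimp only
    rw [mul_left_comm, ← e_add, rep_eq_intCast x]
    congr 2; push_cast; field_simp; ring
  -- The parameter entering `P` is moved outermost, so that `L x` collects all terms with the same
  -- `P`.
  have hswap : ∀ α m γ, twistSum5 p (coefQP A k α m γ) = (p : ℂ) ^ (-9 : ℤ) *
      ∑ x : ZMod (p ^ 3), L x (fun q₁ q₂ q₃ => coefQP A k α m γ q₁ q₂ q₃ p (rep x / p) 1) := by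
    intro α m γ
    rw [twistSum5]
    congr 1
    simp only [L]
    rw [Finset.sum_comm]
    rw [Finset.sum_congr rfl fun _ _ => Finset.sum_comm]
    rw [Finset.sum_comm]
    exact Finset.sum_congr rfl fun _ _ => Finset.sum_comm
  refine ((IsTwistCoef.sum (s := Finset.univ) fun (x : ZMod (p ^ 3)) _ =>
    IsTwistCoef.of_functional hA k (r := p) (s := rep x / p) (t := 1)
    hq one_ne_zero (L x) ?_
    (fun a b _ => (p : ℂ) ^ 4 * χ p (-a : ℤ) * ramanujan p (b - red p x * a)) ?_ ?_).const_mul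
      ((p : ℂ) ^ (-9 : ℤ))).congr hswap ?_
  · intro y Φ
    simp only [L, Finset.mul_sum, mul_left_comm]
  · intro a b c h
    rw [hL] at h
    have h1 : (p : ℤ) ^ 2 ∣ a := by
      by_contra hb
      exact h (by rw [sum_chi_mul_e_pow_eq_zero p 2 (by rwa [dvd_neg]), mul_zero])
    obtain ⟨a, rfl⟩ := h1
    have h2 : (p : ℤ) ^ 2 ∣ p ^ 2 * a * x.val + p * b := by
      by_contra hb; exact h (by rw [sum_e_pow_eq_zero p 2 hb, zero_mul])
    obtain ⟨b', hb'⟩ := h2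
    have hb : (b : ℚ) = p * (b' - a * x.val) := by
      apply mul_left_cancel₀ hq
      have : ((p ^ 2 * a * x.val + p * b : ℤ) : ℚ) = (p ^ 2 * b' : ℤ) := by rw [hb']
      push_cast at this
      linear_combination this
    refine ⟨a, b' + x.val * a, c + x.val * b' , ?_, ?_, ?_⟩
    · push_cast; ring
    · rw [hb, rep]; push_cast; field_simp; ring
    · rw [hb, rep]; push_cast; field_simp; ring
  · intro a b c a' b' g' h1 h2 h3
    obtain rfl : a = p ^ 2 * a' := by
      have : (a : ℚ) = p ^ 2 * a' := mul_left_cancel₀ (pow_ne_zero 2 hq) (by linear_combination h1)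
      exact_mod_cast this
    have hb : (b : ℚ) = p * (b' - 2 * x.val * a') := by
      rw [rep] at h2
      push_cast at h2
      field_simp at h2
      linear_combination h2
    have hb : b = p * (b' - 2 * x.val * a') := by exact_mod_cast hb
    rw [hL, show p ^ 2 * a' * x.val + p * b = p ^ 2 * (b' - x.val * a') by rw [hb]; ring,
      sum_e_pow p 2, show -((p : ℤ) ^ 2 * a') = p ^ 2 * (-a') by ring, sum_chi_mul_e_pow p hp 2]
    push_cast
    rw [red]
    ring
  · intro a b g
    -- The periodicity lemma wants a function of a rational variable; the floor recovers the residue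
    -- from the rational representative.
    have := sum_zmod_periodic (N := p ^ 3) (d := p) (q := p ^ 2) (by ring)
      (fun x => ramanujan p (b - ((⌊x⌋ : ℤ) : ZMod p) * a) *
        coefAt A p (x / p) 1 (p ^ 4 * a) (p ^ 2 * b) g) ?_
    · have hfl : ∀ {n : ℕ} (x : ZMod n), ((⌊rep x⌋ : ℤ) : ZMod p) = red p x := by
        intro n x; rw [rep_eq_intCast, Int.floor_intCast, intCast_val_eq_red]
      simp only [hfl, red_self] at this
      rw [show ((k : ℤ) - 3) = (k : ℤ) - (3 : ℕ) from rfl, zpow_sub_natCast_prime,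
        show (-9 : ℤ) = -(9 : ℕ) from rfl, zpow_neg_natCast_prime]
      rw [Finset.sum_congr rfl (g := fun x : ZMod (p ^ 3) =>
        (p : ℂ) ^ k * (p : ℂ) ^ 4 * χ p (-a : ℤ) * (ramanujan p (b - red p x * a) *
        coefAt A p (rep x / p) 1 (p ^ 4 * a) (p ^ 2 * b) g)), ← Finset.mul_sum, this]
      · push_cast; field_simp
      · intros; push_cast; ring
    · intro x j
      rw [show x + (p : ℚ) * j = x + ((p * j : ℤ) : ℚ) by push_cast; ring, Int.floor_add_intCast]
      rw [hA.coefAt_eq_of one_ne_zero hq (s' := x / p) j (by push_cast; field_simp; ring)]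
      simp

end

/-! ### Operators 4, 7 and 11 -/

section

variable {p : ℕ} [Fact p.Prime] {A : ℚ → ℚ → ℚ → ℂ}

/-- The full sum over the parameter of `q₂` demands a congruence modulo `p⁴`, which is automatic
once both `S` and `T` are integral. Since `s = x/p²` counts modulo `1`, the sum over `x` shrinks to
one modulo `p²`. -/
lemma isTwistCoef4 (hp : p ≠ 2) (hA : IsCoefFun A) (k : ℕ) :
    IsTwistCoef p 1 (fun α m γ => twistSum4 p (coefQP A k α m γ))
      (fun a b g => (p : ℂ) ^ ((k : ℤ) - 2) * χ p (-a : ℤ) * ∑ x : (ZMod (p ^ 2))ˣ,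
        coefAt A p (rep x.1 / p ^ 2) 1 (p ^ 4 * a) (p ^ 1 * b) g) := by
  have hq : (p : ℚ) ≠ 0 := natCast_prime_ne_zero p ℚ
  have hc : (p : ℂ) ≠ 0 := natCast_prime_ne_zero p ℂ
  let L : (ZMod (p ^ 4))ˣ → (ℚ → ℚ → ℚ → ℂ) → ℂ := fun x Φ =>
    ∑ a : ZMod (p ^ 4), ∑ b : (ZMod (p ^ 3))ˣ,
      chi p b.1 * Φ ((rep a * rep x.1 - rep b.1 * p) / p ^ 4) (rep a / p ^ 2) 0
  have hL : ∀ x, ∀ a b c : ℤ, L x (fun q₁ q₂ q₃ => e (a * q₁ + b * q₂ + c * q₃)) =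
      (∑ u : ZMod (p ^ 4), e ((a * x.1.val + p ^ 2 * b : ℤ) * rep u / p ^ 4)) *
      (∑ u : (ZMod (p ^ 3))ˣ, chi p u.1 * e ((-a : ℤ) * rep u.1 / p ^ 3)) := by
    intro x a b c
    rw [← sum_mul_sum']
    refine Finset.sum_congr rfl fun _ _ => Finset.sum_congr rfl fun _ _ => ?_
    dsimp only
    rw [mul_left_comm, ← e_add, rep_eq_intCast x.1]
    congr 2; push_cast; field_simp; ring
  have hswap : ∀ α m γ, twistSum4 p (coefQP A k α m γ) = (p : ℂ) ^ (-10 : ℤ) *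
      ∑ x : (ZMod (p ^ 4))ˣ,
        L x (fun q₁ q₂ q₃ => coefQP A k α m γ q₁ q₂ q₃ p (rep x.1 / p ^ 2) 1) := by
    intro α m γ
    rw [twistSum4]
    congr 1
    simp only [L]
    rw [Finset.sum_congr rfl fun _ _ => Finset.sum_comm]
    exact Finset.sum_comm
  refine ((IsTwistCoef.sum (s := Finset.univ) fun (x : (ZMod (p ^ 4))ˣ) _ =>
    IsTwistCoef.of_functional hA k (r := p) (s := rep x.1 / p ^ 2) (t := 1)
    hq one_ne_zero (L x) ?_
    (fun a b _ => (p : ℂ) ^ 6 * χ p (-a : ℤ)) ?_ ?_).const_mul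
      ((p : ℂ) ^ (-10 : ℤ))).congr hswap ?_
  · intro y Φ
    simp only [L, Finset.mul_sum, mul_left_comm]
  · intro a b c h
    rw [hL, sum_zmod_e_pow] at h
    have h1 : (p : ℤ) ^ 2 ∣ a := by
      by_contra hb
      exact h (by rw [sum_chi_mul_e_pow_eq_zero p 2 (by rwa [dvd_neg]), mul_zero])
    obtain ⟨a, rfl⟩ := h1
    obtain ⟨b', hb'⟩ := ((ite_ne_right_iff).1 (left_ne_zero_of_mul h)).1
    have hb : (b : ℚ) = p ^ 2 * b' - a * x.1.val := by
      apply mul_left_cancel₀ (pow_ne_zero 2 hq)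
      have : ((p ^ 2 * a * x.1.val + p ^ 2 * b : ℤ) : ℚ) = (p ^ 4 * b' : ℤ) := by rw [hb']
      push_cast at this
      linear_combination this
    refine ⟨a, b + 2 * x.1.val * a, c + x.1.val * b' , ?_, ?_, ?_⟩
    · push_cast; ring
    · rw [rep]; push_cast; field_simp
    · rw [hb, rep]; push_cast; field_simp; ring
  · intro a b c a' b' g' h1 h2 h3
    obtain rfl : a = p ^ 2 * a' := by
      have : (a : ℚ) = p ^ 2 * a' := mul_left_cancel₀ (pow_ne_zero 2 hq) (by linear_combination h1)
      exact_mod_cast this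
    have hb : (b : ℚ) = b' - 2 * x.1.val * a' := by
      rw [rep] at h2
      push_cast at h2
      field_simp at h2
      linear_combination h2
    -- The lower right entry of `T = S[P]` reads `g' = c + x (b' - x a') / p²`, with `g'`, `c`
    -- integers and `x` prime to `p`.
    have hd : (p : ℤ) ^ 2 ∣ b' - x.1.val * a' := by
      have hg : (p : ℤ) ^ 2 * (g' - c) = x.1.val * (b' - x.1.val * a') := by
        rw [rep, hb] at h3
        push_cast at h3
        field_simp at h3
        have : (p : ℚ) ^ 2 * (g' - c) = x.1.val * (b' - x.1.val * a') := by
          linear_combination - h3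
        exact_mod_cast this
      exact (isCoprime_val_unit p x).pow_left.dvd_of_dvd_mul_left ⟨_, hg.symm⟩
    obtain ⟨d, hd⟩ := hd
    have hb : b = b' - 2 * x.1.val * a' := by exact_mod_cast hb
    rw [hL, show p ^ 2 * a' * x.1.val + p ^ 2 * b = p ^ 4 * d by
        rw [hb, show b' - 2 * x.1.val * a' = (b' - x.1.val * a') - x.1.val * a' by ring, hd]; ring,
      sum_zmod_e_pow, if_pos (dvd_mul_right _ _), show -((p : ℤ) ^ 2 * a') = p ^ 2 * (-a') by ring,
      sum_chi_mul_e_pow p hp 2]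
    push_cast
    ring
  · intro a b g
    have := sum_units_periodic (N := p ^ 4) (d := p ^ 2) (q := p ^ 2) (by ring)
      (coprime_pow_succ_iff p 3 1)
      (fun x => coefAt A p (x / p ^ 2) 1 (p ^ 4 * a) (p ^ 1 * b) g) ?_
    · rw [show ((k : ℤ) - 2) = (k : ℤ) - (2 : ℕ) from rfl, zpow_sub_natCast_prime,
        show (-10 : ℤ) = -(10 : ℕ) from rfl, zpow_neg_natCast_prime, ← Finset.mul_sum, this]
      push_cast; field_simp
    · intro x j
      exact hA.coefAt_eq_of one_ne_zero hq j (by push_cast; field_simp; ring) _ _ _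

lemma isTwistCoef7 (hp : p ≠ 2) (hA : IsCoefFun A) (k : ℕ) :
    IsTwistCoef p 1 (fun α m γ => twistSum7 p (coefQP A k α m γ))
      (fun a b g => (p : ℂ) ^ ((k : ℤ) - 2) * χ p b * ∑ x : (ZMod (p ^ 2))ˣ,
        chi p x.1 * coefAt A 1 (-rep x.1 / p) p (p ^ 4 * a) (p ^ 1 * b) g) := by
  have hq : (p : ℚ) ≠ 0 := natCast_prime_ne_zero p ℚ
  have hc : (p : ℂ) ≠ 0 := natCast_prime_ne_zero p ℂ
  let L : (ZMod (p ^ 3))ˣ → (ℚ → ℚ → ℚ → ℂ) → ℂ := fun x Φ =>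
    ∑ b : (ZMod p)ˣ, ∑ z : ZMod (p ^ 4), chi p x.1 * chi p b.1 * Φ (rep z / p ^ 4) (rep b.1 / p) 0
  have hL : ∀ x, ∀ a b c : ℤ, L x (fun q₁ q₂ q₃ => e (a * q₁ + b * q₂ + c * q₃)) =
      chi p x.1 * ((χ p b * gaussW p) * (∑ u : ZMod (p ^ 4), e (a * rep u / p ^ 4))) := by
    intro x a b c
    rw [← sum_chi_mul_e p hp, ← sum_mul_sum']
    simp only [L, Finset.mul_sum]
    refine Finset.sum_congr rfl fun _ _ => Finset.sum_congr rfl fun _ _ => ?_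
    rw [e_add, e_add, mul_zero, e_zero]; ring_nf
  refine ((IsTwistCoef.sum (s := Finset.univ) fun (x : (ZMod (p ^ 3))ˣ) _ =>
    IsTwistCoef.of_functional hA k (r := 1) (s := -rep x.1 / p) (t := p)
    one_ne_zero hq (L x) ?_
    (fun a b _ => (p : ℂ) ^ 4 * chi p x.1 * χ p b) ?_ ?_).const_mul
      ((p : ℂ) ^ (-7 : ℤ))).congr (fun _ _ _ => rfl) ?_
  · intro y Φ
    simp only [L, Finset.mul_sum, mul_left_comm]
  · intro a b c h
    rw [hL, sum_zmod_e_pow] at h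
    obtain ⟨a, rfl⟩ := ((ite_ne_right_iff).1 (right_ne_zero_of_mul (right_ne_zero_of_mul h))).1
    refine ⟨a, b - 2 * p ^ 2 * x.1.val * a, p ^ 2 * c - x.1.val * b + p ^ 2 * x.1.val ^ 2 * a,
      ?_, ?_, ?_⟩ <;> (try rw [rep_eq_intCast]) <;> push_cast <;> field_simp <;> ring
  · intro a b c a' b' g' h1 h2 h3
    obtain rfl : a = p ^ 4 * a' := by
      have : (a : ℚ) = p ^ 4 * a' := by linear_combination h1
      exact_mod_cast this
    -- The entries of `S` and `T` differ by a multiple of `p`, so `χ(b) = χ(b')`.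
    have hb : b = b' + p * (2 * p * x.1.val * a') := by
      have : (b : ℚ) = b' + p * (2 * p * x.1.val * a') := by
        rw [rep] at h2
        push_cast at h2
        field_simp at h2
        linear_combination h2
      exact_mod_cast this
    rw [hL, sum_zmod_e_pow, if_pos (dvd_mul_right _ _), hb]
    push_cast
    simp only [CharP.cast_eq_zero, zero_mul, add_zero]
    ring
  · intro a b g
    have := sum_units_periodic (N := p ^ 3) (d := p ^ 2) (q := p) (by ring)
      (coprime_pow_succ_iff p 2 1)
      (fun x => χ p (⌊x⌋ : ℤ) * coefAt A 1 (-x / p) p (p ^ 4 * a) (p ^ 1 * b) g) ?_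
    · have hfl : ∀ {n : ℕ} (x : ZMod n), χ p (⌊rep x⌋ : ℤ) = chi p x := by
        intro n x; rw [rep_eq_intCast, Int.floor_intCast, intCast_val_eq_red, chi]
      simp only [hfl] at this
      rw [show ((k : ℤ) - 2) = (k : ℤ) - (2 : ℕ) from rfl, zpow_sub_natCast_prime,
        show (-7 : ℤ) = -(7 : ℕ) from rfl, zpow_neg_natCast_prime]
      rw [Finset.sum_congr rfl (g := fun x : (ZMod (p ^ 3))ˣ => (p : ℂ) ^ k * (p : ℂ) ^ 4 * χ p b *
        (chi p x.1 * coefAt A 1 (-rep x.1 / p) p (p ^ 4 * a) (p ^ 1 * b) g)), ← Finset.mul_sum, this]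
      · push_cast; field_simp
      · intros; push_cast; ring
    · intro x j
      rw [show x + ((p ^ 2 : ℕ) : ℚ) * j = x + ((p ^ 2 * j : ℤ) : ℚ) by push_cast; ring,
        Int.floor_add_intCast,
        hA.coefAt_eq_of hq one_ne_zero (s' := -x / p) (-j) (by push_cast; field_simp; ring)]
      simp

/-- The only operator that does not force `p ∣ m`: its Gauss sum forces `p ∣ b` for the entry of
`S`, but `t = p⁻¹` divides this by `p` again in `T`. Here `det P = p⁻¹`, whence the factor `p⁻ᵏ`. -/
lemma isTwistCoef11 (hp : p ≠ 2) (hA : IsCoefFun A) (k : ℕ) :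
    IsTwistCoef p 0 (fun α m γ => twistSum11 p (coefQP A k α m γ))
      (fun a b g => (p : ℂ) ^ (1 - (k : ℤ)) * χ p b * ∑ x : (ZMod p)ˣ,
        χ p x * coefAt A 1 (rep x.1 / p ^ 2) ((p : ℚ)⁻¹) (p ^ 4 * a) (p ^ 0 * b) g) := by
  have hq : (p : ℚ) ≠ 0 := natCast_prime_ne_zero p ℚ
  have hq1 : (p : ℚ)⁻¹ ≠ 0 := inv_ne_zero hq
  have hc : (p : ℂ) ≠ 0 := natCast_prime_ne_zero p ℂ
  let L : (ZMod (p ^ 4))ˣ → (ℚ → ℚ → ℚ → ℂ) → ℂ := fun b Φ =>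
    ∑ a : (ZMod (p ^ 2))ˣ, ∑ x : ZMod (p ^ 3), ∑ z : ZMod (p ^ 4), chi p a.1 * chi p b.1 *
      Φ (rep z / p ^ 4) ((rep a.1 * p + rep x * rep b.1) / p ^ 3) (rep x / p ^ 2)
  have hL : ∀ x, ∀ a b c : ℤ, L x (fun q₁ q₂ q₃ => e (a * q₁ + b * q₂ + c * q₃)) =
      chi p x.1 * ((∑ u : (ZMod (p ^ 2))ˣ, chi p u.1 * e (b * rep u.1 / p ^ 2)) *
        ((∑ u : ZMod (p ^ 3), e ((b * x.1.val + p * c : ℤ) * rep u / p ^ 3)) *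
        (∑ u : ZMod (p ^ 4), e (a * rep u / p ^ 4)))) := by
    intro x a b c
    rw [← sum_mul_sum_mul_sum]
    simp only [L, Finset.mul_sum]
    refine Finset.sum_congr rfl fun u _ => Finset.sum_congr rfl fun v _ =>
      Finset.sum_congr rfl fun w _ => ?_
    rw [show (a : ℚ) * (rep w / p ^ 4) + b * ((rep u.1 * p + rep v * rep x.1) / p ^ 3) +
      c * (rep v / p ^ 2) = b * rep u.1 / p ^ 2 + (b * x.1.val + p * c : ℤ) * rep v / p ^ 3 +
        a * rep w / p ^ 4 by rw [rep_eq_intCast x.1]; push_cast; field_simp; ring, e_add, e_add]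
    ring
  have hswap : ∀ α m γ, twistSum11 p (coefQP A k α m γ) = (p : ℂ) ^ (-10 : ℤ) *
      ∑ x : (ZMod (p ^ 4))ˣ,
        L x (fun q₁ q₂ q₃ => coefQP A k α m γ q₁ q₂ q₃ 1 (rep x.1 / p ^ 2) ((p : ℚ)⁻¹)) := by
    intro α m γ
    rw [twistSum11, Finset.sum_comm]
  refine ((IsTwistCoef.sum (s := Finset.univ) fun (x : (ZMod (p ^ 4))ˣ) _ =>
    IsTwistCoef.of_functional hA k (r := 1) (s := rep x.1 / p ^ 2) (t := (p : ℚ)⁻¹)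
    one_ne_zero hq1 (L x) ?_
    (fun a b _ => (p : ℂ) ^ 8 * chi p x.1 * χ p b) ?_ ?_).const_mul
      ((p : ℂ) ^ (-10 : ℤ))).congr hswap ?_
  · intro y Φ
    simp only [L, Finset.mul_sum, mul_left_comm]
  · intro a b c h
    rw [hL, sum_zmod_e_pow, sum_zmod_e_pow] at h
    have h := right_ne_zero_of_mul h
    obtain ⟨b, rfl⟩ : (p : ℤ) ^ 1 ∣ b := by
      by_contra hb
      exact h (by rw [sum_chi_mul_e_pow_eq_zero p 1 hb, zero_mul])
    have h := right_ne_zero_of_mul h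
    obtain ⟨a, rfl⟩ := ((ite_ne_right_iff).1 (right_ne_zero_of_mul h)).1
    obtain ⟨g, hg⟩ := ((ite_ne_right_iff).1 (left_ne_zero_of_mul h)).1
    have hg : (p : ℚ) * (b * x.1.val + c) = p ^ 3 * g := by
      have : (((p : ℤ) ^ 1 * b * x.1.val + p * c : ℤ) : ℚ) = (p ^ 3 * g : ℤ) := by rw [hg]
      push_cast at this
      linear_combination this
    have hg : (c : ℚ) = p ^ 2 * g - b * x.1.val := mul_left_cancel₀ hq (by linear_combination hg)
    refine ⟨a, b + 2 * p ^ 2 * x.1.val * a, g + x.1.val ^ 2 * a, ?_, ?_, ?_⟩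
    · push_cast; ring
    · rw [rep]; push_cast; field_simp
    · rw [rep, hg]; push_cast; field_simp; ring
  · intro a b c a' b' g' h1 h2 h3
    obtain rfl : a = p ^ 4 * a' := by
      have : (a : ℚ) = p ^ 4 * a' := by linear_combination h1
      exact_mod_cast this
    have hb : b = p ^ 1 * (b' - p * (2 * p * x.1.val * a')) := by
      have : (b : ℚ) = p ^ 1 * (b' - p * (2 * p * x.1.val * a')) := by
        rw [rep] at h2
        push_cast at h2
        field_simp at h2
        linear_combination h2
      exact_mod_cast this
    have hg : b * x.1.val + p * c = p ^ 3 * (g' - x.1.val ^ 2 * a') := by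
      have : (b : ℚ) * x.1.val + p * c = p ^ 3 * (g' - x.1.val ^ 2 * a') := by
        rw [rep] at h3
        push_cast at h3
        field_simp at h3
        linear_combination h3
      exact_mod_cast this
    rw [hL, hg, sum_zmod_e_pow, if_pos (dvd_mul_right _ _), sum_zmod_e_pow,
      if_pos (dvd_mul_right _ _), hb, sum_chi_mul_e_pow p hp 1]
    push_cast
    simp only [CharP.cast_eq_zero, zero_mul, sub_zero]
    ring
  · intro a b g
    have := sum_units_chi_periodic p 3 (fun x => χ p x)
      (fun x => coefAt A 1 (x / p ^ 2) ((p : ℚ)⁻¹) (p ^ 4 * a) (p ^ 0 * b) g) ?_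
    · rw [zpow_sub₀ hc, zpow_natCast, zpow_one, show (-10 : ℤ) = -(10 : ℕ) from rfl,
        zpow_neg_natCast_prime]
      rw [Finset.sum_congr rfl (g := fun x : (ZMod (p ^ 4))ˣ => ((p : ℂ) ^ k)⁻¹ * (p : ℂ) ^ 8 * χ p b *
        (chi p x.1 * coefAt A 1 (rep x.1 / p ^ 2) ((p : ℚ)⁻¹) (p ^ 4 * a) (p ^ 0 * b) g)),
        ← Finset.mul_sum]
      · simp only [chi]
        rw [this]; field_simp
      · intros; push_cast; rw [one_mul, inv_pow]; ring
    · intro x j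
      exact hA.coefAt_eq_of hq1 one_ne_zero j (by field_simp; ring) _ _ _

end

/-! ### Ramanujan sums over quadratic polynomials, and operator 3 -/

section

variable {p : ℕ} [Fact p.Prime] {A : ℚ → ℚ → ℚ → ℂ}

lemma red_mul {n : ℕ} (x y : ZMod (p ^ (n + 1))) : red p (x * y) = red p x * red p y := by
  simp only [red_eq_castHom, map_mul]

lemma red_sub {n : ℕ} (x y : ZMod (p ^ (n + 1))) : red p (x - y) = red p x - red p y := by
  simp only [red_eq_castHom, map_sub]

lemma red_one {n : ℕ} : red p (1 : ZMod (p ^ (n + 1))) = 1 := by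
  simp only [red_eq_castHom, map_one]

lemma red_unit_inv {n : ℕ} (u : (ZMod (p ^ (n + 1)))ˣ) : red p u⁻¹.1 = (red p u.1)⁻¹ := by
  have h : red p u⁻¹.1 * red p u.1 = 1 := by rw [← red_mul, Units.inv_mul, red_one]
  exact eq_inv_of_mul_eq_one_left h

lemma chi_self (x : ZMod p) : chi p x = χ p x := by rw [chi, red_self]

lemma e_div_of_eq {x : ℚ} {n : ℤ} {y : ZMod p} (hx : x = n) (hy : (n : ZMod p) = y) :
    e (x / p) = ZMod.stdAddChar y := by
  rw [hx, e_div_natCast, hy]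

lemma ramanujan_mul {c : ZMod p} (hc : c ≠ 0) (x : ZMod p) :
    ramanujan p (c * x) = ramanujan p x := by
  simp [ramanujan, hc]

lemma two_ne_zero_zmod (hp : p ≠ 2) : (2 : ZMod p) ≠ 0 :=
  Ring.two_ne_zero (by rwa [ZMod.ringChar_zmod_n])

/-- The Ramanujan sum is `p` times the indicator of `0`, minus `1`, and `d` has `1 + χ(d)` square
roots. -/
lemma sum_ramanujan_sq_sub (hp : p ≠ 2) (d : ZMod p) :
    ∑ y : ZMod p, ramanujan p (y ^ 2 - d) = p * χ p d := by
  have h : ∀ y : ZMod p, ramanujan p (y ^ 2 - d) = (if y ^ 2 = d then (p : ℂ) else 0) - 1 := by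
    intro y
    simp only [ramanujan, sub_eq_zero]
    split_ifs <;> ring
  simp_rw [h]
  rw [Finset.sum_sub_distrib, ← Finset.sum_filter, Finset.sum_const]
  have := quadraticChar_card_sqrts (by rwa [ZMod.ringChar_zmod_n] : ringChar (ZMod p) ≠ 2) d
  have hcard : ((Finset.univ.filter fun y : ZMod p => y ^ 2 = d).card : ℂ) = χ p d + 1 := by
    rw [χ_eq]
    rw [← Set.toFinset_ofPred]
    exact_mod_cast this
  rw [nsmul_eq_mul, hcard]
  simp [ZMod.card]
  ring

/-- Multiplication by the unit `4u` does not change a Ramanujan sum and completes the square: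
`4u(ud² + vd + w) = (2ud + v)² - (v² - 4uw)`. -/
lemma sum_ramanujan_quadratic (hp : p ≠ 2) {u : ZMod p} (hu : u ≠ 0) (v w : ZMod p) :
    ∑ d : ZMod p, ramanujan p (u * d ^ 2 + v * d + w) = p * χ p (v ^ 2 - 4 * u * w) := by
  have h2 := two_ne_zero_zmod hp
  have h2u : 2 * u ≠ 0 := mul_ne_zero h2 hu
  rw [← sum_ramanujan_sq_sub hp,
    ← Equiv.sum_comp ((Equiv.mulLeft₀ (2 * u) h2u).trans (Equiv.addRight v))
      (fun y => ramanujan p (y ^ 2 - (v ^ 2 - 4 * u * w)))]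
  refine Finset.sum_congr rfl fun d _ => ?_
  have h4 : 4 * u ≠ 0 := by
    rw [show (4 : ZMod p) = 2 * 2 by norm_num]; exact mul_ne_zero (mul_ne_zero h2 h2) hu
  rw [← ramanujan_mul h4]
  simp only [Equiv.trans_apply, Equiv.mulLeft₀_apply, Equiv.coe_addRight]
  congr 1; ring

/-- Replacing `c` by `c⁻¹` reverses the polynomial up to a square, which makes `u` the leading
coefficient. The reversed polynomial takes the value `w` at the excluded point `0`. -/
lemma sum_units_ramanujan_quadratic (hp : p ≠ 2) {u : ZMod p} (hu : u ≠ 0) (v w : ZMod p) :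
    ∑ c : (ZMod p)ˣ, ramanujan p (u + v * c + w * (c : ZMod p) ^ 2) =
      p * χ p (v ^ 2 - 4 * u * w) - ramanujan p w := by
  rw [← sum_ramanujan_quadratic hp hu, ← Equiv.sum_comp (Equiv.inv (ZMod p)ˣ)]
  have := sum_units_eq_sum_erase p (fun d => ramanujan p (u * d ^ 2 + v * d + w))
  simp only [ne_eq, OfNat.ofNat_ne_zero, not_false_eq_true, zero_pow, mul_zero, zero_add] at this
  rw [← this]
  refine Finset.sum_congr rfl fun c _ => ?_
  have hc : (c : ZMod p) ≠ 0 := c.ne_zero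
  rw [← ramanujan_mul (pow_ne_zero 2 hc)]
  congr 1
  simp only [Equiv.inv_apply, Units.val_inv_eq_inv_val]
  field_simp

lemma sum_units_inv (f : ZMod p → ℂ) :
    ∑ u : (ZMod p)ˣ, f (u : ZMod p)⁻¹ = ∑ u : (ZMod p)ˣ, f u := by
  have := Equiv.sum_comp (Equiv.inv (ZMod p)ˣ) (fun u : (ZMod p)ˣ => f u)
  simp only [Equiv.inv_apply, Units.val_inv_eq_inv_val] at this
  exact this

/-- The entries `q₁`, `q₂` give linear phases modulo `p³` and `p²`, while `q₃` sees residues modulo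
`p` only. Two sums over fibres force `p² ∣ a` and `p ∣ b`; modulo `p`, a rescaling makes the phase
linear in one variable and a Gauss sum splits off. -/
lemma isTwistCoef3 (hp : p ≠ 2) (hA : IsCoefFun A) (k : ℕ) :
    IsTwistCoef p 2 (fun α m γ => twistSum3 p (coefQP A k α m γ))
      (fun a b g => (p : ℂ) ^ ((k : ℤ) - 3) *
        (∑ c : (ZMod p)ˣ, ∑ z : (ZMod p)ˣ with z ≠ 1,
          χ p ((1 - z) * (-a + b * c - g * (c : ZMod p) ^ 2 * z))) *
        coefAt A p 0 1 (p ^ 4 * a) (p ^ 2 * b) g) := by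
  have hq : (p : ℚ) ≠ 0 := natCast_prime_ne_zero p ℚ
  have hc : (p : ℂ) ≠ 0 := natCast_prime_ne_zero p ℂ
  let L : (ℚ → ℚ → ℚ → ℂ) → ℂ := fun Φ =>
    ∑ a : (ZMod (p ^ 2))ˣ, ∑ b : (ZMod (p ^ 3))ˣ, ∑ z : (ZMod p)ˣ with z ≠ 1,
      chi p b.1 * chi p (1 - z : ZMod p) * Φ (-rep b.1 / p ^ 3) (rep a.1 / p ^ 2)
          (-(rep a.1 ^ 2 * rep b⁻¹.1 * rep z.1) / p)
  -- `G` gathers whatever depends on residues modulo `p` alone: the characters and the phase coming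
  -- from `q₃`.
  let G : ℤ → (ZMod p)ˣ → ZMod p → ZMod p → ℂ := fun c z a b =>
    χ p (1 - z) * (χ p b * ZMod.stdAddChar (-(c * a ^ 2 * b⁻¹ * z : ZMod p)))
  have hL : ∀ a b c : ℤ, L (fun q₁ q₂ q₃ => e (a * q₁ + b * q₂ + c * q₃)) =
      ∑ z : (ZMod p)ˣ with z ≠ 1, ∑ u : (ZMod (p ^ 2))ˣ,
        (∑ v : (ZMod (p ^ 3))ˣ, G c z (red p u.1) (red p v.1) *
          e ((-a : ℤ) * rep v.1 / p ^ 3)) * e (b * rep u.1 / p ^ 2) := by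
    intro a b c
    simp only [L, Finset.sum_mul]
    rw [Finset.sum_congr rfl fun _ _ => Finset.sum_comm, Finset.sum_comm]
    refine Finset.sum_congr rfl fun z _ => Finset.sum_congr rfl fun u _ =>
      Finset.sum_congr rfl fun v _ => ?_
    rw [show (a : ℚ) * (-rep v.1 / p ^ 3) + b * (rep u.1 / p ^ 2) +
      c * (-(rep u.1 ^ 2 * rep v⁻¹.1 * rep z.1) / p) = (-a : ℤ) * rep v.1 / p ^ 3 +
        b * rep u.1 / p ^ 2 + -(c * rep u.1 ^ 2 * rep v⁻¹.1 * rep z.1) / p by push_cast; ring,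
      e_add, e_add, e_div_of_eq (n := -(c * u.1.val ^ 2 * v⁻¹.1.val * z.1.val))
        (y := (-(c * red p u.1 ^ 2 * (red p v.1)⁻¹ * z) : ZMod p)) (by simp only [rep]; push_cast; rfl)
        (by rw [← red_unit_inv]; push_cast; simp [red]), chi_self]
    simp only [G, chi]; ring
  have hz : ∀ a b c : ℤ, ¬ (p : ℤ) ^ 2 ∣ a →
      L (fun q₁ q₂ q₃ => e (a * q₁ + b * q₂ + c * q₃)) = 0 := by
    intro a b c ha
    rw [hL]
    refine Finset.sum_eq_zero fun z _ => Finset.sum_eq_zero fun u _ => ?_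
    rw [sum_units_red_mul_e_eq_zero p 2 (G c z (red p u.1)) (by rwa [dvd_neg]), zero_mul]
  let H : ℤ → ℤ → (ZMod p)ˣ → ZMod p → ℂ := fun a c z x => (p : ℂ) ^ 2 * ∑ v : (ZMod p)ˣ,
    G c z x v * ZMod.stdAddChar (((-a : ℤ) : ZMod p) * v.1)
  have hL2 : ∀ a b c : ℤ, L (fun q₁ q₂ q₃ => e (((p ^ 2 * a : ℤ) : ℚ) * q₁ + b * q₂ + c * q₃)) =
      ∑ z : (ZMod p)ˣ with z ≠ 1, ∑ u : (ZMod (p ^ 2))ˣ,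
        H a c z (red p u.1) * e (b * rep u.1 / p ^ 2) := by
    intro a b c
    rw [hL]
    refine Finset.sum_congr rfl fun z _ => Finset.sum_congr rfl fun u _ => ?_
    rw [show -((p : ℤ) ^ 2 * a) = p ^ 2 * (-a) by ring, sum_units_red_mul_e p 2 (G c z (red p u.1))]
  have hL3 : ∀ a b c : ℤ,
      L (fun q₁ q₂ q₃ => e (((p ^ 2 * a : ℤ) : ℚ) * q₁ + ((p * b : ℤ) : ℚ) * q₂ + c * q₃)) =
      gaussW p * ((p : ℂ) ^ 3 * ∑ x : (ZMod p)ˣ, ∑ z : (ZMod p)ˣ with z ≠ 1,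
          χ p ((1 - z) * (-a + b * x - c * (x : ZMod p) ^ 2 * z))) := by
    intro a b c
    rw [hL2, Finset.sum_comm (s := Finset.univ), Finset.mul_sum, Finset.mul_sum]
    refine Finset.sum_congr rfl fun z _ => ?_
    have := sum_units_red_mul_e p 1 (H a c z) b
    rw [pow_one] at this
    rw [this]
    simp only [H, G, Finset.mul_sum, Finset.sum_mul]
    rw [Finset.sum_comm]
    have h1 : ∀ v : (ZMod p)ˣ, ∑ u : (ZMod p)ˣ, ((p : ℂ) ^ 1 * ((p : ℂ) ^ 2 *
        (χ p (1 - z) * (χ p v * ZMod.stdAddChar (-(c * (u : ZMod p) ^ 2 * (v : ZMod p)⁻¹ * z) : ZMod p)) *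
          ZMod.stdAddChar (((-a : ℤ) : ZMod p) * v.1)) * ZMod.stdAddChar ((b : ZMod p) * u.1))) =
        ∑ u : (ZMod p)ˣ, (p : ℂ) ^ 3 * χ p (1 - z) * (χ p v *
          ZMod.stdAddChar ((-a + b * u - c * (u : ZMod p) ^ 2 * z) * v : ZMod p)) := by
      intro v
      -- The substitution `u ↦ v u` turns `u² v⁻¹` into `u² v`, so the total phase becomes linear in
      -- `v`.
      rw [← Equiv.sum_comp (Equiv.mulLeft v)]
      refine Finset.sum_congr rfl fun u _ => ?_
      simp only [Equiv.coe_mulLeft, Units.val_mul]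
      have hv : (v : ZMod p) ≠ 0 := v.ne_zero
      rw [show (-a + b * u.1 - c * u.1 ^ 2 * z.1) * v.1 =
        -(c * (v.1 * u.1) ^ 2 * v.1⁻¹ * z.1) + (((-a : ℤ) : ZMod p) * v.1) +
          (b : ZMod p) * (v.1 * u.1) by push_cast; field_simp; ring, AddChar.map_add_eq_mul,
          AddChar.map_add_eq_mul]
      ring
    rw [Finset.sum_congr rfl fun v _ => h1 v, Finset.sum_comm]
    refine Finset.sum_congr rfl fun u _ => ?_
    rw [← Finset.mul_sum, sum_units_χ_mul_stdAddChar hp, map_mul]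
    ring
  have hz2 : ∀ a b c : ℤ, ¬ (p : ℤ) ^ 1 ∣ b →
      L (fun q₁ q₂ q₃ => e (((p ^ 2 * a : ℤ) : ℚ) * q₁ + b * q₂ + c * q₃)) = 0 := by
    intro a b c hb
    rw [hL2]
    refine Finset.sum_eq_zero fun z _ => ?_
    exact sum_units_red_mul_e_eq_zero p 1 (H a c z) hb
  refine ((IsTwistCoef.of_functional hA k (r := p) (s := 0) (t := 1)
    hq one_ne_zero L ?_
    (fun a b g => (p : ℂ) ^ 3 * ∑ x : (ZMod p)ˣ, ∑ z : (ZMod p)ˣ with z ≠ 1,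
          χ p ((1 - z) * (-a + b * x - g * (x : ZMod p) ^ 2 * z))) ?_ ?_).const_mul
      ((p : ℂ) ^ (-6 : ℤ))).congr (fun _ _ _ => rfl) ?_
  · intro y Φ
    simp only [L, Finset.mul_sum, mul_left_comm]
  · intro a b c h
    obtain ⟨a, rfl⟩ : (p : ℤ) ^ 2 ∣ a := by by_contra h'; exact h (hz _ _ _ h')
    obtain ⟨b, rfl⟩ : (p : ℤ) ^ 1 ∣ b := by by_contra h'; exact h (hz2 _ _ _ h')
    refine ⟨a, b, c, ?_, ?_, ?_⟩ <;> push_cast <;> ring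
  · intro a b c a' b' g' h1 h2 h3
    obtain rfl : a = p ^ 2 * a' := by
      have : (a : ℚ) = p ^ 2 * a' := mul_left_cancel₀ (pow_ne_zero 2 hq) (by linear_combination h1)
      exact_mod_cast this
    obtain rfl : b = p * b' := by
      have : (b : ℚ) = p * b' := mul_left_cancel₀ hq (by linear_combination h2)
      exact_mod_cast this
    obtain rfl : c = g' := by
      have : (c : ℚ) = g' := by linear_combination h3
      exact_mod_cast this
    exact hL3 _ _ _
  · intro a b g
    rw [show ((k : ℤ) - 3) = (k : ℤ) - (3 : ℕ) from rfl, zpow_sub_natCast_prime,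
      show (-6 : ℤ) = -(6 : ℕ) from rfl, zpow_neg_natCast_prime]
    -- The sums become opaque variables, so that only powers of `p` have to be compared.
    have hconst : ∀ S X : ℂ, (p : ℂ) ^ k / (p : ℂ) ^ 3 * S * X =
        ((p : ℂ) ^ 6)⁻¹ * (((p * 1 : ℚ) : ℂ) ^ k * ((p : ℂ) ^ 3 * S) * X) := by
      intro S X; push_cast; field_simp
    exact hconst _ _

end

/-! ### Operators 13 and 8 -/

section

variable {p : ℕ} [Fact p.Prime] {A : ℚ → ℚ → ℚ → ℂ}

lemma chi_unit_inv {n : ℕ} (u : (ZMod (p ^ (n + 1)))ˣ) : chi p u⁻¹.1 = chi p u.1 := by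
  rw [chi, red_unit_inv, χ_inv, chi]

/-- The phase is homogeneous of degree one in `(a, b)`: putting `a = b c` makes it `b (u + v c + w
c²)`, and the sum over `b` is a Ramanujan sum. -/
lemma sum_units_homogeneous (hp : p ≠ 2) {u : ZMod p} (hu : u ≠ 0) (v w : ZMod p) :
    ∑ a : (ZMod p)ˣ, ∑ b : (ZMod p)ˣ,
      ZMod.stdAddChar (u * b.1 + w * a.1 ^ 2 * b.1⁻¹ + v * a.1) =
      p * χ p (v ^ 2 - 4 * u * w) - ramanujan p w := by
  rw [← sum_units_ramanujan_quadratic hp hu, Finset.sum_comm]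
  rw [Finset.sum_congr rfl fun (b : (ZMod p)ˣ) _ => (Equiv.sum_comp (Equiv.mulLeft b) _).symm,
    Finset.sum_comm]
  refine Finset.sum_congr rfl fun c _ => ?_
  rw [← sum_units_stdAddChar]
  refine Finset.sum_congr rfl fun b _ => ?_
  have hb : (b : ZMod p) ≠ 0 := b.ne_zero
  congr 1
  simp only [Equiv.coe_mulLeft, Units.val_mul]
  field_simp
  ring

/-- The variable `b` occurs inverted in the entry with the largest denominator; passing to `b⁻¹`
makes that phase linear and forces `p² ∣ c`. The sum over `x` gives `χ(ab) W(χ)`, whose factor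
`χ(b)` cancels the weight, and an unweighted homogeneous sum is left. -/
lemma isTwistCoef13 (hp : p ≠ 2) (hA : IsCoefFun A) (k : ℕ) :
    IsTwistCoef p 2 (fun α m γ => twistSum13 p (coefQP A k α m γ))
      (fun a b g => (p : ℂ) ^ ((k : ℤ) - 3) * (χ p a * (p * χ p (b ^ 2 - 4 * a * g) - ramanujan p g)) *
        coefAt A (p ^ 2) 0 ((p : ℚ)⁻¹) (p ^ 4 * a) (p ^ 2 * b) g) := by
  have hq : (p : ℚ) ≠ 0 := natCast_prime_ne_zero p ℚ
  have hc : (p : ℂ) ≠ 0 := natCast_prime_ne_zero p ℂ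
  let L : (ℚ → ℚ → ℚ → ℂ) → ℂ := fun Φ =>
    ∑ a : (ZMod (p ^ 2))ˣ, ∑ b : (ZMod (p ^ 3))ˣ, ∑ x : (ZMod p)ˣ,
      chi p b.1 * chi p x.1 *
        Φ (rep b.1 * (1 + rep x.1) / p) (rep a.1 / p ^ 2) (rep a.1 ^ 2 * rep b⁻¹.1 / p ^ 3)
  let G : ℤ → (ZMod p)ˣ → ZMod p → ℂ := fun a z b =>
    χ p z * (χ p b * ZMod.stdAddChar (a * b⁻¹ * (1 + z) : ZMod p))
  have hL : ∀ a b c : ℤ, L (fun q₁ q₂ q₃ => e (a * q₁ + b * q₂ + c * q₃)) =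
      ∑ z : (ZMod p)ˣ, ∑ u : (ZMod (p ^ 2))ˣ,
        (∑ v : (ZMod (p ^ 3))ˣ, G a z (red p v.1) *
          e ((c * u.1.val ^ 2 : ℤ) * rep v.1 / p ^ 3)) * e (b * rep u.1 / p ^ 2) := by
    intro a b c
    simp only [L, Finset.sum_mul]
    rw [Finset.sum_congr rfl fun _ _ => Finset.sum_comm, Finset.sum_comm]
    refine Finset.sum_congr rfl fun z _ => Finset.sum_congr rfl fun u _ => ?_
    rw [← Equiv.sum_comp (Equiv.inv _)]
    refine Finset.sum_congr rfl fun v _ => ?_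
    simp only [Equiv.inv_apply, inv_inv, chi_unit_inv]
    rw [show (a : ℚ) * (rep v⁻¹.1 * (1 + rep z.1) / p) + b * (rep u.1 / p ^ 2) +
      c * (rep u.1 ^ 2 * rep v.1 / p ^ 3) = (c * u.1.val ^ 2 : ℤ) * rep v.1 / p ^ 3 +
        b * rep u.1 / p ^ 2 + (a * rep v⁻¹.1 * (1 + rep z.1)) / p by simp only [rep]; push_cast; ring,
      e_add, e_add, e_div_of_eq (n := a * v⁻¹.1.val * (1 + z.1.val))
        (y := (a * (red p v.1)⁻¹ * (1 + z) : ZMod p)) (by simp only [rep]; push_cast; rfl)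
        (by rw [← red_unit_inv]; push_cast; simp [red]), chi_self]
    simp only [G, chi]; ring
  have hz : ∀ a b c : ℤ, ¬ (p : ℤ) ^ 2 ∣ c →
      L (fun q₁ q₂ q₃ => e (a * q₁ + b * q₂ + c * q₃)) = 0 := by
    intro a b c hd
    rw [hL]
    refine Finset.sum_eq_zero fun z _ => Finset.sum_eq_zero fun u _ => ?_
    rw [sum_units_red_mul_e_eq_zero p 2 (G a z), zero_mul]
    intro h
    exact hd (((isCoprime_val_unit p u).pow (m := 2) (n := 2)).dvd_of_dvd_mul_right h)
  let H : ℤ → ℤ → (ZMod p)ˣ → ZMod p → ℂ := fun a c z x => (p : ℂ) ^ 2 * ∑ v : (ZMod p)ˣ,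
    G a z v * ZMod.stdAddChar (((c : ℤ) : ZMod p) * x ^ 2 * v.1)
  have hL2 : ∀ a b c : ℤ, L (fun q₁ q₂ q₃ => e (a * q₁ + b * q₂ + ((p ^ 2 * c : ℤ) : ℚ) * q₃)) =
      ∑ z : (ZMod p)ˣ, ∑ u : (ZMod (p ^ 2))ˣ,
        H a c z (red p u.1) * e (b * rep u.1 / p ^ 2) := by
    intro a b c
    rw [hL]
    refine Finset.sum_congr rfl fun z _ => Finset.sum_congr rfl fun u _ => ?_
    rw [show (p : ℤ) ^ 2 * c * u.1.val ^ 2 = p ^ 2 * (c * u.1.val ^ 2) by ring,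
      sum_units_red_mul_e p 2 (G a z)]
    simp only [H]
    push_cast
    rfl
  have hL3 : ∀ a b c : ℤ,
      L (fun q₁ q₂ q₃ => e (a * q₁ + ((p * b : ℤ) : ℚ) * q₂ + ((p ^ 2 * c : ℤ) : ℚ) * q₃)) =
      gaussW p * ((p : ℂ) ^ 3 * (χ p a * (p * χ p (b ^ 2 - 4 * a * c) - ramanujan p c))) := by
    intro a b c
    have h0 : ∀ z : (ZMod p)ˣ, ∑ u : (ZMod (p ^ 2))ˣ, H a c z (red p u.1) *
        e (((p * b : ℤ) : ℚ) * rep u.1 / p ^ 2) = ∑ u : (ZMod p)ˣ, ∑ v : (ZMod p)ˣ,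
        (p : ℂ) ^ 3 * (χ p v * ZMod.stdAddChar (a * v + c * (u : ZMod p) ^ 2 * (v : ZMod p)⁻¹ + b * u : ZMod p)) *
          (χ p z * ZMod.stdAddChar (a * v * z : ZMod p)) := by
      intro z
      have := sum_units_red_mul_e p 1 (H a c z) b
      rw [pow_one] at this
      rw [this]
      simp only [H, G, Finset.mul_sum, Finset.sum_mul]
      refine Finset.sum_congr rfl fun u _ => ?_
      -- Modulo `p` the inversion is undone, to reach the shape of `sum_units_homogeneous`.
      rw [← Equiv.sum_comp (Equiv.inv _)]
      refine Finset.sum_congr rfl fun v _ => ?_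
      simp only [Equiv.inv_apply, Units.val_inv_eq_inv_val, inv_inv, χ_inv]
      rw [show (a * (v : ZMod p) * (1 + z) : ZMod p) = a * v + a * v * z by ring,
        AddChar.map_add_eq_mul, AddChar.map_add_eq_mul, AddChar.map_add_eq_mul]
      ring
    rw [hL2, Finset.sum_congr rfl fun z _ => h0 z, Finset.sum_comm,
      Finset.sum_congr rfl fun u _ => Finset.sum_comm]
    simp_rw [← Finset.mul_sum, sum_units_χ_mul_stdAddChar hp]
    -- The homogeneous sum is known for a nonzero leading coefficient; otherwise `χ(a)` kills both
    -- sides.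
    rcases eq_or_ne (a : ZMod p) 0 with ha | ha
    · have h0 : χ p (a : ZMod p) = 0 := by rw [ha]; exact MulChar.map_zero _
      simp only [map_mul, h0, zero_mul, mul_zero, Finset.sum_const_zero]
    rw [← sum_units_homogeneous hp ha]
    simp only [Finset.mul_sum]
    refine Finset.sum_congr rfl fun u _ => Finset.sum_congr rfl fun v _ => ?_
    rw [map_mul]
    have := χ_sq (p := p) (x := (v : ZMod p)) v.ne_zero
    linear_combination (χ p a * (p : ℂ) ^ 3 * gaussW p *
      ZMod.stdAddChar (a * v + c * (u : ZMod p) ^ 2 * (v : ZMod p)⁻¹ + b * u : ZMod p)) * this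
  have hz2 : ∀ a b c : ℤ, ¬ (p : ℤ) ^ 1 ∣ b →
      L (fun q₁ q₂ q₃ => e (a * q₁ + b * q₂ + ((p ^ 2 * c : ℤ) : ℚ) * q₃)) = 0 := by
    intro a b c hb
    rw [hL2]
    refine Finset.sum_eq_zero fun z _ => ?_
    exact sum_units_red_mul_e_eq_zero p 1 (H a c z) hb
  refine ((IsTwistCoef.of_functional hA k (r := p ^ 2) (s := 0) (t := (p : ℚ)⁻¹)
    (by positivity) (by positivity) L ?_
    (fun a b g => (p : ℂ) ^ 3 * (χ p a * (p * χ p (b ^ 2 - 4 * a * g) - ramanujan p g)))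
      ?_ ?_).const_mul ((p : ℂ) ^ (-6 : ℤ))).congr (fun _ _ _ => rfl) ?_
  · intro y Φ
    simp only [L, Finset.mul_sum, mul_left_comm]
  · intro a b c h
    obtain ⟨c, rfl⟩ : (p : ℤ) ^ 2 ∣ c := by by_contra h'; exact h (hz _ _ _ h')
    obtain ⟨b, rfl⟩ : (p : ℤ) ^ 1 ∣ b := by by_contra h'; exact h (hz2 _ _ _ h')
    refine ⟨a, b, c, ?_, ?_, ?_⟩ <;> push_cast <;> field_simp <;> ring
  · intro a b c a' b' g' h1 h2 h3
    obtain rfl : a = a' := by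
      have : (a : ℚ) = a' := mul_left_cancel₀ (pow_ne_zero 4 hq) (by linear_combination h1)
      exact_mod_cast this
    obtain rfl : b = p * b' := by
      field_simp at h2
      have : (b : ℚ) = p * b' := by linear_combination h2
      exact_mod_cast this
    obtain rfl : c = p ^ 2 * g' := by
      field_simp at h3
      have : (c : ℚ) = p ^ 2 * g' := by linear_combination h3
      exact_mod_cast this
    exact hL3 _ _ _
  · intro a b g
    rw [show ((k : ℤ) - 3) = (k : ℤ) - (3 : ℕ) from rfl, zpow_sub_natCast_prime,
      show (-6 : ℤ) = -(6 : ℕ) from rfl, zpow_neg_natCast_prime,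
      show ((p ^ 2 * (p : ℚ)⁻¹ : ℚ)) = p by field_simp]
    push_cast
    field_simp

/-- The phase is linear in `z` modulo `p³`, which forces `p² ∣ a`. It is then linear in the first
parameter, with coefficient `a x (1 - z) + b`, and this parameter carries the Gauss sum. As `t = p`,
the variable `x` in `s = x/p` counts modulo `p²`. -/
lemma isTwistCoef8 (hp : p ≠ 2) (hA : IsCoefFun A) (k : ℕ) :
    IsTwistCoef p 2 (fun α m γ => twistSum8 p (coefQP A k α m γ))
      (fun a b g => (p : ℂ) ^ (2 * (k : ℤ) - 4) * ∑ x : (ZMod (p ^ 2))ˣ,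
        (∑ z : (ZMod p)ˣ with z ≠ 1,
          χ p (red p x.1 * z * (1 - z) * (b - a * red p x.1 - z * a * red p x.1))) *
        coefAt A p (rep x.1 / p) p (p ^ 4 * a) (p ^ 2 * b) g) := by
  have hq : (p : ℚ) ≠ 0 := natCast_prime_ne_zero p ℚ
  have hc : (p : ℂ) ≠ 0 := natCast_prime_ne_zero p ℂ
  let L : (ZMod (p ^ 3))ˣ → (ℚ → ℚ → ℚ → ℂ) → ℂ := fun b Φ =>
    ∑ a : (ZMod (p ^ 3))ˣ, ∑ z : (ZMod (p ^ 3))ˣ with red p z.1 ≠ 1,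
      chi p (a * b * z * (1 - z) : ZMod (p ^ 3)) *
        Φ (rep (a * b * (1 - z) : ZMod (p ^ 3)) / p ^ 3) (rep a.1 / p) 0
  -- The restriction `z ≢ 1` is absorbed into the weight, since the fibre lemmas sum over all units.
  let G : ZMod p → ZMod p → ZMod p → ℂ := fun a b z =>
    if z ≠ 1 then χ p (a * b * z * (1 - z)) else 0
  have hL : ∀ x, ∀ a b c : ℤ, L x (fun q₁ q₂ q₃ => e (a * q₁ + b * q₂ + c * q₃)) =
      ∑ u : (ZMod (p ^ 3))ˣ, (∑ z : (ZMod (p ^ 3))ˣ, G (red p u.1) (red p x.1) (red p z.1) *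
        e ((-(a * u.1.val * x.1.val) : ℤ) * rep z.1 / p ^ 3)) *
        e (a * rep u.1 * rep x.1 / p ^ 3 + b * rep u.1 / p) := by
    intro x a b c
    simp only [L, Finset.sum_filter, Finset.sum_mul]
    refine Finset.sum_congr rfl fun u _ => Finset.sum_congr rfl fun z _ => ?_
    simp only [G]
    split_ifs with hz
    · rw [chi, red_mul, red_mul, red_mul, red_sub, red_one, mul_assoc (χ p _) (e _), ← e_add]
      -- The representative of a product and the product of representatives differ by `p³ j`, which
      -- changes the phase by the integer `a j`.
      obtain ⟨j, hj⟩ := exists_rep_eq (N := p ^ 3) (x := (u * x * (1 - z) : ZMod (p ^ 3)))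
        (n := u.1.val * x.1.val * (1 - z.1.val)) (by push_cast; simp)
      rw [hj]
      congr 1
      refine e_eq_of_sub (a * j) ?_
      simp only [rep]
      push_cast
      field_simp
      ring
    · simp
  have hz : ∀ x, ∀ a b c : ℤ, ¬ (p : ℤ) ^ 2 ∣ a →
      L x (fun q₁ q₂ q₃ => e (a * q₁ + b * q₂ + c * q₃)) = 0 := by
    intro x a b c hd
    rw [hL]
    refine Finset.sum_eq_zero fun u _ => ?_
    rw [sum_units_red_mul_e_eq_zero p 2 (G (red p u.1) (red p x.1)), zero_mul]
    intro h
    rw [dvd_neg] at h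
    exact hd ((isCoprime_val_unit p u).pow_left.dvd_of_dvd_mul_right
      ((isCoprime_val_unit p x).pow_left.dvd_of_dvd_mul_right h))
  have hL2 : ∀ x, ∀ a b c : ℤ,
      L x (fun q₁ q₂ q₃ => e (((p ^ 2 * a : ℤ) : ℚ) * q₁ + b * q₂ + c * q₃)) =
      gaussW p * ((p : ℂ) ^ 4 * ∑ z : (ZMod p)ˣ with z ≠ 1,
        χ p (red p x.1 * z * (1 - z) * (a * red p x.1 * (1 - z) + b))) := by
    intro x a b c
    rw [hL]
    have h1 : ∀ u : (ZMod (p ^ 3))ˣ, (∑ z : (ZMod (p ^ 3))ˣ, G (red p u.1) (red p x.1) (red p z.1) *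
        e ((-(p ^ 2 * a * u.1.val * x.1.val) : ℤ) * rep z.1 / p ^ 3)) *
        e ((p ^ 2 * a : ℤ) * rep u.1 * rep x.1 / p ^ 3 + b * rep u.1 / p) =
        (p : ℂ) ^ 2 * ∑ z : (ZMod p)ˣ, G (red p u.1) (red p x.1) z *
          ZMod.stdAddChar ((a * red p x.1 * (1 - z) + b) * red p u.1 : ZMod p) := by
      intro u
      rw [show (-(p ^ 2 * a * u.1.val * x.1.val) : ℤ) = p ^ 2 * (-(a * u.1.val * x.1.val)) by ring,
        sum_units_red_mul_e p 2 (G (red p u.1) (red p x.1)),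
        show ((p ^ 2 * a : ℤ) : ℚ) * rep u.1 * rep x.1 / p ^ 3 + b * rep u.1 / p =
          (a * rep u.1 * rep x.1 + b * rep u.1) / p by push_cast; field_simp,
        e_div_of_eq (n := a * u.1.val * x.1.val + b * u.1.val)
          (y := (a * red p u.1 * red p x.1 + b * red p u.1 : ZMod p)) (by simp only [rep]; push_cast; rfl)
          (by push_cast; simp [red]), mul_assoc, Finset.sum_mul]
      congr 1
      refine Finset.sum_congr rfl fun z _ => ?_
      rw [mul_assoc, ← AddChar.map_add_eq_mul]
      congr 2
      simp only [Int.cast_neg, Int.cast_mul, intCast_val_eq_red]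
      ring
    rw [Finset.sum_congr rfl fun u _ => h1 u, sum_units_red p 2 (fun y => (p : ℂ) ^ 2 *
      ∑ z : (ZMod p)ˣ, G y (red p x.1) z *
          ZMod.stdAddChar ((a * red p x.1 * (1 - z) + b) * y : ZMod p)), ← Finset.mul_sum,
      Finset.sum_comm, Finset.sum_filter, Finset.mul_sum, Finset.mul_sum, Finset.mul_sum,
      Finset.mul_sum]
    refine Finset.sum_congr rfl fun z _ => ?_
    have h1 : (z : ZMod p) ≠ 1 ↔ z ≠ 1 := not_congr Units.val_eq_one
    by_cases hz1 : z ≠ 1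
    · simp only [G, if_pos (h1.2 hz1), if_pos hz1]
      rw [Finset.sum_congr rfl (g := fun u : (ZMod p)ˣ => χ p (red p x.1 * z * (1 - z)) *
        (χ p u * ZMod.stdAddChar ((a * red p x.1 * (1 - z) + b) * u : ZMod p))), ← Finset.mul_sum,
        sum_units_χ_mul_stdAddChar hp, map_mul _ _ (a * red p x.1 * (1 - z) + b)]
      · ring
      · intro u _
        simp only [map_mul]; ring
    · simp only [G, if_neg (fun h => hz1 (h1.1 h)), if_neg hz1]
      simp
  have hswap : ∀ α m γ, twistSum8 p (coefQP A k α m γ) = (p : ℂ) ^ (-9 : ℤ) *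
      ∑ x : (ZMod (p ^ 3))ˣ,
        L x (fun q₁ q₂ q₃ => coefQP A k α m γ q₁ q₂ q₃ p (rep x.1 / p) p) := by
    intro α m γ
    rw [twistSum8, Finset.sum_comm]
  refine ((IsTwistCoef.sum (s := Finset.univ) fun (x : (ZMod (p ^ 3))ˣ) _ =>
    IsTwistCoef.of_functional hA k (r := p) (s := rep x.1 / p) (t := p)
    hq hq (L x) ?_
    (fun a b _ => (p : ℂ) ^ 4 * ∑ z : (ZMod p)ˣ with z ≠ 1,
        χ p (red p x.1 * z * (1 - z) * (b - a * red p x.1 - z * a * red p x.1))) ?_ ?_).const_mul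
      ((p : ℂ) ^ (-9 : ℤ))).congr hswap ?_
  · intro y Φ
    simp only [L, Finset.mul_sum, mul_left_comm]
  · intro a b c h
    obtain ⟨a, rfl⟩ : (p : ℤ) ^ 2 ∣ a := by by_contra h'; exact h (hz _ _ _ _ h')
    refine ⟨a, b + 2 * x.1.val * a, p ^ 2 * c + x.1.val * b + x.1.val ^ 2 * a, ?_, ?_, ?_⟩ <;>
      (try simp only [rep]) <;> push_cast <;> field_simp
  · intro a b c a' b' g' h1 h2 h3
    obtain rfl : a = p ^ 2 * a' := by
      have : (a : ℚ) = p ^ 2 * a' := mul_left_cancel₀ (pow_ne_zero 2 hq) (by linear_combination h1)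
      exact_mod_cast this
    have hb : b = b' - 2 * x.1.val * a' := by
      have : (b : ℚ) = b' - 2 * x.1.val * a' := by
        rw [rep] at h2
        push_cast at h2
        field_simp at h2
        linear_combination h2
      exact_mod_cast this
    rw [hL2, hb]
    congr 2
    refine Finset.sum_congr rfl fun z _ => ?_
    congr 1
    simp only [Int.cast_sub, Int.cast_mul, intCast_val_eq_red, Int.cast_ofNat]
    ring
  · intro a b g
    have := sum_units_periodic (N := p ^ 3) (d := p ^ 2) (q := p) (by ring)
      (coprime_pow_succ_iff p 2 1)
      (fun x => (∑ z : (ZMod p)ˣ with z ≠ 1, χ p ((⌊x⌋ : ℤ) * z * (1 - z) *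
        (b - a * (⌊x⌋ : ℤ) - z * a * (⌊x⌋ : ℤ)))) *
          coefAt A p (x / p) p (p ^ 4 * a) (p ^ 2 * b) g) ?_
    · have hfl : ∀ {n : ℕ} (x : ZMod n), ((⌊rep x⌋ : ℤ) : ZMod p) = red p x := by
        intro n x; rw [rep_eq_intCast, Int.floor_intCast, intCast_val_eq_red]
      simp only [hfl] at this
      rw [show (2 * (k : ℤ) - 4) = ((2 * k : ℕ) : ℤ) - (4 : ℕ) by push_cast; ring,
        zpow_sub_natCast_prime,
        show (-9 : ℤ) = -(9 : ℕ) from rfl, zpow_neg_natCast_prime]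
      rw [Finset.sum_congr rfl (g := fun x : (ZMod (p ^ 3))ˣ => (p : ℂ) ^ (2 * k) * (p : ℂ) ^ 4 *
        ((∑ z : (ZMod p)ˣ with z ≠ 1,
          χ p (red p x.1 * z * (1 - z) * (b - a * red p x.1 - z * a * red p x.1))) *
        coefAt A p (rep x.1 / p) p (p ^ 4 * a) (p ^ 2 * b) g)), ← Finset.mul_sum, this]
      · have hconst : ∀ S : ℂ, (p : ℂ) ^ (2 * k) / (p : ℂ) ^ 4 * S =
            ((p : ℂ) ^ 9)⁻¹ * ((p : ℂ) ^ (2 * k) * (p : ℂ) ^ 4 * (p * S)) := by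
          intro S; field_simp
        exact hconst _
      · intros; push_cast; ring
    · intro x j
      rw [show x + ((p ^ 2 : ℕ) : ℚ) * j = x + ((p ^ 2 * j : ℤ) : ℚ) by push_cast; ring,
        Int.floor_add_intCast,
        hA.coefAt_eq_of hq hq (s' := x / p) j (by push_cast; field_simp; ring)]
      simp

end

/-! ### A stationary phase modulo `p²`; operators 6 and 9 -/

section

variable {p : ℕ} [Fact p.Prime] {A : ℚ → ℚ → ℚ → ℂ}

/-- Writing `d = d₀ + p j` changes the polynomial modulo `p²` by `p j` times its derivative at `d₀`.
The sum over `j` thus keeps only the root of `2u d + v` modulo `p`, a unit exactly when `p ∤ v`.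
There, `4u` times the polynomial is `4uw - v²` plus a multiple of `p²`, so the sum over `a` is `p`
times a Ramanujan sum, or zero. -/
lemma sum_e_quadratic (hp : p ≠ 2) {u : ℤ} (hu : (u : ZMod p) ≠ 0) (v w : ℤ) :
    ∑ d : (ZMod (p ^ 2))ˣ, ∑ a : (ZMod (p ^ 2))ˣ,
      e ((u * d.1.val ^ 2 + v * d.1.val + w : ℤ) * rep a.1 / p ^ 2) =
      if ¬ (p : ℤ) ∣ v ∧ (p : ℤ) ∣ 4 * u * w - v ^ 2 then
        (p : ℂ) ^ 2 * ramanujan p (((4 * u * w - v ^ 2) / p : ℤ)) else 0 := by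
  have hq : (p : ℚ) ≠ 0 := natCast_prime_ne_zero p ℚ
  have hp0 : p ≠ 0 := (Fact.out : p.Prime).ne_zero
  have hpz : (p : ℤ) ≠ 0 := by exact_mod_cast hp0
  have h2 := two_ne_zero_zmod hp
  have h2u : 2 * (u : ZMod p) ≠ 0 := mul_ne_zero h2 hu
  have h4u : 4 * (u : ZMod p) ≠ 0 := by
    rw [show (4 : ZMod p) = 2 * 2 by norm_num]; exact mul_ne_zero (mul_ne_zero h2 h2) hu
  have h4u' : IsCoprime (p : ℤ) (4 * u) := by
    rw [Prime.coprime_iff_not_dvd (Nat.prime_iff_prime_int.1 Fact.out),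
      ← ZMod.intCast_zmod_eq_zero_iff_dvd]
    exact_mod_cast h4u
  have hR : ∀ n : ℤ, ∑ a : (ZMod (p ^ 2))ˣ, e (n * rep a.1 / p ^ 2) =
      if (p : ℤ) ∣ n then (p : ℂ) * ramanujan p ((n / p : ℤ)) else 0 := by
    intro n
    split_ifs with hn
    · obtain ⟨n, rfl⟩ := hn
      rw [Int.mul_ediv_cancel_left _ hpz]
      have := sum_e_pow p 1 n
      rw [pow_one, pow_one] at this
      exact this
    · exact sum_e_pow_eq_zero p 1 (by rwa [pow_one])
  have h1 : ∀ a : (ZMod (p ^ 2))ˣ, ∑ d : (ZMod (p ^ 2))ˣ,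
      e ((u * d.1.val ^ 2 + v * d.1.val + w : ℤ) * rep a.1 / p ^ 2) =
      ∑ d : (ZMod p)ˣ, if 2 * (u : ZMod p) * d + v = 0 then
        (p : ℂ) * e ((u * d.1.val ^ 2 + v * d.1.val + w : ℤ) * rep a.1 / p ^ 2) else 0 := by
    intro a
    rw [sum_units_fiber (N := p ^ 2) (d := p) (q := p) (by ring) (coprime_pow_succ_iff' p 1)
      (fun x => e ((u * x ^ 2 + v * x + w : ℤ) * rep a.1 / p ^ 2))]
    refine Finset.sum_congr rfl fun d _ => ?_
    have h3 : ∀ j : ℕ, e ((u * (d.1.val + p * j : ℕ) ^ 2 + v * (d.1.val + p * j : ℕ) + w : ℤ) *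
        rep a.1 / p ^ 2) = e ((u * d.1.val ^ 2 + v * d.1.val + w : ℤ) * rep a.1 / p ^ 2) *
        e (((2 * u * d.1.val + v) * a.1.val : ℤ) * j / p) := by
      intro j
      rw [← e_add]
      refine e_eq_of_sub (u * j ^ 2 * a.1.val) ?_
      rw [rep]; push_cast; field_simp; ring
    rw [Finset.sum_congr rfl fun j _ => h3 j, ← Finset.mul_sum, sum_range_e hp0]
    have hiff : (p : ℤ) ∣ (2 * u * d.1.val + v) * a.1.val ↔ 2 * (u : ZMod p) * d + v = 0 := by
      rw [show (p : ℤ) ∣ (2 * u * d.1.val + v) * a.1.val ↔ (p : ℤ) ∣ 2 * u * d.1.val + v from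
        ⟨(isCoprime_val_unit p a).dvd_of_dvd_mul_right, fun h => h.mul_right _⟩, ← ZMod.intCast_zmod_eq_zero_iff_dvd]
      push_cast; simp
    simp only [hiff]
    split_ifs
    · ring
    · ring
  rw [Finset.sum_comm, Finset.sum_congr rfl fun a _ => h1 a, Finset.sum_comm]
  by_cases hv : (v : ZMod p) = 0
  · rw [if_neg (fun h => h.1 ((ZMod.intCast_zmod_eq_zero_iff_dvd _ _).1 hv))]
    refine Finset.sum_eq_zero fun d _ => Finset.sum_eq_zero fun a _ => ?_
    rw [if_neg]
    rw [hv, add_zero]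
    exact mul_ne_zero h2u d.ne_zero
  have hv' : ¬ (p : ℤ) ∣ v := fun h => hv ((ZMod.intCast_zmod_eq_zero_iff_dvd _ _).2 h)
  let d₀ : (ZMod p)ˣ := Units.mk0 (-(v : ZMod p) / (2 * u)) (div_ne_zero (neg_ne_zero.2 hv) h2u)
  have hd₀ : 2 * (u : ZMod p) * d₀ + v = 0 := by
    simp only [d₀, Units.val_mk0]; field_simp; ring
  rw [Finset.sum_eq_single d₀]
  · simp only [hd₀, if_true]
    rw [← Finset.mul_sum, hR]
    obtain ⟨t, ht⟩ : (p : ℤ) ∣ 2 * u * d₀.1.val + v := by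
      rw [← ZMod.intCast_zmod_eq_zero_iff_dvd, ← hd₀]
      push_cast; simp
    set n : ℤ := u * d₀.1.val ^ 2 + v * d₀.1.val + w with hn
    have hE : 4 * u * n = p * (p * t ^ 2) + (4 * u * w - v ^ 2) := by
      have : 4 * u * n = (2 * u * d₀.1.val + v) ^ 2 + (4 * u * w - v ^ 2) := by rw [hn]; ring
      rw [this, ht]; ring
    have hiff : (p : ℤ) ∣ n ↔ (p : ℤ) ∣ 4 * u * w - v ^ 2 := by
      have h5 : (p : ℤ) ∣ 4 * u * n ↔ (p : ℤ) ∣ 4 * u * w - v ^ 2 := by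
        rw [hE, dvd_add_right (dvd_mul_right _ _)]
      exact ⟨fun h => h5.1 (h.mul_left _), fun h => h4u'.dvd_of_dvd_mul_left (h5.2 h)⟩
    by_cases hdv : (p : ℤ) ∣ n
    · rw [if_pos hdv, if_pos ⟨hv', hiff.1 hdv⟩]
      obtain ⟨n', hn'⟩ := hdv
      rw [hn'] at hE ⊢
      have hE' : 4 * u * w - v ^ 2 = p * (4 * u * n' - p * t ^ 2) := by linear_combination -hE
      rw [hE', Int.mul_ediv_cancel_left _ hpz, Int.mul_ediv_cancel_left _ hpz, ← ramanujan_mul h4u]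
      push_cast
      simp only [CharP.cast_eq_zero, zero_mul, sub_zero]
      ring
    · rw [if_neg hdv, if_neg (fun h => hdv (hiff.2 h.2)), mul_zero]
  · intro d _ hd
    refine Finset.sum_eq_zero fun a _ => if_neg fun h => hd ?_
    apply Units.ext
    apply mul_left_cancel₀ h2u
    linear_combination h - hd₀
  · intro h; exact absurd (Finset.mem_univ _) h

/-- The sum over `x` gives `χ(ab) W(χ)` and its `χ(b)` cancels the weight. The remaining
Kloosterman-like double sum modulo `p²` is homogeneous, and rescaling reduces it to
`sum_e_quadratic`. -/
lemma isTwistCoef6 (hp : p ≠ 2) (hA : IsCoefFun A) (k : ℕ) :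
    IsTwistCoef p 2 (fun α m γ => twistSum6 p (coefQP A k α m γ))
      (fun a b g => (p : ℂ) ^ (2 * (k : ℤ) - 4) * (χ p a *
        if ¬ (p : ℤ) ∣ b ∧ (p : ℤ) ∣ 4 * a * g - b ^ 2 then
          ramanujan p (((4 * a * g - b ^ 2) / p : ℤ)) else 0) *
        coefAt A (p ^ 2) 0 1 (p ^ 4 * a) (p ^ 2 * b) g) := by
  have hq : (p : ℚ) ≠ 0 := natCast_prime_ne_zero p ℚ
  have hc : (p : ℂ) ≠ 0 := natCast_prime_ne_zero p ℂ
  let L : (ℚ → ℚ → ℚ → ℂ) → ℂ := fun Φ =>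
    ∑ a : (ZMod (p ^ 2))ˣ, ∑ b : (ZMod (p ^ 2))ˣ, ∑ x : (ZMod p)ˣ,
      chi p b.1 * chi p x.1 * Φ (rep b.1 * (1 + rep x.1 * p) / p ^ 2) (rep a.1 / p ^ 2)
          (rep a.1 ^ 2 * rep b⁻¹.1 / p ^ 2)
  have hΨ : ∀ n : ℤ, e ((n : ℚ) / p ^ 2) = ZMod.stdAddChar (n : ZMod (p ^ 2)) := by
    intro n
    have := e_div_natCast (N := p ^ 2) n
    push_cast at this
    exact this
  have hL : ∀ a b c : ℤ, L (fun q₁ q₂ q₃ => e (a * q₁ + b * q₂ + c * q₃)) =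
      χ p a * gaussW p * ∑ u : (ZMod (p ^ 2))ˣ, ∑ v : (ZMod (p ^ 2))ˣ,
        ZMod.stdAddChar (a * v.1 + b * u.1 + c * u.1 ^ 2 * v⁻¹.1 : ZMod (p ^ 2)) := by
    intro a b c
    simp only [Finset.mul_sum]
    refine Finset.sum_congr rfl fun u _ => Finset.sum_congr rfl fun v _ => ?_
    rw [show ZMod.stdAddChar (a * v.1 + b * u.1 + c * u.1 ^ 2 * v⁻¹.1 : ZMod (p ^ 2)) =
      e (((a * v.1.val + b * u.1.val + c * u.1.val ^ 2 * v⁻¹.1.val : ℤ) : ℚ) / p ^ 2) by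
        rw [hΨ]; push_cast; simp only [ZMod.natCast_zmod_val]]
    have h1 := sum_chi_mul_e p hp (a * v.1.val)
    rw [show ((a * v.1.val : ℤ) : ZMod p) = a * red p v.1 by rw [Int.cast_mul, intCast_val_eq_red],
      map_mul] at h1
    have h2 := χ_sq (red_unit_ne_zero p v)
    have h3 : χ p a * gaussW p = chi p v.1 * ∑ u : (ZMod p)ˣ,
        chi p u.1 * e ((a * v.1.val : ℤ) * rep u.1 / p) := by
      rw [h1, chi]; linear_combination -(χ p a * gaussW p) * h2
    rw [h3, Finset.mul_sum, Finset.sum_mul]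
    refine Finset.sum_congr rfl fun x _ => ?_
    dsimp only
    rw [show (a : ℚ) * (rep v.1 * (1 + rep x.1 * p) / p ^ 2) + b * (rep u.1 / p ^ 2) +
      c * (rep u.1 ^ 2 * rep v⁻¹.1 / p ^ 2) = (a * v.1.val : ℤ) * rep x.1 / p +
      ((a * v.1.val + b * u.1.val + c * u.1.val ^ 2 * v⁻¹.1.val : ℤ) : ℚ) / p ^ 2 by
        simp only [rep]; push_cast; field_simp; ring, e_add]
    ring
  have hK : ∀ a b c : ℤ, ∑ u : (ZMod (p ^ 2))ˣ, ∑ v : (ZMod (p ^ 2))ˣ,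
        ZMod.stdAddChar (a * v.1 + b * u.1 + c * u.1 ^ 2 * v⁻¹.1 : ZMod (p ^ 2)) =
      ∑ d : (ZMod (p ^ 2))ˣ, ∑ u : (ZMod (p ^ 2))ˣ,
        e ((a * d.1.val ^ 2 + b * d.1.val + c : ℤ) * rep u.1 / p ^ 2) := by
    intro a b c
    -- Setting `v = u d` and then replacing `u` by `d u` clears the inverse: the phase becomes `u (a
    -- d² + b d + c)`.
    rw [Finset.sum_congr rfl fun (u : (ZMod (p ^ 2))ˣ) _ =>
      (Equiv.sum_comp (Equiv.mulLeft u) _).symm, Finset.sum_comm]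
    refine Finset.sum_congr rfl fun d _ => ?_
    rw [← Equiv.sum_comp (Equiv.mulLeft d)]
    refine Finset.sum_congr rfl fun u _ => ?_
    rw [rep, show ((a * d.1.val ^ 2 + b * d.1.val + c : ℤ) : ℚ) * u.1.val =
      (((a * d.1.val ^ 2 + b * d.1.val + c) * u.1.val : ℤ) : ℚ) by push_cast; ring, hΨ]
    congr 1
    simp only [Equiv.coe_mulLeft, _root_.mul_inv_rev, Units.val_mul]
    push_cast
    simp only [ZMod.natCast_zmod_val]
    have hu := Units.mul_inv u
    have hd := Units.mul_inv d
    linear_combination (c * u.1 * (d.1 * d⁻¹.1) ^ 2) * hu +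
      (c * u.1 * (d.1 * d⁻¹.1 + 1)) * hd
  refine ((IsTwistCoef.of_functional hA k (r := p ^ 2) (s := 0) (t := 1)
    (by positivity) one_ne_zero L ?_
    (fun a b g => (p : ℂ) ^ 2 * (χ p a *
        if ¬ (p : ℤ) ∣ b ∧ (p : ℤ) ∣ 4 * a * g - b ^ 2 then
          ramanujan p (((4 * a * g - b ^ 2) / p : ℤ)) else 0))
      ?_ ?_).const_mul ((p : ℂ) ^ (-6 : ℤ))).congr (fun _ _ _ => rfl) ?_
  · intro y Φ
    simp only [L, Finset.mul_sum, mul_left_comm]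
  · intro a b c h
    refine ⟨a, b, c, ?_, ?_, ?_⟩ <;> push_cast <;> ring
  · intro a b c a' b' g' h1 h2 h3
    obtain rfl : a = a' := by
      have : (a : ℚ) = a' := mul_left_cancel₀ (pow_ne_zero 4 hq) (by linear_combination h1)
      exact_mod_cast this
    obtain rfl : b = b' := by
      have : (b : ℚ) = b' := mul_left_cancel₀ (pow_ne_zero 2 hq) (by linear_combination h2)
      exact_mod_cast this
    obtain rfl : c = g' := by
      have : (c : ℚ) = g' := by linear_combination h3
      exact_mod_cast this
    rw [hL, hK]
    by_cases ha : (a : ZMod p) = 0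
    · have h0 : χ p (a : ZMod p) = 0 := by rw [ha]; exact MulChar.map_zero _
      simp only [h0, zero_mul, mul_zero]
    rw [sum_e_quadratic hp ha]
    split_ifs
    · ring
    · ring
  · intro a b g
    rw [show (2 * (k : ℤ) - 4) = ((2 * k : ℕ) : ℤ) - (4 : ℕ) by push_cast; ring,
        zpow_sub_natCast_prime,
      show (-6 : ℤ) = -(6 : ℕ) from rfl, zpow_neg_natCast_prime, mul_one]
    have hconst : ∀ S X : ℂ, (p : ℂ) ^ (2 * k) / (p : ℂ) ^ 4 * S * X =
        ((p : ℂ) ^ 6)⁻¹ * (((p ^ 2 : ℚ) : ℂ) ^ k * ((p : ℂ) ^ 2 * S) * X) := by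
      intro S X; push_cast; field_simp; ring
    exact hconst _ _

/-- The coefficient sees `x` modulo `p` only, the Ramanujan factor sees it modulo `p²`. Along the
fibre `x + p j` the argument of the latter is the quadratic `a j² - b₁ j + c₁` built from the
entries of `S`, and `4ac₁ - b₁²` equals `(4ag - b²)/p²`. -/
lemma isTwistCoef9 (hp : p ≠ 2) (hA : IsCoefFun A) (k : ℕ) :
    IsTwistCoef p 2 (fun α m γ => twistSum9 p (coefQP A k α m γ))
      (fun a b g => (p : ℂ) ^ (3 * (k : ℤ) - 5) * (χ p a * χ p (-((4 * a * g - b ^ 2) / p ^ 2) : ℤ)) *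
        ∑ x : (ZMod p)ˣ, coefAt A (p ^ 2) (rep x.1) p (p ^ 4 * a) (p ^ 2 * b) g) := by
  have hq : (p : ℚ) ≠ 0 := natCast_prime_ne_zero p ℚ
  have hc : (p : ℂ) ≠ 0 := natCast_prime_ne_zero p ℂ
  have hp0 : p ≠ 0 := (Fact.out : p.Prime).ne_zero
  have hpz : (p : ℤ) ^ 2 ≠ 0 := by positivity
  let L : (ℚ → ℚ → ℚ → ℂ) → ℂ := fun Φ => ∑ b : (ZMod p)ˣ, ∑ x : (ZMod p)ˣ,
      chi p b.1 * Φ (rep b.1 / p) 0 (rep x.1 / p)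
  have hL : ∀ a b c : ℤ, L (fun q₁ q₂ q₃ => e (a * q₁ + b * q₂ + c * q₃)) =
      χ p a * gaussW p * ramanujan p c := by
    intro a b c
    rw [← sum_chi_mul_e p hp, ← sum_e_unit, ← sum_mul_sum']
    refine Finset.sum_congr rfl fun _ _ => Finset.sum_congr rfl fun _ _ => ?_
    dsimp only; rw [mul_zero, add_zero, e_add]; ring_nf
  refine ((IsTwistCoef.sum (s := Finset.univ) fun (x : (ZMod (p ^ 2))ˣ) _ =>
    IsTwistCoef.of_functional hA k (r := p ^ 2) (s := rep x.1) (t := p)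
    (by positivity) hq L ?_
    (fun a b g => χ p a * ramanujan p (((g - x.1.val * b + x.1.val ^ 2 * a) / p ^ 2 : ℤ)))
      ?_ ?_).const_mul ((p : ℂ) ^ (-6 : ℤ))).congr (fun _ _ _ => rfl) ?_
  · intro y Φ
    simp only [L, Finset.mul_sum, mul_left_comm]
  · intro a b c h
    refine ⟨a, p * b + 2 * x.1.val * a, p ^ 2 * c + x.1.val * p * b + x.1.val ^ 2 * a, ?_, ?_, ?_⟩ <;>
      (try rw [rep]) <;> push_cast <;> ring
  · intro a b c a' b' g' h1 h2 h3
    obtain rfl : a = a' := by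
      have : (a : ℚ) = a' := mul_left_cancel₀ (pow_ne_zero 4 hq) (by linear_combination h1)
      exact_mod_cast this
    obtain rfl : b' = p * b + 2 * x.1.val * a := by
      have : (b' : ℚ) = p * b + 2 * x.1.val * a := by
        rw [rep] at h2
        exact mul_left_cancel₀ (pow_ne_zero 2 hq) (by linear_combination -h2)
      exact_mod_cast this
    obtain rfl : g' = p ^ 2 * c + x.1.val * p * b + x.1.val ^ 2 * a := by
      have : (g' : ℚ) = p ^ 2 * c + x.1.val * p * b + x.1.val ^ 2 * a := by
        rw [rep] at h3
        linear_combination -h3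
      exact_mod_cast this
    rw [hL, show p ^ 2 * c + x.1.val * p * b + x.1.val ^ 2 * a -
      x.1.val * (p * b + 2 * x.1.val * a) + x.1.val ^ 2 * a = (p : ℤ) ^ 2 * c by ring,
      Int.mul_ediv_cancel_left _ hpz]
    ring
  · intro a b g
    by_cases ha : (a : ZMod p) = 0
    · have h0 : χ p (a : ZMod p) = 0 := by rw [ha]; exact MulChar.map_zero _
      simp only [h0, zero_mul, mul_zero, Finset.sum_const_zero]
    have hfl : ∀ {n : ℕ} (x : ZMod n), ⌊rep x⌋ = x.val := by
      intro n x; rw [rep_eq_intCast, Int.floor_intCast]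
    have key : ∑ x : (ZMod (p ^ 2))ˣ, ramanujan p (((g - x.1.val * b + x.1.val ^ 2 * a) / p ^ 2 : ℤ)) *
        coefAt A (p ^ 2) (rep x.1) p (p ^ 4 * a) (p ^ 2 * b) g =
        ∑ x : (ZMod p)ˣ, p * χ p (-((4 * a * g - b ^ 2) / p ^ 2) : ℤ) *
          coefAt A (p ^ 2) (rep x.1) p (p ^ 4 * a) (p ^ 2 * b) g := by
      have := sum_units_lift p 1 (fun r _ => ramanujan p (((g - ⌊r⌋ * b + ⌊r⌋ ^ 2 * a) / p ^ 2 : ℤ)) *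
        coefAt A (p ^ 2) r p (p ^ 4 * a) (p ^ 2 * b) g)
      simp only [hfl] at this
      refine this.trans (Finset.sum_congr rfl fun x _ => ?_)
      have hAx : ∀ j : ℕ, coefAt A (p ^ 2) (rep x.1 + p * j) p (p ^ 4 * a) (p ^ 2 * b) g =
          coefAt A (p ^ 2) (rep x.1) p (p ^ 4 * a) (p ^ 2 * b) g := by
        intro j
        exact hA.coefAt_eq_of hq (by positivity) j (by push_cast; ring) _ _ _
      simp only [hAx, ← Finset.sum_mul]
      -- The integer divisions by `p²` are known to be exact only where `S` is integral; elsewhere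
      -- the coefficient is zero.
      by_cases h0 : coefAt A (p ^ 2) (rep x.1) p (p ^ 4 * a) (p ^ 2 * b) g = 0
      · rw [h0, mul_zero, mul_zero]
      congr 1
      obtain ⟨a₁, b₁, c₁, h1, h2, h3, -⟩ := hA.coefAt_integral (by positivity) hq h0
      obtain rfl : a = a₁ := by
        have : (a : ℚ) = a₁ := mul_left_cancel₀ (pow_ne_zero 4 hq) (by linear_combination h1)
        exact_mod_cast this
      obtain rfl : b = p * b₁ + 2 * x.1.val * a := by
        have : (b : ℚ) = p * b₁ + 2 * x.1.val * a := by
          rw [rep] at h2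
          exact mul_left_cancel₀ (pow_ne_zero 2 hq) (by linear_combination h2)
        exact_mod_cast this
      obtain rfl : g = p ^ 2 * c₁ + x.1.val * p * b₁ + x.1.val ^ 2 * a := by
        have : (g : ℚ) = p ^ 2 * c₁ + x.1.val * p * b₁ + x.1.val ^ 2 * a := by
          rw [rep] at h3
          linear_combination h3
        exact_mod_cast this
      rw [show 4 * a * (p ^ 2 * c₁ + x.1.val * p * b₁ + x.1.val ^ 2 * a) -
        (p * b₁ + 2 * x.1.val * a) ^ 2 = (p : ℤ) ^ 2 * (4 * a * c₁ - b₁ ^ 2) by ring,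
        Int.mul_ediv_cancel_left _ hpz]
      rw [show ((-(4 * a * c₁ - b₁ ^ 2) : ℤ) : ZMod p) = (-b₁ : ZMod p) ^ 2 - 4 * a * c₁ by
        push_cast; ring, ← sum_ramanujan_quadratic hp ha]
      have h4 := sum_zmod_eq_sum_range (N := p)
        (fun j => ramanujan p ((a : ZMod p) * (j : ZMod p) ^ 2 + (-b₁) * (j : ZMod p) + c₁))
      simp only [ZMod.natCast_zmod_val] at h4
      rw [h4, pow_one]
      refine Finset.sum_congr rfl fun j _ => ?_
      rw [show (rep x.1 + p * j : ℚ) = ((x.1.val + p * j : ℤ) : ℚ) by rw [rep]; push_cast; ring,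
        Int.floor_intCast,
        show (p ^ 2 * c₁ + x.1.val * p * b₁ + x.1.val ^ 2 * a -
          (x.1.val + p * j : ℤ) * (p * b₁ + 2 * x.1.val * a) + (x.1.val + p * j : ℤ) ^ 2 * a) =
          (p : ℤ) ^ 2 * (a * j ^ 2 + (-b₁) * j + c₁) by ring, Int.mul_ediv_cancel_left _ hpz]
      push_cast
      rfl
    rw [Finset.sum_congr rfl (g := fun x : (ZMod (p ^ 2))ˣ => (p : ℂ) ^ (3 * k) * χ p a *
      (ramanujan p (((g - x.1.val * b + x.1.val ^ 2 * a) / p ^ 2 : ℤ)) *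
        coefAt A (p ^ 2) (rep x.1) p (p ^ 4 * a) (p ^ 2 * b) g)), ← Finset.mul_sum, key,
      ← Finset.mul_sum]
    · rw [show (3 * (k : ℤ) - 5) = ((3 * k : ℕ) : ℤ) - (5 : ℕ) by push_cast; ring,
        zpow_sub_natCast_prime,
        show (-6 : ℤ) = -(6 : ℕ) from rfl, zpow_neg_natCast_prime]
      have hconst : ∀ S T X : ℂ, (p : ℂ) ^ (3 * k) / (p : ℂ) ^ 5 * (S * T) * X =
          ((p : ℂ) ^ 6)⁻¹ * ((p : ℂ) ^ (3 * k) * S * (p * T * X)) := by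
        intro S T X; field_simp
      exact hconst _ _ _
    · intro x _
      push_cast; ring

end

/-! ### Operators 12 and 1 -/

section

variable {p : ℕ} [Fact p.Prime] {A : ℚ → ℚ → ℚ → ℂ}

/-- The sum over `z` forces `p² ∣ a`, and the full sum over `y` forces `p⁴ ∣ a x + p b + p² c x⁻¹`;
together they give the integrality of `T = S[P]`. With `a = p² a'`, the Gauss sum in the unit `b`
has coefficient `a' x (z - 1) + c x⁻¹`, which modulo `p` is `x z a' - b'` in terms of `T`. -/
lemma isTwistCoef12 (hp : p ≠ 2) (hA : IsCoefFun A) (k : ℕ) :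
    IsTwistCoef p 1 (fun α m γ => twistSum12 p (coefQP A k α m γ))
      (fun a b g => (p : ℂ)⁻¹ * ∑ x : (ZMod p)ˣ, (∑ z : (ZMod p)ˣ with z ≠ 1,
          χ p (x * z * (1 - z) * (x * z * a - b))) *
        coefAt A p (rep x.1 / p ^ 2) ((p : ℚ)⁻¹) (p ^ 4 * a) (p ^ 1 * b) g) := by
  have hq : (p : ℚ) ≠ 0 := natCast_prime_ne_zero p ℚ
  have hq1 : (p : ℚ)⁻¹ ≠ 0 := inv_ne_zero hq
  have hc : (p : ℂ) ≠ 0 := natCast_prime_ne_zero p ℂ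
  let L : (ZMod (p ^ 4))ˣ → (ℚ → ℚ → ℚ → ℂ) → ℂ := fun a Φ =>
    ∑ b : (ZMod (p ^ 3))ˣ, ∑ y : ZMod (p ^ 4), ∑ z : (ZMod (p ^ 3))ˣ with red p z.1 ≠ 1,
        chi p a.1 * chi p (b * z * (1 - z) : ZMod (p ^ 3)) *
          Φ (rep a.1 * (rep y - rep b.1 * (1 - rep z.1) * p) / p ^ 4) (rep y / p ^ 3)
            (rep a⁻¹.1 * (rep y + rep b.1 * p) / p ^ 2)
  let G : ZMod p → ZMod p → ℂ := fun b z => if z ≠ 1 then χ p (b * z * (1 - z)) else 0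
  have hL : ∀ x, ∀ a b c : ℤ, L x (fun q₁ q₂ q₃ => e (a * q₁ + b * q₂ + c * q₃)) =
      chi p x.1 * ((∑ y : ZMod (p ^ 4),
        e ((a * x.1.val + p * b + p ^ 2 * (c * x⁻¹.1.val) : ℤ) * rep y / p ^ 4)) *
        ∑ v : (ZMod (p ^ 3))ˣ, (∑ z : (ZMod (p ^ 3))ˣ, G (red p v.1) (red p z.1) *
          e ((a * x.1.val * v.1.val : ℤ) * rep z.1 / p ^ 3)) *
          e (-(a * x.1.val) * rep v.1 / p ^ 3 + c * x⁻¹.1.val * rep v.1 / p)) := by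
    intro x a b c
    rw [← sum_mul_sum', Finset.sum_comm, Finset.mul_sum]
    refine Finset.sum_congr rfl fun v _ => ?_
    rw [Finset.mul_sum]
    refine Finset.sum_congr rfl fun y _ => ?_
    rw [Finset.sum_filter, Finset.sum_mul, Finset.mul_sum, Finset.mul_sum]
    refine Finset.sum_congr rfl fun z _ => ?_
    simp only [G]
    split_ifs with hz
    · rw [chi, chi, red_mul, red_mul, red_sub, red_one]
      rw [show (a : ℚ) * (rep x.1 * (rep y - rep v.1 * (1 - rep z.1) * p) / p ^ 4) +
        b * (rep y / p ^ 3) + c * (rep x⁻¹.1 * (rep y + rep v.1 * p) / p ^ 2) =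
        (a * x.1.val + p * b + p ^ 2 * (c * x⁻¹.1.val) : ℤ) * rep y / p ^ 4 +
        (a * x.1.val * v.1.val : ℤ) * rep z.1 / p ^ 3 +
        (-(a * x.1.val) * rep v.1 / p ^ 3 + c * x⁻¹.1.val * rep v.1 / p) by
          simp only [rep]; push_cast; field_simp; ring, e_add, e_add]
      ring
    · simp
  have hz : ∀ x, ∀ a b c : ℤ, ¬ (p : ℤ) ^ 2 ∣ a →
      L x (fun q₁ q₂ q₃ => e (a * q₁ + b * q₂ + c * q₃)) = 0 := by
    intro x a b c hd
    rw [hL, Finset.sum_eq_zero (s := Finset.univ (α := (ZMod (p ^ 3))ˣ)), mul_zero, mul_zero]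
    intro v _
    rw [sum_units_red_mul_e_eq_zero p 2 (G (red p v.1)), zero_mul]
    intro h
    exact hd ((isCoprime_val_unit p x).pow_left.dvd_of_dvd_mul_right
      ((isCoprime_val_unit p v).pow_left.dvd_of_dvd_mul_right h))
  have hL2 : ∀ x, ∀ a b c : ℤ,
      L x (fun q₁ q₂ q₃ => e (((p ^ 2 * a : ℤ) : ℚ) * q₁ + b * q₂ + c * q₃)) =
      (if (p : ℤ) ^ 4 ∣ p ^ 2 * a * x.1.val + p * b + p ^ 2 * (c * x⁻¹.1.val) then
        gaussW p * ((p : ℂ) ^ 8 * ∑ z : (ZMod p)ˣ with z ≠ 1,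
        χ p (red p x.1 * z * (1 - z) * (a * red p x.1 * (z - 1) + c * (red p x.1)⁻¹))) else 0) := by
    intro x a b c
    rw [hL, sum_zmod_e_pow]
    split_ifs with hdvd
    swap
    · simp
    have h1 : ∀ v : (ZMod (p ^ 3))ˣ, (∑ z : (ZMod (p ^ 3))ˣ, G (red p v.1) (red p z.1) *
          e ((p ^ 2 * a * x.1.val * v.1.val : ℤ) * rep z.1 / p ^ 3)) *
          e (-((p ^ 2 * a : ℤ) * x.1.val) * rep v.1 / p ^ 3 + c * x⁻¹.1.val * rep v.1 / p) =
        (p : ℂ) ^ 2 * ∑ z : (ZMod p)ˣ, G (red p v.1) z *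
          ZMod.stdAddChar ((a * red p x.1 * (z - 1) + c * (red p x.1)⁻¹) * red p v.1 : ZMod p) := by
      intro v
      rw [show (p ^ 2 * a * x.1.val * v.1.val : ℤ) = p ^ 2 * (a * x.1.val * v.1.val) by ring,
        sum_units_red_mul_e p 2 (G (red p v.1)),
        show -(((p ^ 2 * a : ℤ) : ℚ) * x.1.val) * rep v.1 / p ^ 3 + c * x⁻¹.1.val * rep v.1 / p =
          (-(a * x.1.val * rep v.1) + c * x⁻¹.1.val * rep v.1) / p by push_cast; field_simp,
        e_div_of_eq (n := -(a * x.1.val * v.1.val) + c * x⁻¹.1.val * v.1.val)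
          (y := (-(a * red p x.1 * red p v.1) + c * (red p x.1)⁻¹ * red p v.1 : ZMod p))
          (by simp only [rep]; push_cast; rfl)
          (by rw [← red_unit_inv]; push_cast; simp [red]), mul_assoc, Finset.sum_mul]
      congr 1
      refine Finset.sum_congr rfl fun z _ => ?_
      rw [mul_assoc, ← AddChar.map_add_eq_mul]
      congr 2
      simp only [Int.cast_mul, intCast_val_eq_red]
      ring
    rw [Finset.sum_congr rfl fun u _ => h1 u, sum_units_red p 2 (fun y => (p : ℂ) ^ 2 *
      ∑ z : (ZMod p)ˣ, G y z *
          ZMod.stdAddChar ((a * red p x.1 * (z - 1) + c * (red p x.1)⁻¹) * y : ZMod p)),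
      ← Finset.mul_sum, Finset.sum_comm, Finset.sum_filter, Finset.mul_sum, Finset.mul_sum,
      Finset.mul_sum, Finset.mul_sum, Finset.mul_sum, Finset.mul_sum]
    refine Finset.sum_congr rfl fun z _ => ?_
    have h1 : (z : ZMod p) ≠ 1 ↔ z ≠ 1 := not_congr Units.val_eq_one
    by_cases hz1 : z ≠ 1
    · simp only [G, if_pos (h1.2 hz1), if_pos hz1]
      rw [Finset.sum_congr rfl (g := fun u : (ZMod p)ˣ => χ p (z * (1 - z)) *
        (χ p u * ZMod.stdAddChar ((a * red p x.1 * (z - 1) + c * (red p x.1)⁻¹) * u : ZMod p))),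
        ← Finset.mul_sum, sum_units_χ_mul_stdAddChar hp,
        map_mul _ _ (a * red p x.1 * (z - 1) + c * (red p x.1)⁻¹), chi]
      · simp only [map_mul]; ring
      · intro u _
        simp only [map_mul]; ring
    · simp only [G, if_neg (fun h => hz1 (h1.1 h)), if_neg hz1]
      simp
  -- Representatives of `x` and `x⁻¹` are inverse only modulo `p⁴`; `t` carries the error through
  -- the integer identities.
  have hinv : ∀ x : (ZMod (p ^ 4))ˣ, ∃ t : ℤ, (x.1.val : ℤ) * x⁻¹.1.val = 1 + p ^ 4 * t := by
    intro x
    have : (((x.1.val : ℤ) * x⁻¹.1.val : ℤ) : ZMod (p ^ 4)) = (1 : ℤ) := by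
      push_cast; simp only [ZMod.natCast_zmod_val]; exact Units.mul_inv x
    rw [ZMod.intCast_eq_intCast_iff_dvd_sub] at this
    obtain ⟨t, ht⟩ := this
    push_cast at ht
    exact ⟨-t, by linear_combination -ht⟩
  refine ((IsTwistCoef.sum (s := Finset.univ) fun (x : (ZMod (p ^ 4))ˣ) _ =>
    IsTwistCoef.of_functional hA k (r := p) (s := rep x.1 / p ^ 2) (t := (p : ℚ)⁻¹)
    hq hq1 (L x) ?_
    (fun a b _ => (p : ℂ) ^ 8 * ∑ z : (ZMod p)ˣ with z ≠ 1,
        χ p (red p x.1 * z * (1 - z) * (red p x.1 * z * a - b))) ?_ ?_).const_mul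
      ((p : ℂ) ^ (-12 : ℤ))).congr (fun _ _ _ => rfl) ?_
  · intro y Φ
    simp only [L, Finset.mul_sum, mul_left_comm]
  · intro a b c h
    obtain ⟨a, rfl⟩ : (p : ℤ) ^ 2 ∣ a := by by_contra h'; exact h (hz _ _ _ _ h')
    rw [hL2, ite_ne_right_iff] at h
    obtain ⟨d, hd⟩ := h.1
    have hpz : (p : ℤ) ≠ 0 := by exact_mod_cast hq
    obtain rfl : b = p * (p ^ 2 * d - a * x.1.val - c * x⁻¹.1.val) :=
      mul_left_cancel₀ hpz (by linear_combination hd)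
    obtain ⟨t, ht⟩ := hinv x
    have ht : (x.1.val : ℚ) * x⁻¹.1.val = 1 + p ^ 4 * t := by exact_mod_cast ht
    refine ⟨a, (p ^ 2 * d - a * x.1.val - c * x⁻¹.1.val) + 2 * x.1.val * a,
      x.1.val * d - c * p ^ 2 * t, ?_, ?_, ?_⟩
    · push_cast; ring
    · rw [rep]; push_cast; field_simp
    · rw [rep]; push_cast; field_simp
      linear_combination -(c : ℚ) * ht
  · intro a b c a' b' g' h1 h2 h3
    obtain rfl : a = p ^ 2 * a' := by
      have : (a : ℚ) = p ^ 2 * a' := mul_left_cancel₀ (pow_ne_zero 2 hq) (by linear_combination h1)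
      exact_mod_cast this
    obtain rfl : b = p * (b' - 2 * x.1.val * a') := by
      have : (b : ℚ) = p * (b' - 2 * x.1.val * a') := by
        rw [rep] at h2
        push_cast at h2
        field_simp at h2
        linear_combination h2
      exact_mod_cast this
    obtain rfl : c = p ^ 2 * g' - x.1.val * b' + x.1.val ^ 2 * a' := by
      have : (c : ℚ) = p ^ 2 * g' - x.1.val * b' + x.1.val ^ 2 * a' := by
        rw [rep] at h3
        push_cast at h3
        field_simp at h3
        linear_combination h3
      exact_mod_cast this
    obtain ⟨t, ht⟩ := hinv x
    rw [hL2, if_pos]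
    · congr 2
      refine Finset.sum_congr rfl fun z _ => ?_
      congr 2
      push_cast
      simp only [CharP.cast_eq_zero]
      have hx := red_unit_ne_zero p x
      have hx' : ((x.1.val : ℕ) : ZMod p) = red p x.1 := rfl
      rw [hx']
      field_simp
      ring
    · refine ⟨g' * x⁻¹.1.val + p ^ 2 * t * (x.1.val * a' - b'), ?_⟩
      linear_combination ((p : ℤ) ^ 2 * (x.1.val * a' - b')) * ht
  · intro a b g
    have := sum_units_chi_periodic p 3 (fun y => ∑ z : (ZMod p)ˣ with z ≠ 1,
          χ p (y * z * (1 - z) * (y * z * a - b)))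
      (fun x => coefAt A p (x / p ^ 2) ((p : ℚ)⁻¹) (p ^ 4 * a) (p ^ 1 * b) g) ?_
    · rw [show (-12 : ℤ) = -(12 : ℕ) from rfl, zpow_neg_natCast_prime]
      rw [Finset.sum_congr rfl (g := fun x : (ZMod (p ^ 4))ˣ => (p : ℂ) ^ 8 *
        ((∑ z : (ZMod p)ˣ with z ≠ 1, χ p (red p x.1 * z * (1 - z) * (red p x.1 * z * a - b))) *
          coefAt A p (rep x.1 / p ^ 2) ((p : ℚ)⁻¹) (p ^ 4 * a) (p ^ 1 * b) g)),
        ← Finset.mul_sum, this]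
      · have hconst : ∀ S : ℂ, (p : ℂ)⁻¹ * S = ((p : ℂ) ^ 12)⁻¹ * ((p : ℂ) ^ 8 * ((p : ℂ) ^ 3 * S)) := by
          intro S; field_simp
        exact hconst _
      · intro x _; rw [mul_inv_cancel₀ hq]; push_cast; ring
    · intro x j
      exact hA.coefAt_eq_of hq1 hq j (by field_simp; ring) _ _ _

/-- With `U = [1, n; 0, 1]` the matrix becomes `U P`: the coefficient is unchanged, and `Q` is
replaced by `U⁻¹ Q ᵗU⁻¹`. -/
lemma coefQP_add_intCast (hA : IsCoefFun A) (k : ℕ) (α m γ q₁ q₂ q₃ s : ℚ) (n : ℤ) :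
    coefQP A k α m γ q₁ q₂ q₃ 1 (s + n) 1 =
      coefQP A k α m γ (q₁ - 2 * n * q₂ + n ^ 2 * q₃) (q₂ - n * q₃) q₃ 1 s 1 := by
  rw [coefQP, coefQP, hA.coefAt_eq_of one_ne_zero one_ne_zero (s' := s) n (by ring)]
  congr 3
  ring

/-- Lifting `a`, `b` from residues modulo `p` to `a + p i`, `b + p j` shifts `s` by the integer `i +
x j`, which is moved into `Q`. The sum over `i` then forces `p ∣ m`, and `j`, `z` only contribute
powers of `p`. Replacing `b` by `x⁻¹ b` frees `s` from `x`, and the sum over `x` becomes a Gauss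
sum. -/
lemma isTwistCoef1 (hp : p ≠ 2) (hA : IsCoefFun A) (k : ℕ) :
    IsTwistCoef p 1 (fun α m γ => twistSum1 p (coefQP A k α m γ))
      (fun a b g => (p : ℂ)⁻¹ * ∑ x : (ZMod p)ˣ, ∑ y : (ZMod p)ˣ, χ p (x * y * (b * x - g)) *
        coefAt A 1 ((rep x.1 + rep y.1) / p) 1 (p ^ 4 * a) (p ^ 1 * b) g) := by
  have hq : (p : ℚ) ≠ 0 := natCast_prime_ne_zero p ℚ
  have hc : (p : ℂ) ≠ 0 := natCast_prime_ne_zero p ℂ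
  have hp0 : p ≠ 0 := (Fact.out : p.Prime).ne_zero
  have hW := gaussW_ne_zero hp
  let L : (ZMod (p ^ 3))ˣ → (ZMod p)ˣ → (ZMod p)ˣ → (ℚ → ℚ → ℚ → ℂ) → ℂ := fun x a b Φ =>
    ∑ i ∈ Finset.range (p ^ 2), ∑ j ∈ Finset.range (p ^ 2), ∑ z : ZMod (p ^ 4),
      χ p (a * b) * Φ (rep z / p ^ 4 - 2 * (i + rep x.1 * j) * (-(rep b.1 + p * j) / p ^ 2) +
        (i + rep x.1 * j) ^ 2 * (-rep x⁻¹.1 / p))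
        (-(rep b.1 + p * j) / p ^ 2 - (i + rep x.1 * j) * (-rep x⁻¹.1 / p)) (-rep x⁻¹.1 / p)
  have hswap : ∀ α m γ, twistSum1 p (coefQP A k α m γ) = (p : ℂ) ^ (-11 : ℤ) *
      ∑ x : (ZMod (p ^ 3))ˣ, ∑ a : (ZMod p)ˣ, ∑ b : (ZMod p)ˣ,
        L x a b (fun q₁ q₂ q₃ => coefQP A k α m γ q₁ q₂ q₃ 1 ((rep a.1 + rep x.1 * rep b.1) / p) 1) := by
    intro α m γ
    rw [twistSum1, Finset.sum_congr rfl fun _ _ => Finset.sum_comm, Finset.sum_comm]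
    congr 1
    refine Finset.sum_congr rfl fun x _ => ?_
    let F : ℚ → ZMod p → ℚ → ZMod p → ℂ := fun ra ca rb cb => ∑ z : ZMod (p ^ 4), χ p (ca * cb) *
      coefQP A k α m γ (rep z / p ^ 4) (-rb / p ^ 2) (-rep x⁻¹.1 / p) 1 ((ra + rep x.1 * rb) / p) 1
    have h1 : ∀ a b : (ZMod (p ^ 3))ˣ, (∑ z : ZMod (p ^ 4), chi p (a.1 * b.1) *
        coefQP A k α m γ (rep z / p ^ 4) (-rep b.1 / p ^ 2) (-rep x⁻¹.1 / p) 1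
          ((rep a.1 + rep x.1 * rep b.1) / p) 1) = F (rep a.1) (red p a.1) (rep b.1) (red p b.1) := by
      intro a b
      simp only [F, chi, red_mul]
    rw [Finset.sum_congr rfl fun a _ => Finset.sum_congr rfl fun b _ => h1 a b,
      Finset.sum_congr rfl fun (a : (ZMod (p ^ 3))ˣ) _ =>
        sum_units_lift p 2 (F (rep a.1) (red p a.1)),
      sum_units_lift p 2 (fun r c => ∑ b : (ZMod p)ˣ, ∑ j ∈ Finset.range (p ^ 2),
        F r c (rep b.1 + p * j) b.1)]
    refine Finset.sum_congr rfl fun a _ => ?_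
    rw [Finset.sum_comm]
    refine Finset.sum_congr rfl fun b _ => Finset.sum_congr rfl fun i _ =>
      Finset.sum_congr rfl fun j _ => Finset.sum_congr rfl fun z _ => ?_
    have := coefQP_add_intCast hA k α m γ (rep z / p ^ 4) (-(rep b.1 + p * j) / p ^ 2)
      (-rep x⁻¹.1 / p) ((rep a.1 + rep x.1 * rep b.1) / p) (i + x.1.val * j)
    rw [show (rep a.1 + p * i + rep x.1 * (rep b.1 + p * j)) / p =
      (rep a.1 + rep x.1 * rep b.1) / p + ((i + x.1.val * j : ℤ) : ℚ) by
        rw [rep_eq_intCast x.1]; push_cast; field_simp; ring, this, rep_eq_intCast x.1]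
    push_cast
    rfl
  have hinv : ∀ x : (ZMod (p ^ 3))ˣ, ∃ t : ℤ, (x.1.val : ℤ) * x⁻¹.1.val = 1 + p ^ 3 * t := by
    intro x
    have : (((x.1.val : ℤ) * x⁻¹.1.val : ℤ) : ZMod (p ^ 3)) = (1 : ℤ) := by
      push_cast; simp only [ZMod.natCast_zmod_val]; exact Units.mul_inv x
    rw [ZMod.intCast_eq_intCast_iff_dvd_sub] at this
    obtain ⟨t, ht⟩ := this
    push_cast at ht
    exact ⟨-t, by linear_combination -ht⟩
  have hz : ∀ x a b, ∀ u v w : ℤ, ¬ (p : ℤ) ^ 4 ∣ u →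
      L x a b (fun q₁ q₂ q₃ => e (u * q₁ + v * q₂ + w * q₃)) = 0 := by
    intro x a b u v w hu
    refine Finset.sum_eq_zero fun i _ => Finset.sum_eq_zero fun j _ => ?_
    have := sum_zmod_e_pow p 4 u
    rw [if_neg hu] at this
    rw [← mul_zero (χ p (a * b) * e (u * (- 2 * (i + rep x.1 * j) * (-(rep b.1 + p * j) / p ^ 2) +
        (i + rep x.1 * j) ^ 2 * (-rep x⁻¹.1 / p)) + v * (-(rep b.1 + p * j) / p ^ 2 -
        (i + rep x.1 * j) * (-rep x⁻¹.1 / p)) + w * (-rep x⁻¹.1 / p))), ← this, Finset.mul_sum]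
    refine Finset.sum_congr rfl fun z _ => ?_
    dsimp only
    rw [mul_assoc (χ p _) (e _) (e _), ← e_add]
    congr 2
    ring
  have hL : ∀ x a b, ∀ u v w : ℤ,
      L x a b (fun q₁ q₂ q₃ => e (((p ^ 4 * u : ℤ) : ℚ) * q₁ + v * q₂ + w * q₃)) =
      χ p (a * b) * e (-v * rep b.1 / p ^ 2 - w * rep x⁻¹.1 / p) *
        ((p : ℂ) ^ 6 * if (p : ℤ) ∣ v then (p : ℂ) ^ 2 else 0) := by
    intro x a b u v w
    obtain ⟨t, ht⟩ := hinv x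
    have ht : (x.1.val : ℚ) * x⁻¹.1.val = 1 + p ^ 3 * t := by exact_mod_cast ht
    have hsum := sum_range_e (pow_ne_zero 2 hp0) (p * (v * x⁻¹.1.val))
    have hiff : ((p ^ 2 : ℕ) : ℤ) ∣ p * (v * x⁻¹.1.val) ↔ (p : ℤ) ∣ v := by
      push_cast
      rw [sq, mul_dvd_mul_iff_left (by exact_mod_cast hp0)]
      exact ⟨(isCoprime_val_unit p x⁻¹).dvd_of_dvd_mul_right, fun h => h.mul_right _⟩
    simp only [hiff] at hsum
    push_cast at hsum
    rw [← hsum, Finset.mul_sum, Finset.mul_sum]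
    refine Finset.sum_congr rfl fun i _ => ?_
    have h1 : ∀ (j : ℕ) (z : ZMod (p ^ 4)),
        χ p (a * b) * e (((p ^ 4 * u : ℤ) : ℚ) * (rep z / p ^ 4 - 2 * (i + rep x.1 * j) *
          (-(rep b.1 + p * j) / p ^ 2) + (i + rep x.1 * j) ^ 2 * (-rep x⁻¹.1 / p)) +
          v * (-(rep b.1 + p * j) / p ^ 2 - (i + rep x.1 * j) * (-rep x⁻¹.1 / p)) +
            w * (-rep x⁻¹.1 / p)) =
        χ p (a * b) * e (-v * rep b.1 / p ^ 2 - w * rep x⁻¹.1 / p) *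
          e (p * (v * x⁻¹.1.val) * i / p ^ 2) := by
      intro j z
      rw [mul_assoc (χ p _) (e _), ← e_add]
      congr 1
      -- The terms linear in `j` cancel because `x x⁻¹ ≡ 1` modulo `p³`; the witness is the integral
      -- part of the phase.
      refine e_eq_of_sub (u * z.val + 2 * p ^ 2 * u * (i + x.1.val * j) * (b.1.val + p * j) -
        p ^ 3 * u * (i + x.1.val * j) ^ 2 * x⁻¹.1.val + v * j * p ^ 2 * t) ?_
      simp only [rep]
      push_cast
      field_simp
      linear_combination (p * v * j : ℚ) * ht
    simp only
    rw [Finset.sum_congr rfl fun j _ => Finset.sum_congr rfl fun z _ => h1 j z]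
    simp only [Finset.sum_const, Finset.card_univ, Finset.card_range, ZMod.card, nsmul_eq_mul]
    push_cast
    ring
  refine ((IsTwistCoef.sum (s := Finset.univ) fun (x : (ZMod (p ^ 3))ˣ) _ =>
    IsTwistCoef.sum (s := Finset.univ) fun (a : (ZMod p)ˣ) _ =>
    IsTwistCoef.sum (s := Finset.univ) fun (b : (ZMod p)ˣ) _ =>
    IsTwistCoef.of_functional hA k (r := 1) (s := (rep a.1 + rep x.1 * rep b.1) / p) (t := 1)
    one_ne_zero one_ne_zero (L x a b) ?_
    -- For a fixed `P` no Gauss sum arises yet; the inverse offsets the factor `W(χ)` built into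
    -- `IsTwistCoef` until the sum over `x` produces it.
    (fun _ m g => (gaussW p)⁻¹ * ((p : ℂ) ^ 8 * (χ p (a * b) *
      ZMod.stdAddChar ((m * a - g) * (red p x.1)⁻¹ : ZMod p)))) ?_ ?_).const_mul
      ((p : ℂ) ^ (-11 : ℤ))).congr hswap ?_
  · intro y Φ
    simp only [L, Finset.mul_sum, mul_left_comm]
  · intro u v w h
    obtain ⟨u, rfl⟩ : (p : ℤ) ^ 4 ∣ u := by by_contra h'; exact h (hz _ _ _ _ _ _ h')
    rw [hL] at h
    obtain ⟨v, rfl⟩ := (ite_ne_right_iff.1 (right_ne_zero_of_mul (right_ne_zero_of_mul h))).1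
    refine ⟨u, v + 2 * p ^ 2 * (a.1.val + x.1.val * b.1.val) * u,
      w + (a.1.val + x.1.val * b.1.val) * v + p ^ 2 * (a.1.val + x.1.val * b.1.val) ^ 2 * u,
        ?_, ?_, ?_⟩ <;> (try simp only [rep]) <;> push_cast <;> field_simp
  · intro u v w a' b' g' h1 h2 h3
    obtain rfl : u = p ^ 4 * a' := by
      have : (u : ℚ) = p ^ 4 * a' := by linear_combination h1
      exact_mod_cast this
    obtain rfl : v = p * (b' - 2 * p ^ 2 * (a.1.val + x.1.val * b.1.val) * a') := by
      have : (v : ℚ) = p * (b' - 2 * p ^ 2 * (a.1.val + x.1.val * b.1.val) * a') := by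
        simp only [rep] at h2
        push_cast at h2
        field_simp at h2
        linear_combination h2
      exact_mod_cast this
    obtain rfl : w = g' - (a.1.val + x.1.val * b.1.val) * b' +
        p ^ 2 * (a.1.val + x.1.val * b.1.val) ^ 2 * a' := by
      have : (w : ℚ) = g' - (a.1.val + x.1.val * b.1.val) * b' +
        p ^ 2 * (a.1.val + x.1.val * b.1.val) ^ 2 * a' := by
        simp only [rep] at h3
        push_cast at h3
        field_simp at h3
        linear_combination h3
      exact_mod_cast this
    rw [hL, if_pos (dvd_mul_right _ _)]
    have hx := red_unit_ne_zero p x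
    have he : e (-((p * (b' - 2 * p ^ 2 * (a.1.val + x.1.val * b.1.val) * a') : ℤ) : ℚ) *
        rep b.1 / p ^ 2 - ((g' - (a.1.val + x.1.val * b.1.val) * b' +
        p ^ 2 * (a.1.val + x.1.val * b.1.val) ^ 2 * a' : ℤ) : ℚ) * rep x⁻¹.1 / p) =
        ZMod.stdAddChar ((b' * a - g') * (red p x.1)⁻¹ : ZMod p) := by
      rw [show (-((p * (b' - 2 * p ^ 2 * (a.1.val + x.1.val * b.1.val) * a') : ℤ) : ℚ) *
        rep b.1 / p ^ 2 - ((g' - (a.1.val + x.1.val * b.1.val) * b' +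
        p ^ 2 * (a.1.val + x.1.val * b.1.val) ^ 2 * a' : ℤ) : ℚ) * rep x⁻¹.1 / p) =
        ((-(b' - 2 * p ^ 2 * (a.1.val + x.1.val * b.1.val) * a') * b.1.val -
        (g' - (a.1.val + x.1.val * b.1.val) * b' +
        p ^ 2 * (a.1.val + x.1.val * b.1.val) ^ 2 * a') * x⁻¹.1.val : ℤ) : ℚ) / p by
          simp only [rep]; push_cast; field_simp]
      refine e_div_of_eq rfl ?_
      have hx' : ((x.1.val : ℕ) : ZMod p) = red p x.1 := rfl
      have hx'' : ((x⁻¹.1.val : ℕ) : ZMod p) = (red p x.1)⁻¹ := red_unit_inv x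
      push_cast
      simp only [hx', hx'', CharP.cast_eq_zero, ZMod.natCast_zmod_val]
      field_simp
      ring
    rw [he, mul_inv_cancel_left₀ hW]
    ring
  · intro a b g
    have h1 : ∀ u v : (ZMod p)ˣ, ∑ x : (ZMod (p ^ 3))ˣ,
        ZMod.stdAddChar ((b * u - g) * (red p x.1)⁻¹ : ZMod p) *
          coefAt A 1 ((rep u.1 + rep x.1 * rep v.1) / p) 1 (p ^ 4 * a) (p ^ 1 * b) g =
        (p : ℂ) ^ 2 * ∑ x : (ZMod p)ˣ, ZMod.stdAddChar ((b * u - g) * (x : ZMod p)⁻¹ : ZMod p) *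
          coefAt A 1 ((rep u.1 + rep x.1 * rep v.1) / p) 1 (p ^ 4 * a) (p ^ 1 * b) g := by
      intro u v
      refine sum_units_chi_periodic p 2 (fun x => ZMod.stdAddChar ((b * u - g) * x⁻¹ : ZMod p))
        (fun r => coefAt A 1 ((rep u.1 + r * rep v.1) / p) 1 (p ^ 4 * a) (p ^ 1 * b) g) ?_
      intro r j
      exact hA.coefAt_eq_of one_ne_zero one_ne_zero (j * v.1.val)
        (by rw [rep_eq_intCast v.1]; push_cast; field_simp; ring) _ _ _
    -- The two values of `s` differ by an integer, since `x · (x⁻¹ v) ≡ v` modulo `p`.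
    have h2 : ∀ x u v : (ZMod p)ˣ, coefAt A 1 ((rep u.1 + rep x.1 * rep (x⁻¹ * v).1) / p) 1
        (p ^ 4 * a) (p ^ 1 * b) g =
        coefAt A 1 ((rep u.1 + rep v.1) / p) 1 (p ^ 4 * a) (p ^ 1 * b) g := by
      intro x u v
      obtain ⟨j, hj⟩ := exists_rep_eq (N := p) (x := v.1) (n := x.1.val * (x⁻¹ * v).1.val) (by
        push_cast
        rw [ZMod.natCast_zmod_val, ZMod.natCast_zmod_val]
        exact mul_inv_cancel_left₀ x.ne_zero _)
      refine hA.coefAt_eq_of one_ne_zero one_ne_zero (-j) ?_ _ _ _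
      rw [hj]
      simp only [rep]
      push_cast
      field_simp
      ring
    have h3 : ∀ u : (ZMod p)ˣ, ∑ v : (ZMod p)ˣ, ∑ x : (ZMod p)ˣ, χ p (u * v) *
        (ZMod.stdAddChar ((b * u - g) * (x : ZMod p)⁻¹ : ZMod p) *
          coefAt A 1 ((rep u.1 + rep x.1 * rep v.1) / p) 1 (p ^ 4 * a) (p ^ 1 * b) g) =
        gaussW p * ∑ v : (ZMod p)ˣ, χ p (u * v * (b * u - g)) *
          coefAt A 1 ((rep u.1 + rep v.1) / p) 1 (p ^ 4 * a) (p ^ 1 * b) g := by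
      intro u
      rw [Finset.sum_comm, Finset.sum_congr rfl fun (x : (ZMod p)ˣ) _ =>
        (Equiv.sum_comp (Equiv.mulLeft x⁻¹) _).symm, Finset.sum_comm, Finset.mul_sum]
      refine Finset.sum_congr rfl fun v _ => ?_
      simp only [Equiv.coe_mulLeft, h2]
      rw [map_mul _ _ ((b : ZMod p) * u - g)]
      have h4 := sum_units_χ_mul_stdAddChar hp ((b : ZMod p) * u - g)
      rw [← Equiv.sum_comp (Equiv.inv _)] at h4
      rw [show gaussW p * (χ p (u * v) * χ p ((b : ZMod p) * u - g) *
        coefAt A 1 ((rep u.1 + rep v.1) / p) 1 (p ^ 4 * a) (p ^ 1 * b) g) =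
        χ p (u * v) * coefAt A 1 ((rep u.1 + rep v.1) / p) 1 (p ^ 4 * a) (p ^ 1 * b) g *
          (χ p ((b : ZMod p) * u - g) * gaussW p) by ring, ← h4, Finset.mul_sum]
      refine Finset.sum_congr rfl fun x _ => ?_
      rw [Equiv.inv_apply, Units.val_mul, Units.val_inv_eq_inv_val]
      simp only [map_mul]
      ring
    have h5 : ∑ x : (ZMod (p ^ 3))ˣ, ∑ u : (ZMod p)ˣ, ∑ v : (ZMod p)ˣ,
        (((1 : ℚ) * 1 : ℚ) : ℂ) ^ k * ((gaussW p)⁻¹ * ((p : ℂ) ^ 8 * (χ p (u * v) *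
      ZMod.stdAddChar ((b * u - g) * (red p x.1)⁻¹ : ZMod p)))) *
        coefAt A 1 ((rep u.1 + rep x.1 * rep v.1) / p) 1 (p ^ 4 * a) (p ^ 1 * b) g =
        (p : ℂ) ^ 10 * ∑ u : (ZMod p)ˣ, ∑ v : (ZMod p)ˣ, χ p (u * v * (b * u - g)) *
          coefAt A 1 ((rep u.1 + rep v.1) / p) 1 (p ^ 4 * a) (p ^ 1 * b) g := by
      rw [Finset.sum_comm, Finset.mul_sum]
      refine Finset.sum_congr rfl fun u _ => ?_
      rw [Finset.sum_comm]
      have h6 : ∀ v : (ZMod p)ˣ, ∑ x : (ZMod (p ^ 3))ˣ, (((1 : ℚ) * 1 : ℚ) : ℂ) ^ k *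
          ((gaussW p)⁻¹ * ((p : ℂ) ^ 8 * (χ p (u * v) *
      ZMod.stdAddChar ((b * u - g) * (red p x.1)⁻¹ : ZMod p)))) *
        coefAt A 1 ((rep u.1 + rep x.1 * rep v.1) / p) 1 (p ^ 4 * a) (p ^ 1 * b) g =
        (gaussW p)⁻¹ * (p : ℂ) ^ 10 * ∑ x : (ZMod p)ˣ, χ p (u * v) *
        (ZMod.stdAddChar ((b * u - g) * (x : ZMod p)⁻¹ : ZMod p) *
          coefAt A 1 ((rep u.1 + rep x.1 * rep v.1) / p) 1 (p ^ 4 * a) (p ^ 1 * b) g) := by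
        intro v
        rw [← Finset.mul_sum]
        rw [show ∀ S : ℂ, (gaussW p)⁻¹ * (p : ℂ) ^ 10 * (χ p (u * v) * S) =
          (gaussW p)⁻¹ * (p : ℂ) ^ 8 * χ p (u * v) * ((p : ℂ) ^ 2 * S) by intro S; ring, ← h1,
          Finset.mul_sum]
        refine Finset.sum_congr rfl fun x _ => ?_
        push_cast
        rw [one_mul, one_pow]
        ring
      rw [Finset.sum_congr rfl fun v _ => h6 v, ← Finset.mul_sum, h3]
      have hcancel : ∀ S : ℂ, (gaussW p)⁻¹ * (p : ℂ) ^ 10 * (gaussW p * S) = (p : ℂ) ^ 10 * S := by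
        intro S; field_simp
      exact hcancel _
    rw [h5, show (-11 : ℤ) = -(11 : ℕ) from rfl, zpow_neg_natCast_prime]
    have hconst : ∀ S : ℂ, (p : ℂ)⁻¹ * S = ((p : ℂ) ^ 11)⁻¹ * ((p : ℂ) ^ 10 * S) := by
      intro S; field_simp
    exact hconst _

end

/-! ### Operator 2 -/

section

variable {p : ℕ} [Fact p.Prime] {A : ℚ → ℚ → ℚ → ℂ}

lemma isUnit_of_red_ne_zero {n : ℕ} {x : ZMod (p ^ (n + 1))} (h : red p x ≠ 0) : IsUnit x := by
  rw [← ZMod.natCast_zmod_val x, ZMod.isUnit_iff_coprime, coprime_pow_succ_iff',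
    Nat.coprime_comm, Nat.Prime.coprime_iff_not_dvd Fact.out]
  rwa [red, Ne, ZMod.natCast_eq_zero_iff] at h

lemma isUnit_one_sub_of_red_ne_one {n : ℕ} {x : ZMod (p ^ (n + 1))} (h : red p x ≠ 1) :
    IsUnit (1 - x) := by
  refine isUnit_of_red_ne_zero ?_
  rw [red_sub, red_one, sub_ne_zero]
  exact h.symm

lemma red_inv_of_isUnit {n : ℕ} {x : ZMod (p ^ (n + 1))} (h : IsUnit x) :
    red p x⁻¹ = (red p x)⁻¹ := by
  obtain ⟨u, rfl⟩ := h
  rw [ZMod.inv_coe_unit, red_unit_inv]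

/-- The substitution `s = (1 - y)⁻¹` in a sum over the units `y` with `1 - y` a unit. -/
lemma sum_units_inv_one_sub {n : ℕ} (f : ZMod (p ^ (n + 1)) → ZMod (p ^ (n + 1)) → ℂ) :
    ∑ y : (ZMod (p ^ (n + 1)))ˣ with red p y.1 ≠ 1, f y.1 (1 - y.1)⁻¹ =
      ∑ s : (ZMod (p ^ (n + 1)))ˣ with red p s.1 ≠ 1, f (1 - s⁻¹.1) s.1 := by
  have hu : ∀ y : (ZMod (p ^ (n + 1)))ˣ, red p y.1 ≠ 1 → IsUnit (1 - y.1) := fun y hy =>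
    isUnit_one_sub_of_red_ne_one hy
  refine Finset.sum_bij (fun y hy => (hu y (Finset.mem_filter.1 hy).2).unit⁻¹) ?_ ?_ ?_ ?_
  · intro y hy
    refine Finset.mem_filter.2 ⟨Finset.mem_univ _, ?_⟩
    have hy := (Finset.mem_filter.1 hy).2
    rw [red_unit_inv, IsUnit.unit_spec, red_sub, red_one, Ne, inv_eq_one, sub_eq_self]
    exact red_unit_ne_zero p y
  · intro y hy z hz h
    have := congrArg Units.val (inv_injective h)
    rw [IsUnit.unit_spec, IsUnit.unit_spec] at this
    exact Units.ext (sub_right_injective this)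
  · intro s hs
    have hs := (Finset.mem_filter.1 hs).2
    have h1 : red p s⁻¹.1 ≠ 1 := by rwa [red_unit_inv, Ne, inv_eq_one]
    have h2 : red p (hu s⁻¹ h1).unit.1 ≠ 1 := by
      rw [IsUnit.unit_spec, red_sub, red_one, Ne, sub_eq_self]
      exact red_unit_ne_zero p s⁻¹
    refine ⟨(hu s⁻¹ h1).unit, Finset.mem_filter.2 ⟨Finset.mem_univ _, h2⟩, ?_⟩
    rw [inv_eq_iff_eq_inv]
    refine Units.ext ?_
    rw [IsUnit.unit_spec, IsUnit.unit_spec, sub_sub_cancel]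
  · intro y hy
    rw [inv_inv, IsUnit.unit_spec, sub_sub_cancel]
    congr 1
    rw [← ZMod.inv_coe_unit, IsUnit.unit_spec]

/-- In the variable `(1 - y)⁻¹` the entry `q₁` is linear, and summing over it forces `p²` to divide
the first entry of `S`. The sum over `a` then forces `p` to divide the second entry and becomes a
Gauss sum. -/
lemma isTwistCoef2 (hp : p ≠ 2) (hA : IsCoefFun A) (k : ℕ) :
    IsTwistCoef p 2 (fun α m γ => twistSum2 p (coefQP A k α m γ))
      (fun a b g => (p : ℂ) ^ ((k : ℤ) - 3) * ∑ u : (ZMod p)ˣ,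
        (∑ x : (ZMod p)ˣ with x ≠ 1, ∑ y : (ZMod p)ˣ with y ≠ 1,
          χ p (y * (1 - x) * (a * ((y - x) / (1 - y)) * (u : ZMod p) ^ 2 + b * u -
            g * (x : ZMod p)⁻¹))) *
        coefAt A p (rep u.1 / p) 1 (p ^ 4 * a) (p ^ 2 * b) g) := by
  have hq : (p : ℚ) ≠ 0 := natCast_prime_ne_zero p ℚ
  have hc : (p : ℂ) ≠ 0 := natCast_prime_ne_zero p ℂ
  let L : (ZMod (p ^ 3))ˣ → (ℚ → ℚ → ℚ → ℂ) → ℂ := fun b Φ =>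
    ∑ a : (ZMod (p ^ 3))ˣ,
      ∑ x : (ZMod (p ^ 3))ˣ with red p x.1 ≠ 1, ∑ y : (ZMod (p ^ 3))ˣ with red p y.1 ≠ 1,
        chi p (a * b * x * y : ZMod (p ^ 3)) *
          Φ (-rep (a * b * (1 - (1 - (y : ZMod (p ^ 3)))⁻¹ * x) : ZMod (p ^ 3)) / p ^ 3)
            (-rep a.1 / p ^ 2)
            (-rep (a * (b : ZMod (p ^ 3))⁻¹ * (1 - (x : ZMod (p ^ 3)))⁻¹ : ZMod (p ^ 3)) / p)
  have hz : ∀ b, ∀ u v w : ℤ, ¬ (p : ℤ) ^ 2 ∣ u →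
      L b (fun q₁ q₂ q₃ => e (u * q₁ + v * q₂ + w * q₃)) = 0 := by
    intro b u v w hd
    refine Finset.sum_eq_zero fun a _ => Finset.sum_eq_zero fun x _ => ?_
    have h1 := sum_units_inv_one_sub (p := p) (n := 2) (fun y s =>
      chi p (a * b * x * y : ZMod (p ^ 3)) * e (u * (-rep (a * b * (1 - s * x) : ZMod (p ^ 3)) / p ^ 3) +
        v * (-rep a.1 / p ^ 2) + w * (-rep (a * (b : ZMod (p ^ 3))⁻¹ *
          (1 - (x : ZMod (p ^ 3)))⁻¹ : ZMod (p ^ 3)) / p)))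
    refine h1.trans ?_
    have h2 := sum_units_red_mul_e_eq_zero p 2
      (fun s => if s ≠ 1 then χ p (red p a.1 * red p b.1 * red p x.1 * (1 - s⁻¹)) else 0)
      (c := u * (a.1.val * b.1.val * x.1.val)) (by
        intro h
        refine hd ?_
        have h := (isCoprime_val_unit p x).pow_left.dvd_of_dvd_mul_right
          (by rwa [← mul_assoc] at h : (p : ℤ) ^ 2 ∣ (u * (a.1.val * b.1.val)) * x.1.val)
        have h := (isCoprime_val_unit p b).pow_left.dvd_of_dvd_mul_right
          (by rwa [← mul_assoc] at h : (p : ℤ) ^ 2 ∣ (u * a.1.val) * b.1.val)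
        exact (isCoprime_val_unit p a).pow_left.dvd_of_dvd_mul_right h)
    rw [← mul_zero (e (u * (-(rep a.1 * rep b.1) / p ^ 3) +
        v * (-rep a.1 / p ^ 2) + w * (-rep (a * (b : ZMod (p ^ 3))⁻¹ *
          (1 - (x : ZMod (p ^ 3)))⁻¹ : ZMod (p ^ 3)) / p))), ← h2, Finset.mul_sum,
          Finset.sum_filter]
    refine Finset.sum_congr rfl fun s _ => ?_
    split_ifs with hs
    · rw [chi, red_mul, red_mul, red_mul, red_sub, red_one, red_unit_inv, mul_left_comm, ← e_add]
      congr 1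
      obtain ⟨j, hj⟩ := exists_rep_eq (N := p ^ 3) (x := (a * b * (1 - s * x) : ZMod (p ^ 3)))
        (n := a.1.val * b.1.val * (1 - s.1.val * x.1.val)) (by push_cast; simp)
      rw [hj]
      refine e_eq_of_sub (-(u * j)) ?_
      simp only [rep]
      push_cast
      field_simp
      ring
    · simp
  let H : ZMod p → ℤ → ℤ → ZMod p → ZMod p → ZMod p → ℂ := fun b u w a x y =>
    if x ≠ 1 then if y ≠ 1 then χ p (a * b * x * y) * ZMod.stdAddChar
      (a * (-u * b * (1 - (1 - y)⁻¹ * x) - w * b⁻¹ * (1 - x)⁻¹) : ZMod p) else 0 else 0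
  have hL : ∀ b, ∀ u v w : ℤ,
      L b (fun q₁ q₂ q₃ => e (((p ^ 2 * u : ℤ) : ℚ) * q₁ + v * q₂ + w * q₃)) =
      ∑ a : (ZMod (p ^ 3))ˣ, (∑ x : (ZMod (p ^ 3))ˣ, ∑ y : (ZMod (p ^ 3))ˣ,
        H (red p b.1) u w (red p a.1) (red p x.1) (red p y.1)) *
          e ((p * (-v) : ℤ) * rep a.1 / p ^ 3) := by
    intro b u v w
    refine Finset.sum_congr rfl fun a _ => ?_
    rw [Finset.sum_mul, Finset.sum_filter]
    refine Finset.sum_congr rfl fun x _ => ?_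
    simp only [H]
    split_ifs with hx
    · rw [Finset.sum_mul, Finset.sum_filter]
      refine Finset.sum_congr rfl fun y _ => ?_
      split_ifs with hy
      · rw [chi, red_mul, red_mul, red_mul, mul_assoc (χ p _) (ZMod.stdAddChar _)]
        congr 1
        rw [e_add, e_add, mul_sub (red p a.1), sub_eq_add_neg (red p a.1 * _), AddChar.map_add_eq_mul, mul_right_comm]
        congr 2
        · rw [show ((p ^ 2 * u : ℤ) : ℚ) * (-rep (a * b * (1 - (1 - (y : ZMod (p ^ 3)))⁻¹ * x) :
            ZMod (p ^ 3)) / p ^ 3) = (-u * rep (a * b * (1 - (1 - (y : ZMod (p ^ 3)))⁻¹ * x) :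
            ZMod (p ^ 3))) / p by push_cast; field_simp]
          refine e_div_of_eq (n := -u * (a * b * (1 - (1 - (y : ZMod (p ^ 3)))⁻¹ * x) :
            ZMod (p ^ 3)).val) (by simp only [rep]; push_cast; rfl) ?_
          rw [Int.cast_mul, intCast_val_eq_red, red_mul, red_mul, red_sub, red_one, red_mul,
            red_inv_of_isUnit (isUnit_one_sub_of_red_ne_one hy), red_sub, red_one]
          push_cast; ring
        · rw [show (w : ℚ) * (-rep (a * (b : ZMod (p ^ 3))⁻¹ * (1 - (x : ZMod (p ^ 3)))⁻¹ :
            ZMod (p ^ 3)) / p) = (-w * rep (a * (b : ZMod (p ^ 3))⁻¹ *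
              (1 - (x : ZMod (p ^ 3)))⁻¹ : ZMod (p ^ 3))) / p by ring]
          refine e_div_of_eq (n := -w * (a * (b : ZMod (p ^ 3))⁻¹ *
              (1 - (x : ZMod (p ^ 3)))⁻¹ : ZMod (p ^ 3)).val) (by simp only [rep]; push_cast; rfl) ?_
          rw [Int.cast_mul, intCast_val_eq_red, red_mul, red_mul, red_inv_of_isUnit b.isUnit,
            red_inv_of_isUnit (isUnit_one_sub_of_red_ne_one hx), red_sub, red_one]
          push_cast; ring
        · push_cast; field_simp
      · simp
    · simp
  have hz2 : ∀ b, ∀ u v w : ℤ, ¬ (p : ℤ) ∣ v →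
      L b (fun q₁ q₂ q₃ => e (((p ^ 2 * u : ℤ) : ℚ) * q₁ + v * q₂ + w * q₃)) = 0 := by
    intro b u v w hv
    rw [hL]
    refine sum_units_red_mul_e_eq_zero p 2 (fun a => ∑ x : (ZMod (p ^ 3))ˣ, ∑ y : (ZMod (p ^ 3))ˣ,
        H (red p b.1) u w a (red p x.1) (red p y.1)) ?_
    have hpz : (p : ℤ) ≠ 0 := natCast_prime_ne_zero p ℤ
    rwa [sq, mul_dvd_mul_iff_left hpz, dvd_neg]
  have hL2 : ∀ b, ∀ u v w : ℤ,
      L b (fun q₁ q₂ q₃ => e (((p ^ 2 * u : ℤ) : ℚ) * q₁ + ((p * v : ℤ) : ℚ) * q₂ + w * q₃)) =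
      gaussW p * ((p : ℂ) ^ 6 * ∑ x : (ZMod p)ˣ with x ≠ 1, ∑ y : (ZMod p)ˣ with y ≠ 1,
        χ p (red p b.1 * x * y) * χ p (-u * red p b.1 * (1 - (1 - y : ZMod p)⁻¹ * x) -
          w * (red p b.1)⁻¹ * (1 - x : ZMod p)⁻¹ - v)) := by
    intro b u v w
    have h1 : ∀ a : ZMod p, ∑ x : (ZMod (p ^ 3))ˣ, ∑ y : (ZMod (p ^ 3))ˣ,
        H (red p b.1) u w a (red p x.1) (red p y.1) = (p : ℂ) ^ 4 * ∑ x : (ZMod p)ˣ,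
          ∑ y : (ZMod p)ˣ, H (red p b.1) u w a x y := by
      intro a
      rw [Finset.sum_congr rfl fun (x : (ZMod (p ^ 3))ˣ) _ =>
        sum_units_red p 2 (fun y => H (red p b.1) u w a (red p x.1) y),
        sum_units_red p 2 (fun x => (p : ℂ) ^ 2 * ∑ y : (ZMod p)ˣ, H (red p b.1) u w a x y),
        ← Finset.mul_sum]
      ring
    rw [hL, Finset.sum_congr rfl fun a _ => by rw [h1],
      show ((p * -(p * v) : ℤ)) = p ^ 2 * (-v) by ring,
      sum_units_red_mul_e p 2 (fun a => (p : ℂ) ^ 4 * ∑ x : (ZMod p)ˣ,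
          ∑ y : (ZMod p)ˣ, H (red p b.1) u w a x y)]
    have h2 : ∀ a : (ZMod p)ˣ, (p : ℂ) ^ 4 * (∑ x : (ZMod p)ˣ,
          ∑ y : (ZMod p)ˣ, H (red p b.1) u w a x y) * ZMod.stdAddChar (((-v : ℤ) : ZMod p) * a.1) =
        (p : ℂ) ^ 4 * ∑ x : (ZMod p)ˣ, ∑ y : (ZMod p)ˣ, H (red p b.1) u w a x y *
          ZMod.stdAddChar (((-v : ℤ) : ZMod p) * a.1) := by
      intro a
      simp only [Finset.sum_mul, mul_assoc]
    rw [Finset.sum_congr rfl fun a _ => h2 a, ← Finset.mul_sum, Finset.sum_comm]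
    have h3 : ∀ x y : (ZMod p)ˣ, ∑ a : (ZMod p)ˣ, H (red p b.1) u w a x y *
          ZMod.stdAddChar (((-v : ℤ) : ZMod p) * a.1) =
        if x ≠ 1 then if y ≠ 1 then gaussW p * (χ p (red p b.1 * x * y) *
          χ p (-u * red p b.1 * (1 - (1 - y : ZMod p)⁻¹ * x) -
          w * (red p b.1)⁻¹ * (1 - x : ZMod p)⁻¹ - v)) else 0 else 0 := by
      intro x y
      have hx : (x : ZMod p) ≠ 1 ↔ x ≠ 1 := not_congr Units.val_eq_one
      have hy : (y : ZMod p) ≠ 1 ↔ y ≠ 1 := not_congr Units.val_eq_one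
      simp only [H, hx, hy]
      split_ifs
      · have h4 := sum_units_χ_mul_stdAddChar hp (-u * red p b.1 * (1 - (1 - y : ZMod p)⁻¹ * x) -
          w * (red p b.1)⁻¹ * (1 - x : ZMod p)⁻¹ - v : ZMod p)
        rw [mul_left_comm, mul_comm (gaussW p), ← h4, Finset.mul_sum]
        refine Finset.sum_congr rfl fun a _ => ?_
        rw [mul_assoc (χ p _), ← AddChar.map_add_eq_mul, show (a : ZMod p) * (-(u : ZMod p) * red p b.1 *
          (1 - (1 - y : ZMod p)⁻¹ * x) - (w : ZMod p) * (red p b.1)⁻¹ * (1 - x : ZMod p)⁻¹) +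
          ((-v : ℤ) : ZMod p) * a = (-(u : ZMod p) * red p b.1 * (1 - (1 - y : ZMod p)⁻¹ * x) -
          (w : ZMod p) * (red p b.1)⁻¹ * (1 - x : ZMod p)⁻¹ - v) * a by push_cast; ring]
        simp only [map_mul]
        ring
      · simp
      · simp
    have h5 : ∀ x : (ZMod p)ˣ, ∑ a : (ZMod p)ˣ, ∑ y : (ZMod p)ˣ, H (red p b.1) u w a x y *
          ZMod.stdAddChar (((-v : ℤ) : ZMod p) * a.1) = gaussW p * if x ≠ 1 then
        ∑ y : (ZMod p)ˣ with y ≠ 1, (χ p (red p b.1 * x * y) *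
          χ p (-u * red p b.1 * (1 - (1 - y : ZMod p)⁻¹ * x) -
          w * (red p b.1)⁻¹ * (1 - x : ZMod p)⁻¹ - v)) else 0 := by
      intro x
      rw [Finset.sum_comm, Finset.sum_congr rfl fun y _ => h3 x y]
      split_ifs
      · rw [← Finset.sum_filter, Finset.mul_sum]
      · simp
    rw [Finset.sum_congr rfl fun x _ => h5 x, ← Finset.mul_sum, ← Finset.sum_filter]
    ring
  have hswap : ∀ α m γ, twistSum2 p (coefQP A k α m γ) = (p : ℂ) ^ (-11 : ℤ) *
      ∑ b : (ZMod (p ^ 3))ˣ,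
        L b (fun q₁ q₂ q₃ => coefQP A k α m γ q₁ q₂ q₃ p (rep b.1 / p) 1) := by
    intro α m γ
    rw [twistSum2, Finset.sum_comm]
  let G : ℤ → ℤ → ℤ → ZMod p → ℂ := fun a b g u =>
    ∑ x : (ZMod p)ˣ with x ≠ 1, ∑ y : (ZMod p)ˣ with y ≠ 1,
          χ p (y * (1 - x) * (a * ((y - x) / (1 - y)) * u ^ 2 + b * u - g * (x : ZMod p)⁻¹))
  refine ((IsTwistCoef.sum (s := Finset.univ) fun (x : (ZMod (p ^ 3))ˣ) _ =>
    IsTwistCoef.of_functional hA k (r := p) (s := rep x.1 / p) (t := 1)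
    hq one_ne_zero (L x) ?_
    (fun a b g => (p : ℂ) ^ 6 * G a b g (red p x.1)) ?_ ?_).const_mul
      ((p : ℂ) ^ (-11 : ℤ))).congr hswap ?_
  · intro y Φ
    simp only [L, Finset.mul_sum, mul_left_comm]
  · intro a b c h
    obtain ⟨a, rfl⟩ : (p : ℤ) ^ 2 ∣ a := by by_contra h'; exact h (hz _ _ _ _ h')
    obtain ⟨b, rfl⟩ : (p : ℤ) ∣ b := by by_contra h'; exact h (hz2 _ _ _ _ h')
    refine ⟨a, b + 2 * x.1.val * a, c + x.1.val * b + x.1.val ^ 2 * a, ?_, ?_, ?_⟩ <;>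
      (try simp only [rep]) <;> push_cast <;> field_simp
  · intro u v w a b g h1 h2 h3
    obtain rfl : u = p ^ 2 * a := by
      have : (u : ℚ) = p ^ 2 * a := mul_left_cancel₀ (pow_ne_zero 2 hq) (by linear_combination h1)
      exact_mod_cast this
    obtain rfl : v = p * (b - 2 * x.1.val * a) := by
      have : (v : ℚ) = p * (b - 2 * x.1.val * a) := by
        rw [rep] at h2
        push_cast at h2
        field_simp at h2
        linear_combination h2
      exact_mod_cast this
    obtain rfl : w = g - x.1.val * b + x.1.val ^ 2 * a := by
      have : (w : ℚ) = g - x.1.val * b + x.1.val ^ 2 * a := by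
        rw [rep] at h3
        push_cast at h3
        field_simp at h3
        linear_combination h3
      exact_mod_cast this
    rw [hL2]
    congr 2
    have hr := red_unit_ne_zero p x
    refine Finset.sum_congr rfl fun s hs => Finset.sum_congr rfl fun y hy => ?_
    have hs1 : (1 - s : ZMod p) ≠ 0 := sub_ne_zero.2 fun h =>
      (Finset.mem_filter.1 hs).2 (Units.val_eq_one.1 h.symm)
    have hy1 : (1 - y : ZMod p) ≠ 0 := sub_ne_zero.2 fun h =>
      (Finset.mem_filter.1 hy).2 (Units.val_eq_one.1 h.symm)
    have hs0 : (s : ZMod p) ≠ 0 := s.ne_zero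
    rw [← map_mul]
    -- The argument produced by the Gauss sum and the claimed one differ by the square of `s / (1 -
    -- s)`.
    refine Eq.trans ?_ (χ_mul_sq _ (div_ne_zero hs0 hs1))
    congr 1
    simp only [Int.cast_sub, Int.cast_add, Int.cast_mul, Int.cast_pow, intCast_val_eq_red,
      Int.cast_ofNat]
    field_simp
    ring
  · intro a b g
    have := sum_units_chi_periodic p 2 (G a b g)
      (fun r => coefAt A p (r / p) 1 (p ^ 4 * a) (p ^ 2 * b) g) (by
        intro r j
        exact hA.coefAt_eq_of one_ne_zero hq j (by push_cast; field_simp; ring) _ _ _)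
    rw [show ((k : ℤ) - 3) = (k : ℤ) - (3 : ℕ) from rfl, zpow_sub_natCast_prime,
      show (-11 : ℤ) = -(11 : ℕ) from rfl, zpow_neg_natCast_prime]
    rw [Finset.sum_congr rfl (g := fun x : (ZMod (p ^ 3))ˣ => (p : ℂ) ^ k * (p : ℂ) ^ 6 *
      (G a b g (red p x.1) * coefAt A p (rep x.1 / p) 1 (p ^ 4 * a) (p ^ 2 * b) g)),
      ← Finset.mul_sum, this]
    · have hconst : ∀ S : ℂ, (p : ℂ) ^ k / (p : ℂ) ^ 3 * S =
          ((p : ℂ) ^ 11)⁻¹ * ((p : ℂ) ^ k * (p : ℂ) ^ 6 * ((p : ℂ) ^ 2 * S)) := by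
        intro S; field_simp
      exact hconst _
    · intros; push_cast; ring

end

/-! ### Fourier expansions on the Siegel upper half space -/

section

/-- The matrix `[α, m/2; m/2, γ]` with rational entries. -/
def symMat (α m γ : ℚ) : Matrix (Fin 2) (Fin 2) ℚ := !![α, m / 2; m / 2, γ]

/-- `e^{2 π i tr(S Z)}` for `S = [α, m/2; m/2, γ]` and symmetric `Z`. -/
def qexp (α m γ : ℚ) (Z : Matrix (Fin 2) (Fin 2) ℂ) : ℂ :=
  Complex.exp (2 * Real.pi * Complex.I * (α * Z 0 0 + m * Z 0 1 + γ * Z 1 1))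

lemma expTr_symMat (α m γ : ℚ) {Z : Matrix (Fin 2) (Fin 2) ℂ} (hZ : Z.IsSymm) :
    expTr (symMat α m γ) Z = qexp α m γ Z := by
  have h : Z 1 0 = Z 0 1 := hZ.apply 0 1
  rw [expTr, qexp]
  congr 2
  simp [toC, symMat, trace, Fin.sum_univ_two, mul_apply, h]
  ring

lemma eq_symMat_of_mem_APlus {N : ℕ} {S : Matrix (Fin 2) (Fin 2) ℚ} (hS : S ∈ APlus N) :
    symMat (S 0 0) (2 * S 0 1) (S 1 1) = S := by
  obtain ⟨α, m, γ, rfl, -⟩ := hS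
  ext i j
  fin_cases i <;> fin_cases j <;> simp [symMat, halfMat]

lemma symMat_injective {α m γ α' m' γ' : ℚ} (h : symMat α m γ = symMat α' m' γ') :
    α = α' ∧ m = m' ∧ γ = γ' := by
  have h1 := congrFun (congrFun h 0) 0
  have h2 := congrFun (congrFun h 0) 1
  have h3 := congrFun (congrFun h 1) 1
  simp only [symMat, of_apply, cons_val', cons_val_zero, cons_val_one, cons_val_fin_one] at h1 h2 h3
  exact ⟨h1, by linarith, h3⟩

/-- Rational triples are a common index set for expansions of different levels. The entries
determine `S`, and terms outside the image of `A(N)⁺` vanish. -/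
lemma hasSum_APlus_iff {N : ℕ} {c : ℚ → ℚ → ℚ → ℂ}
    (hc : ∀ α m γ, c α m γ ≠ 0 → symMat α m γ ∈ APlus N) {Z : Matrix (Fin 2) (Fin 2) ℂ}
    (hZ : Z ∈ siegelH2) {v : ℂ} :
    HasSum (fun S : APlus N => c (S.1 0 0) (2 * S.1 0 1) (S.1 1 1) * expTr S Z) v ↔
      HasSum (fun x : ℚ × ℚ × ℚ => c x.1 x.2.1 x.2.2 * qexp x.1 x.2.1 x.2.2 Z) v := by
  let g : APlus N → ℚ × ℚ × ℚ := fun S => (S.1 0 0, 2 * S.1 0 1, S.1 1 1)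
  have hg : Function.Injective g := by
    intro S T h
    refine Subtype.ext ?_
    rw [← eq_symMat_of_mem_APlus S.2, ← eq_symMat_of_mem_APlus T.2]
    simp only [g, Prod.mk.injEq] at h
    rw [h.1, h.2.1, h.2.2]
  rw [← hg.hasSum_iff]
  · refine Eq.to_iff (congrArg (fun f => HasSum f v) (funext fun S => ?_))
    simp only [g, Function.comp_apply]
    rw [← expTr_symMat _ _ _ hZ.1, eq_symMat_of_mem_APlus S.2]
  · rintro ⟨α, m, γ⟩ hx
    by_contra h
    have h := hc α m γ (left_ne_zero_of_mul h)
    refine hx ⟨⟨_, h⟩, ?_⟩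
    simp only [g, symMat, of_apply, cons_val', cons_val_zero, cons_val_one, cons_val_fin_one,
      Prod.mk.injEq, true_and, and_true]
    ring

/-! ### Uniqueness of Fourier coefficients -/

/-- Instead of integrating over a torus, average over rational points of denominator `M + 1`. Finite
orthogonality isolates the sum of `f` over the congruence class of `x₀` modulo `M + 1`, which is
therefore `0`; letting `M` grow leaves `f x₀`. -/
lemma eq_zero_of_forall_tsum_mul_e {f : ℚ × ℚ × ℚ → ℂ} (hf : Summable f)
    (hint : ∀ x, f x ≠ 0 → ∃ a b c : ℤ, x = ((a : ℚ), (b : ℚ), (c : ℚ)))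
    (h : ∀ r s t : ℚ, HasSum (fun x => f x * e (x.1 * r + x.2.1 * s + x.2.2 * t)) 0) : f = 0 := by
  classical
  funext x₀
  by_contra hx₀
  obtain ⟨a₀, b₀, c₀, hx₀'⟩ := hint x₀ hx₀
  let P : ℕ → ℚ × ℚ × ℚ → Prop := fun M x => ∃ a b c : ℤ, x = ((a : ℚ), (b : ℚ), (c : ℚ)) ∧
    (M : ℤ) ∣ a - a₀ ∧ (M : ℤ) ∣ b - b₀ ∧ (M : ℤ) ∣ c - c₀
  have hsum : ∀ M : ℕ, HasSum (fun x => if P (M + 1) x then f x else 0) 0 := by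
    intro M
    have hM : ((M + 1 : ℕ) : ℂ) ≠ 0 := by exact_mod_cast Nat.succ_ne_zero M
    have h1 : HasSum (fun x => (((M + 1 : ℕ) : ℂ)⁻¹) ^ 3 * ∑ u : ZMod (M + 1), ∑ v : ZMod (M + 1),
        ∑ w : ZMod (M + 1), e (-(a₀ * rep u + b₀ * rep v + c₀ * rep w) / (M + 1 : ℕ)) *
          (f x * e (x.1 * (rep u / (M + 1 : ℕ)) + x.2.1 * (rep v / (M + 1 : ℕ)) +
            x.2.2 * (rep w / (M + 1 : ℕ)))))
        ((((M + 1 : ℕ) : ℂ)⁻¹) ^ 3 * ∑ u : ZMod (M + 1), ∑ v : ZMod (M + 1),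
        ∑ w : ZMod (M + 1), e (-(a₀ * rep u + b₀ * rep v + c₀ * rep w) / (M + 1 : ℕ)) * 0) :=
      HasSum.mul_left _ (hasSum_sum fun _ _ => hasSum_sum fun _ _ => hasSum_sum fun _ _ =>
        HasSum.mul_left _ (h _ _ _))
    simp only [mul_zero, Finset.sum_const_zero] at h1
    refine h1.congr_fun fun x => ?_
    by_cases hx : f x = 0
    · simp [hx]
    obtain ⟨a, b, c, rfl⟩ := hint x hx
    have h2 : ∀ u v w : ZMod (M + 1),
        e (-(a₀ * rep u + b₀ * rep v + c₀ * rep w) / (M + 1 : ℕ)) *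
          (f (a, b, c) * e (a * (rep u / (M + 1 : ℕ)) + b * (rep v / (M + 1 : ℕ)) +
            c * (rep w / (M + 1 : ℕ)))) = f (a, b, c) * (e ((a - a₀ : ℤ) * rep u / (M + 1 : ℕ)) *
          (e ((b - b₀ : ℤ) * rep v / (M + 1 : ℕ)) * e ((c - c₀ : ℤ) * rep w / (M + 1 : ℕ)))) := by
      intro u v w
      rw [mul_left_comm, ← e_add, ← e_add, ← e_add]
      congr 2
      push_cast
      ring
    simp only [h2, ← Finset.mul_sum, ← Finset.sum_mul]
    rw [sum_zmod_e, sum_zmod_e, sum_zmod_e]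
    have hP : P (M + 1) ((a : ℚ), (b : ℚ), (c : ℚ)) ↔ ((M + 1 : ℕ) : ℤ) ∣ a - a₀ ∧
        ((M + 1 : ℕ) : ℤ) ∣ b - b₀ ∧ ((M + 1 : ℕ) : ℤ) ∣ c - c₀ := by
      constructor
      · rintro ⟨a', b', c', h, h'⟩
        simp only [Prod.mk.injEq, Int.cast_inj] at h
        rwa [h.1, h.2.1, h.2.2]
      · intro h
        exact ⟨a, b, c, rfl, h⟩
    simp only [hP]
    by_cases h3 : ((M + 1 : ℕ) : ℤ) ∣ a - a₀
    · by_cases h4 : ((M + 1 : ℕ) : ℤ) ∣ b - b₀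
      · by_cases h5 : ((M + 1 : ℕ) : ℤ) ∣ c - c₀
        · rw [if_pos h3, if_pos h4, if_pos h5, if_pos ⟨h3, h4, h5⟩]
          generalize ((M + 1 : ℕ) : ℂ) = z at hM ⊢
          field_simp
        · rw [if_neg h5, if_neg fun h => h5 h.2.2]; ring
      · rw [if_neg h4, if_neg fun h => h4 h.2.1]; ring
    · rw [if_neg h3, if_neg fun h => h3 h.1]; ring
  -- A fixed integral `x ≠ x₀` eventually leaves the class of `x₀`, and `‖f‖` dominates throughout.
  have hlim := tendsto_tsum_of_dominated_convergence (𝓕 := atTop)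
    (f := fun (M : ℕ) x => if P (M + 1) x then f x else 0)
    (g := fun x => if x = x₀ then f x else 0) (bound := fun x => ‖f x‖) hf.norm
    (by
      intro x
      by_cases hx : x = x₀
      · subst hx
        have hPx : ∀ M : ℕ, P (M + 1) x := fun M => ⟨a₀, b₀, c₀, hx₀', by simp, by simp, by simp⟩
        simp only [hPx, if_true]
        exact tendsto_const_nhds
      · rw [if_neg hx]
        refine tendsto_const_nhds.congr' ?_
        by_cases hfx : f x = 0
        · exact Eventually.of_forall fun M => by simp [hfx]
        obtain ⟨a, b, c, rfl⟩ := hint x hfx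
        filter_upwards [eventually_ge_atTop ((a - a₀).natAbs + (b - b₀).natAbs + (c - c₀).natAbs)]
          with M hM
        rw [if_neg]
        rintro ⟨a', b', c', h, h1, h2, h3⟩
        simp only [Prod.mk.injEq, Int.cast_inj] at h
        rw [← h.1] at h1
        rw [← h.2.1] at h2
        rw [← h.2.2] at h3
        refine hx ?_
        rw [hx₀']
        have h1 := Int.eq_zero_of_dvd_of_natAbs_lt_natAbs h1 (by simp only [Int.natAbs_natCast]; omega)
        have h2 := Int.eq_zero_of_dvd_of_natAbs_lt_natAbs h2 (by simp only [Int.natAbs_natCast]; omega)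
        have h3 := Int.eq_zero_of_dvd_of_natAbs_lt_natAbs h3 (by simp only [Int.natAbs_natCast]; omega)
        rw [sub_eq_zero.1 h1, sub_eq_zero.1 h2, sub_eq_zero.1 h3])
    (Eventually.of_forall fun M x => by
      split_ifs
      · exact le_rfl
      · simp)
  simp only [fun M => (hsum M).tsum_eq, tsum_ite_eq] at hlim
  exact hx₀ (tendsto_nhds_unique hlim tendsto_const_nhds)

lemma siegelH2_one_add (x y z : ℝ) :
    !![(x : ℂ) + Complex.I, y; (y : ℂ), z + Complex.I] ∈ siegelH2 := by
  refine ⟨?_, ?_⟩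
  · ext i j; fin_cases i <;> fin_cases j <;> rfl
  · have : (!![(x : ℂ) + Complex.I, y; (y : ℂ), z + Complex.I]).map Complex.im = 1 := by
      ext i j; fin_cases i <;> fin_cases j <;> simp
    rw [this]
    exact PosDef.one

/-- At `Z = X + i` with `X` rational the exponential is the additive character of `X` times its
nonzero value at `i`. That value is absorbed into `f`, to which the uniqueness lemma applies. -/
lemma coef_eq_of_hasSum {c c' : ℚ → ℚ → ℚ → ℂ} {F : Matrix (Fin 2) (Fin 2) ℂ → ℂ}
    (hint : ∀ α m γ, c α m γ ≠ 0 → ∃ a b g : ℤ, α = a ∧ m = b ∧ γ = g)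
    (hint' : ∀ α m γ, c' α m γ ≠ 0 → ∃ a b g : ℤ, α = a ∧ m = b ∧ γ = g)
    (h : ∀ Z ∈ siegelH2,
      HasSum (fun x : ℚ × ℚ × ℚ => c x.1 x.2.1 x.2.2 * qexp x.1 x.2.1 x.2.2 Z) (F Z))
    (h' : ∀ Z ∈ siegelH2,
      HasSum (fun x : ℚ × ℚ × ℚ => c' x.1 x.2.1 x.2.2 * qexp x.1 x.2.1 x.2.2 Z) (F Z))
    (α m γ : ℚ) : c α m γ = c' α m γ := by
  let Z₀ : Matrix (Fin 2) (Fin 2) ℂ := !![Complex.I, 0; 0, Complex.I]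
  let f : ℚ × ℚ × ℚ → ℂ := fun x =>
    (c x.1 x.2.1 x.2.2 - c' x.1 x.2.1 x.2.2) * qexp x.1 x.2.1 x.2.2 Z₀
  have hf : ∀ r s t : ℚ, HasSum (fun x => f x * e (x.1 * r + x.2.1 * s + x.2.2 * t)) 0 := by
    intro r s t
    have hZ := siegelH2_one_add r s t
    have h1 := (h _ hZ).sub (h' _ hZ)
    rw [sub_self] at h1
    refine h1.congr_fun fun x => ?_
    rw [← sub_mul]
    simp only [f]
    rw [mul_assoc, qexp, qexp, e, ← Complex.exp_add]
    congr 2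
    simp [Z₀]
    ring
  have h0 : f = 0 := by
    refine eq_zero_of_forall_tsum_mul_e ?_ ?_ hf
    · have := (hf 0 0 0).summable
      simpa [e_zero] using this
    · rintro ⟨α, m, γ⟩ hne
      have hne := left_ne_zero_of_mul hne
      have hor : c α m γ ≠ 0 ∨ c' α m γ ≠ 0 := by
        by_contra hcon
        push Not at hcon
        exact hne (by simp only [hcon.1, hcon.2, sub_self])
      obtain ⟨a, b, g, rfl, rfl, rfl⟩ := hor.elim (hint α m γ) (hint' α m γ)
      exact ⟨a, b, g, rfl⟩
  have h1 := congrFun h0 (α, m, γ)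
  simp only [f, Pi.zero_apply, mul_eq_zero, qexp, Complex.exp_ne_zero, or_false] at h1
  exact sub_eq_zero.1 h1

/-! ### The action of upper triangular matrices on Fourier expansions -/

lemma toC_mul {l m n : Type*} [Fintype m] (A : Matrix l m ℚ) (B : Matrix m n ℚ) :
    toC (A * B) = toC A * toC B := Matrix.map_mul

lemma toC_mul_mul_add_mem_siegelH2 {r s t : ℚ} (hr : r ≠ 0) (ht : t ≠ 0) (q₁ q₂ q₃ : ℚ)
    {Z : Matrix (Fin 2) (Fin 2) ℂ} (hZ : Z ∈ siegelH2) :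
    toC !![r, s; 0, t] * Z * (toC !![r, s; 0, t])ᵀ + toC !![q₁, q₂; q₂, q₃] ∈ siegelH2 := by
  have h : Z 1 0 = Z 0 1 := hZ.1.apply 0 1
  refine ⟨?_, ?_⟩
  · ext i j
    fin_cases i <;> fin_cases j <;>
      simp [toC, mul_apply, Fin.sum_univ_two, h, transpose_apply] <;> ring
  · let P : Matrix (Fin 2) (Fin 2) ℝ := !![(r : ℝ), s; 0, t]
    have hP : (toC !![r, s; 0, t] * Z * (toC !![r, s; 0, t])ᵀ + toC !![q₁, q₂; q₂, q₃]).map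
        Complex.im = P * Z.map Complex.im * Pᴴ := by
      ext i j
      fin_cases i <;> fin_cases j <;>
        simp [P, toC, mul_apply, vecMul, dotProduct, Fin.sum_univ_two, h]
    rw [hP]
    refine hZ.2.mul_mul_conjTranspose_same (Matrix.vecMul_injective_of_isUnit ?_)
    rw [Matrix.isUnit_iff_isUnit_det, isUnit_iff_ne_zero]
    simp [P, det_fin_two, hr, ht]

/-- The matrix is block upper triangular with lower right block `ᵗP⁻¹`, so the cocycle is constant
with determinant `det(P)⁻¹`. -/
lemma slashQP_eq (k : ℕ) (F : Matrix (Fin 2) (Fin 2) ℂ → ℂ) (q₁ q₂ q₃ : ℚ) {r s t : ℚ}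
    (hr : r ≠ 0) (ht : t ≠ 0) (Z : Matrix (Fin 2) (Fin 2) ℂ) :
    slashQP k F q₁ q₂ q₃ !![r, s; 0, t] Z = ((r * t : ℚ) : ℂ) ^ k *
      F (toC !![r, s; 0, t] * Z * (toC !![r, s; 0, t])ᵀ + toC !![q₁, q₂; q₂, q₃]) := by
  set P : Matrix (Fin 2) (Fin 2) ℚ := !![r, s; 0, t] with hPdef
  have hdet : P.det = r * t := by simp [hPdef, det_fin_two]
  have hunit : IsUnit P.det := by rw [hdet]; exact (mul_ne_zero hr ht).isUnit
  have hinv : (toC (P⁻¹)ᵀ) * (toC P)ᵀ = 1 := by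
    have : (toC P)ᵀ = toC Pᵀ := rfl
    rw [this, ← toC_mul, ← transpose_mul, mul_nonsing_inv _ hunit, transpose_one, toC]
    exact Matrix.map_one _ (map_zero _) (map_one _)
  have h0 : toC (0 : Matrix (Fin 2) (Fin 2) ℚ) = 0 := Matrix.map_zero _ (map_zero _)
  rw [slashQP, fromBlocks_multiply, slash, moebius, cocycle]
  simp only [toBlocks_fromBlocks₁₁, toBlocks_fromBlocks₁₂, toBlocks_fromBlocks₂₁,
    toBlocks_fromBlocks₂₂, Matrix.one_mul, Matrix.mul_zero, Matrix.zero_mul, add_zero, zero_add,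
    h0, toC_mul]
  rw [inv_eq_right_inv hinv, Matrix.add_mul, Matrix.mul_assoc (toC !![q₁, q₂; q₂, q₃]), hinv,
    Matrix.mul_one]
  congr 1
  have : (toC (P⁻¹)ᵀ).det = (((r * t)⁻¹ : ℚ) : ℂ) := by
    have := RingHom.map_det (algebraMap ℚ ℂ) (P⁻¹)ᵀ
    rw [toC, ← RingHom.mapMatrix_apply, ← this, det_transpose, det_nonsing_inv, hdet,
      Ring.inverse_eq_inv']
    rfl
  rw [this, _root_.zpow_neg, zpow_natCast, Rat.cast_inv, inv_pow, inv_inv]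

/-- The substitution `S ↦ S[P]` on `S = [α, m/2; m/2, γ]` for `P = [r, s; 0, t]`. -/
def substEquiv {r t : ℚ} (s : ℚ) (hr : r ≠ 0) (ht : t ≠ 0) : ℚ × ℚ × ℚ ≃ ℚ × ℚ × ℚ where
  toFun x := (x.1 * r ^ 2, 2 * x.1 * r * s + x.2.1 * r * t,
    x.1 * s ^ 2 + x.2.1 * s * t + x.2.2 * t ^ 2)
  invFun y := (y.1 / r ^ 2, y.2.1 / (r * t) - 2 * y.1 * s / (r ^ 2 * t),
    y.2.2 / t ^ 2 - y.2.1 * s / (r * t ^ 2) + y.1 * s ^ 2 / (r ^ 2 * t ^ 2))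
  left_inv x := by
    ext
    · field_simp
    · simp only; field_simp; ring
    · simp only; field_simp; ring
  right_inv y := by
    ext
    · simp only; field_simp
    · simp only; field_simp; ring
    · simp only; field_simp; ring

/-- `tr(S (P Z ᵗP + Q)) = tr(S[P] Z) + tr(S Q)`; reindexing by `T = S[P]` produces `coefQP`. -/
lemma hasSum_slashQP {A : ℚ → ℚ → ℚ → ℂ} {F : Matrix (Fin 2) (Fin 2) ℂ → ℂ}
    (h : ∀ Z ∈ siegelH2,
      HasSum (fun x : ℚ × ℚ × ℚ => A x.1 x.2.1 x.2.2 * qexp x.1 x.2.1 x.2.2 Z) (F Z))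
    (k : ℕ) (q₁ q₂ q₃ : ℚ) {r s t : ℚ} (hr : r ≠ 0) (ht : t ≠ 0)
    {Z : Matrix (Fin 2) (Fin 2) ℂ} (hZ : Z ∈ siegelH2) :
    HasSum (fun x : ℚ × ℚ × ℚ => coefQP A k x.1 x.2.1 x.2.2 q₁ q₂ q₃ r s t *
      qexp x.1 x.2.1 x.2.2 Z) (slashQP k F q₁ q₂ q₃ !![r, s; 0, t] Z) := by
  have hsymm : Z 1 0 = Z 0 1 := hZ.1.apply 0 1
  rw [slashQP_eq k F q₁ q₂ q₃ hr ht]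
  have h1 := (h _ (toC_mul_mul_add_mem_siegelH2 (s := s) hr ht q₁ q₂ q₃ hZ)).mul_left
    (((r * t : ℚ) : ℂ) ^ k)
  rw [← (substEquiv s hr ht).symm.hasSum_iff] at h1
  refine h1.congr_fun fun y => ?_
  simp only [Function.comp_apply, substEquiv, Equiv.coe_fn_symm_mk, coefQP, coefAt]
  rw [mul_assoc, mul_assoc]
  congr 2
  rw [e, qexp, qexp, ← Complex.exp_add]
  congr 1
  have hr' : (r : ℂ) ≠ 0 := by exact_mod_cast hr
  have ht' : (t : ℂ) ≠ 0 := by exact_mod_cast ht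
  simp [toC, mul_apply, Fin.sum_univ_two, hsymm]
  field_simp
  ring

end

section

variable {p : ℕ} [Fact p.Prime] {A : ℚ → ℚ → ℚ → ℂ}

/-! ### Quadratic character sums -/

/-- For `w ≠ 0` divide by the square `w²`: the value is `χ(1 + d w⁻¹)`. If `d ≠ 0`, then `1 + d w⁻¹`
runs over everything except `1`. -/
lemma sum_χ_mul_add (hp : p ≠ 2) (d : ZMod p) : ∑ w : ZMod p, χ p (w * (w + d)) = ramanujan p d := by
  have h1 := sum_units_eq_sum_erase p (fun w => χ p (w * (w + d)))
  simp only [zero_mul, MulChar.map_zero, sub_zero] at h1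
  rw [← h1]
  have h2 : ∀ w : (ZMod p)ˣ, χ p (w * (w + d) : ZMod p) = χ p (1 + d * (w : ZMod p)⁻¹) := by
    intro w
    have hw : (w : ZMod p) ≠ 0 := w.ne_zero
    rw [← χ_mul_sq (1 + d * (w : ZMod p)⁻¹) hw]
    congr 1
    field_simp
  rw [Finset.sum_congr rfl fun w _ => h2 w, sum_units_inv (fun w => χ p (1 + d * w)),
    sum_units_eq_sum_erase p (fun w => χ p (1 + d * w)), ramanujan]
  split_ifs with hd
  · subst hd
    simp [ZMod.card]
  · rw [mul_zero, add_zero, map_one]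
    have := Equiv.sum_comp ((Equiv.mulLeft₀ d hd).trans (Equiv.addLeft 1)) (fun x => χ p x)
    simp only [Equiv.trans_apply, Equiv.mulLeft₀_apply, Equiv.coe_addLeft] at this
    rw [this, sum_χ hp, zero_sub]

lemma sum_χ_one_sub_mul (hp : p ≠ 2) (u v : ZMod p) :
    ∑ z : ZMod p, χ p ((1 - z) * (u - v * z)) = χ p v * ramanujan p (u - v) := by
  rw [← Equiv.sum_comp (Equiv.subLeft 1)]
  simp only [Equiv.subLeft_apply, sub_sub_cancel]
  rcases eq_or_ne v 0 with rfl | hv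
  · simp only [zero_mul, sub_zero, map_mul, MulChar.map_zero, ← Finset.sum_mul, sum_χ hp]
  · have h : ∀ w : ZMod p, χ p (w * (u - v * (1 - w))) =
        χ p v * χ p (w * (w + v⁻¹ * (u - v))) := by
      intro w
      rw [← map_mul]
      congr 1
      field_simp
      ring
    rw [Finset.sum_congr rfl fun w _ => h w, ← Finset.mul_sum, sum_χ_mul_add hp,
      ramanujan_mul (inv_ne_zero hv)]

lemma sum_χ_mul_sub (hp : p ≠ 2) (c : ZMod p) :
    ∑ x : ZMod p, χ p (x * (c - x)) = χ p (-1) * ramanujan p c := by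
  have h : ∀ x : ZMod p, χ p (x * (c - x)) = χ p (-1) * χ p (x * (x + (-1) * c)) := by
    intro x; rw [← map_mul]; congr 1; ring
  rw [Finset.sum_congr rfl fun x _ => h x, ← Finset.mul_sum, sum_χ_mul_add hp,
    ramanujan_mul (neg_ne_zero.2 one_ne_zero)]

lemma sum_units_ne_one (f : ZMod p → ℂ) :
    ∑ z : (ZMod p)ˣ with z ≠ 1, f z = (∑ z : ZMod p, f z) - f 0 - f 1 := by
  have h1 := Finset.sum_filter_add_sum_filter_not Finset.univ (fun z : (ZMod p)ˣ => z ≠ 1)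
    (fun z => f z)
  rw [sum_units_eq_sum_erase p f] at h1
  rw [← h1, eq_sub_iff_add_eq]
  simp [Finset.filter_eq']

lemma ramanujan_zero : ramanujan p 0 = (p : ℂ) - 1 := if_pos rfl

lemma ramanujan_of_ne_zero {c : ZMod p} (hc : c ≠ 0) : ramanujan p c = -1 := if_neg hc

lemma sum_units_ne_one_χ_mul_one_sub (hp : p ≠ 2) :
    ∑ z : (ZMod p)ˣ with z ≠ 1, χ p (z * (1 - z)) = -χ p (-1) := by
  rw [sum_units_ne_one (fun z => χ p (z * (1 - z))), sum_χ_mul_sub hp,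
    ramanujan_of_ne_zero one_ne_zero]
  simp [MulChar.map_zero]

lemma sum_units_ne_one_χ_one_sub (hp : p ≠ 2) :
    ∑ z : (ZMod p)ˣ with z ≠ 1, χ p (1 - z) = -1 := by
  have h := Equiv.sum_comp (Equiv.subLeft (1 : ZMod p)) (fun x => χ p x)
  simp only [Equiv.subLeft_apply, sum_χ hp] at h
  rw [sum_units_ne_one (fun z => χ p (1 - z)), h]
  simp [MulChar.map_zero]

lemma sum_units_ne_one_χ (hp : p ≠ 2) : ∑ z : (ZMod p)ˣ with z ≠ 1, χ p z = -1 := by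
  rw [sum_units_ne_one (fun z => χ p z), sum_χ hp]
  simp [MulChar.map_zero]

lemma sum_units_χ_linear (hp : p ≠ 2) (a b : ZMod p) :
    ∑ c : (ZMod p)ˣ, χ p (b * c - a) = χ p (-a) * ramanujan p b := by
  rw [sum_units_eq_sum_erase p (fun c => χ p (b * c - a))]
  rcases eq_or_ne b 0 with rfl | hb
  · simp [ramanujan_zero, ZMod.card]; ring
  · have := Equiv.sum_comp ((Equiv.mulLeft₀ b hb).trans (Equiv.subRight a)) (fun x => χ p x)
    simp only [Equiv.trans_apply, Equiv.mulLeft₀_apply, Equiv.subRight_apply] at this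
    rw [this, sum_χ hp, ramanujan_of_ne_zero hb]
    simp

/-- The inner sum is a full sum over `z`, hence a Ramanujan sum of a quadratic in `c`, minus the
term at `z = 0`. Summed over `c`, both parts are explicit. -/
lemma sum_sum_χ_quadratic (hp : p ≠ 2) (a b g : ZMod p) :
    ∑ c : (ZMod p)ˣ, ∑ z : (ZMod p)ˣ with z ≠ 1,
      χ p ((1 - z) * (-a + b * c - g * (c : ZMod p) ^ 2 * z)) =
    χ p g * (p * χ p (b ^ 2 - 4 * a * g) - ramanujan p a) - χ p (-a) * ramanujan p b := by
  have h : ∀ c : (ZMod p)ˣ, ∑ z : (ZMod p)ˣ with z ≠ 1,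
      χ p ((1 - z) * (-a + b * c - g * (c : ZMod p) ^ 2 * z)) =
      χ p g * ramanujan p (g * (c : ZMod p) ^ 2 + (-b) * c + a) - χ p (b * c - a) := by
    intro c
    rw [sum_units_ne_one (fun z : ZMod p => χ p ((1 - z) * (-a + b * c - g * (c : ZMod p) ^ 2 * z))),
      sum_χ_one_sub_mul hp, χ_mul_sq g c.ne_zero, sub_self, zero_mul, MulChar.map_zero, sub_zero,
      ← ramanujan_mul (neg_ne_zero.2 one_ne_zero)]
    congr 2
    · congr 1; ring
    · ring
  rw [Finset.sum_congr rfl fun c _ => h c, Finset.sum_sub_distrib, sum_units_χ_linear hp,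
    ← Finset.mul_sum]
  congr 1
  rcases eq_or_ne g 0 with rfl | hg
  · simp only [MulChar.map_zero, zero_mul]
  · rw [sum_units_eq_sum_erase p (fun c => ramanujan p (g * c ^ 2 + (-b) * c + a)),
      sum_ramanujan_quadratic hp hg]
    congr 4
    · ring
    · ring

/-! ### The contributions of the individual matrices `P` -/

lemma intCast_zmod_sq_eq_zero_iff (n : ℤ) : ((n : ℤ) : ZMod (p ^ 2)) = 0 ↔ (p : ℤ) ^ 2 ∣ n := by
  rw [ZMod.intCast_zmod_eq_zero_iff_dvd]; push_cast; rfl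

lemma intCast_zmod_eq_zero_iff (n : ℤ) : ((n : ℤ) : ZMod p) = 0 ↔ (p : ℤ) ∣ n :=
  ZMod.intCast_zmod_eq_zero_iff_dvd n p

lemma isUnit_intCast_zmod_sq {n : ℤ} (h : ¬ (p : ℤ) ∣ n) : IsUnit ((n : ℤ) : ZMod (p ^ 2)) := by
  refine isUnit_of_red_ne_zero (n := 1) ?_
  rw [red_eq_castHom, map_intCast]
  rwa [Ne, intCast_zmod_eq_zero_iff]

/-- Operator 1 when `p² ∣ m`: the coefficient depends on `c = x + y` only, and `∑ χ(x (c - x))` over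
`x` is a Ramanujan sum in `c`, namely `p - 1` at `c = 0` and `-1` elsewhere, up to `χ(-1)`. -/
lemma sum_sum_χ_coefAt_one (hp : p ≠ 2) (hA : IsCoefFun A) (b g : ℤ) (α m γ : ℚ) :
    ∑ x : (ZMod p)ˣ, ∑ y : (ZMod p)ˣ, χ p (x * y * (((p * b : ℤ) : ZMod p) * x - g)) *
        coefAt A 1 ((rep x.1 + rep y.1) / p) 1 α m γ =
      χ p g * (((p : ℂ) - 1) * coefAt A 1 0 1 α m γ -
        ∑ x : (ZMod p)ˣ, coefAt A 1 (rep x.1 / p) 1 α m γ) := by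
  have hq : (p : ℚ) ≠ 0 := natCast_prime_ne_zero p ℚ
  let H : ZMod p → ℂ := fun c => coefAt A 1 (rep c / p) 1 α m γ
  have hH : ∀ x y : ZMod p, coefAt A 1 ((rep x + rep y) / p) 1 α m γ = H (x + y) := by
    intro x y
    obtain ⟨j, hj⟩ := exists_rep_eq (N := p) (x := x + y) (n := x.val + y.val) (by push_cast; simp)
    refine hA.coefAt_eq_of one_ne_zero one_ne_zero (-j) ?_ _ _ _
    rw [hj]; simp only [rep]; push_cast; field_simp; ring
  have h1 : ∀ x : (ZMod p)ˣ, ∑ y : (ZMod p)ˣ, χ p (x * y * (((p * b : ℤ) : ZMod p) * x - g)) *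
        coefAt A 1 ((rep x.1 + rep y.1) / p) 1 α m γ =
      ∑ c : ZMod p, χ p (-g) * χ p (x * (c - x)) * H c := by
    intro x
    rw [← Equiv.sum_comp (Equiv.addLeft (x : ZMod p))]
    have h2 := sum_units_eq_sum_erase p
      (fun y => χ p (-g) * χ p (x * (x + y - x)) * H (x + y))
    simp only [add_zero, sub_self, mul_zero, MulChar.map_zero, zero_mul, sub_zero] at h2
    simp only [Equiv.coe_addLeft]
    rw [← h2]
    refine Finset.sum_congr rfl fun y _ => ?_
    rw [hH, ← map_mul]
    congr 2
    push_cast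
    rw [CharP.cast_eq_zero]
    ring
  rw [Finset.sum_congr rfl fun x _ => h1 x, Finset.sum_comm]
  have h3 : ∀ c : ZMod p, ∑ x : (ZMod p)ˣ, χ p (-g) * χ p (x * (c - x)) * H c =
      χ p g * (ramanujan p c * H c) := by
    intro c
    have h4 := sum_units_eq_sum_erase p (fun x => χ p (x * (c - x)))
    rw [zero_mul, MulChar.map_zero, sub_zero, sum_χ_mul_sub hp] at h4
    rw [← Finset.sum_mul, ← Finset.mul_sum, h4, ← mul_assoc (χ p (-g)), ← map_mul, mul_assoc]
    congr 2
    ring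
  rw [Finset.sum_congr rfl fun c _ => h3 c, ← Finset.mul_sum]
  congr 1
  have h5 := sum_units_eq_sum_erase p (fun c => ramanujan p c * H c)
  have h6 : H 0 = coefAt A 1 0 1 α m γ := by simp [H, rep]
  rw [eq_sub_iff_add_eq] at h5
  rw [← h5, add_comm, ramanujan_zero, h6, sub_eq_add_neg _ (∑ x : (ZMod p)ˣ, _), ← Finset.sum_neg_distrib]
  congr 1
  refine Finset.sum_congr rfl fun x _ => ?_
  rw [ramanujan_of_ne_zero x.ne_zero, neg_one_mul]

/-- The lower right entry of `S` is integral only if `p²` divides `u (a u - b)`, and `u` is a unit.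
-/
lemma dvd_of_coefAt_self_one_ne_zero (hA : IsCoefFun A) (a b g : ℤ) (u : (ZMod (p ^ 2))ˣ)
    (h : coefAt A p (rep u.1 / p ^ 2) 1 (p ^ 4 * a) (p ^ 1 * b) g ≠ 0) :
    (a : ZMod (p ^ 2)) * (u : ZMod (p ^ 2)) = (b : ZMod (p ^ 2)) := by
  have hq : (p : ℚ) ≠ 0 := natCast_prime_ne_zero p ℚ
  obtain ⟨-, -, c, -, -, -, -, -, hc⟩ := hA.coefAt_integral hq one_ne_zero h
  have h1 : (p : ℤ) ^ 2 ∣ u.1.val * (a * u.1.val - b) := by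
    refine ⟨c - g, ?_⟩
    have : (u.1.val : ℚ) * (a * u.1.val - b) = p ^ 2 * (c - g) := by
      rw [← hc]; simp only [rep]; field_simp; ring
    exact_mod_cast this
  have h2 := (isCoprime_val_unit p u).pow_left.dvd_of_dvd_mul_left h1
  rw [← intCast_zmod_sq_eq_zero_iff] at h2
  push_cast at h2
  rw [ZMod.natCast_zmod_val] at h2
  exact sub_eq_zero.1 h2

/-- As `a` is prime to `p`, the congruence `a u ≡ b` modulo `p²` singles out one `u`, the class of
`x`. -/
lemma sum_coefAt_self_one (hA : IsCoefFun A) {a b : ℤ} (g : ℤ) (ha : ¬ (p : ℤ) ∣ a)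
    (hb : ¬ (p : ℤ) ∣ b) {x : ℤ} (hx : x * a ≡ b [ZMOD (p : ℤ) ^ 2]) :
    ∑ u : (ZMod (p ^ 2))ˣ, coefAt A p (rep u.1 / p ^ 2) 1 (p ^ 4 * a) (p ^ 1 * b) g =
      coefAt A p (x / p ^ 2) 1 (p ^ 4 * a) (p ^ 1 * b) g := by
  have hq : (p : ℚ) ≠ 0 := natCast_prime_ne_zero p ℚ
  have hxa : (x : ZMod (p ^ 2)) * a = b := by
    rw [← sub_eq_zero]
    exact_mod_cast (intCast_zmod_sq_eq_zero_iff (p := p) (x * a - b)).2 hx.symm.dvd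
  have hx' : ¬ (p : ℤ) ∣ x := by
    intro h
    have h1 : (p : ℤ) ∣ b - x * a := (dvd_pow_self _ two_ne_zero).trans hx.dvd
    have := dvd_add h1 (h.mul_right a)
    rw [sub_add_cancel] at this
    exact hb this
  obtain ⟨u₀, hu₀⟩ := isUnit_intCast_zmod_sq hx'
  rw [Fintype.sum_eq_single u₀]
  · obtain ⟨j, hj⟩ := exists_rep_eq (N := p ^ 2) (x := u₀.1) hu₀.symm
    refine hA.coefAt_eq_of one_ne_zero hq j ?_ _ _ _
    rw [hj]; push_cast; field_simp; ring
  · intro u hu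
    by_contra h
    have h1 := dvd_of_coefAt_self_one_ne_zero hA a b g u h
    refine hu (Units.ext ((isUnit_intCast_zmod_sq ha).mul_left_cancel ?_))
    rw [h1, hu₀, ← hxa, mul_comm]

lemma sum_coefAt_self_one_eq_zero (hA : IsCoefFun A) {a : ℤ} (b g : ℤ) (ha : ¬ (p : ℤ) ∣ a) :
    ∑ u : (ZMod (p ^ 2))ˣ,
      coefAt A p (rep u.1 / p ^ 2) 1 (p ^ 4 * a) (p ^ 1 * (p * b : ℤ)) g = 0 := by
  refine Finset.sum_eq_zero fun u _ => ?_
  by_contra h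
  have h1 := dvd_of_coefAt_self_one_ne_zero hA a _ g u h
  have h2 : IsUnit (((p * b : ℤ)) : ZMod (p ^ 2)) := by
    rw [← h1]; exact (isUnit_intCast_zmod_sq ha).mul u.isUnit
  have h3 := (h2.map (ZMod.castHom (dvd_pow_self p two_ne_zero) (ZMod p))).ne_zero
  rw [map_intCast] at h3
  exact h3 ((intCast_zmod_eq_zero_iff _).2 (dvd_mul_right _ _))

/-- Integrality of `S` means `u b ≡ -g` modulo `p²`, so only `u = y` can contribute, with `χ(b) χ(u)
= χ(-g)`. If `p ∣ y` no unit qualifies, and `χ(-g) = 0` as well. -/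
lemma sum_chi_coefAt_one_self (hA : IsCoefFun A) {a b g : ℤ} (hb : ¬ (p : ℤ) ∣ b) {y : ℤ}
    (hy : y * b ≡ -g [ZMOD (p : ℤ) ^ 2]) :
    χ p b * ∑ u : (ZMod (p ^ 2))ˣ,
        chi p u.1 * coefAt A 1 (-rep u.1 / p) p (p ^ 4 * a) (p ^ 1 * b) g =
      χ p (-g) * coefAt A 1 (-y / p) p (p ^ 4 * a) (p ^ 1 * b) g := by
  have hq : (p : ℚ) ≠ 0 := natCast_prime_ne_zero p ℚ
  have hyb : (y : ZMod (p ^ 2)) * b = -g := by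
    rw [← sub_eq_zero]
    exact_mod_cast (intCast_zmod_sq_eq_zero_iff (p := p) (y * b - -g)).2 hy.symm.dvd
  have key : ∀ u : (ZMod (p ^ 2))ˣ, coefAt A 1 (-rep u.1 / p) p (p ^ 4 * a) (p ^ 1 * b) g ≠ 0 →
      u.1 = y := by
    intro u h
    obtain ⟨-, -, c, -, -, -, -, -, hc⟩ := hA.coefAt_integral one_ne_zero hq h
    have h1 : (p : ℤ) ^ 2 ∣ u.1.val * b + g := by
      refine ⟨c - a * u.1.val ^ 2, ?_⟩
      have : (u.1.val : ℚ) * b + g = p ^ 2 * (c - a * u.1.val ^ 2) := by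
        rw [← hc]; simp only [rep]; field_simp; ring
      exact_mod_cast this
    rw [← intCast_zmod_sq_eq_zero_iff] at h1
    push_cast at h1
    rw [ZMod.natCast_zmod_val, ← neg_neg (g : ZMod (p ^ 2)), ← hyb, ← sub_eq_add_neg, sub_eq_zero]
      at h1
    exact (isUnit_intCast_zmod_sq hb).mul_right_cancel h1
  have hred : (y : ZMod p) * b = -g := by
    have := congrArg (ZMod.castHom (dvd_pow_self p two_ne_zero) (ZMod p)) hyb
    simpa only [map_mul, map_neg, map_intCast] using this
  by_cases hy' : (p : ℤ) ∣ y
  · have h1 : χ p (-g) = 0 := by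
      rw [← hred, (intCast_zmod_eq_zero_iff y).2 hy', zero_mul, MulChar.map_zero]
    rw [h1, zero_mul, Finset.sum_eq_zero, mul_zero]
    intro u _
    by_contra h
    have h2 := key u (right_ne_zero_of_mul h)
    have h3 := red_unit_ne_zero p (n := 1) u
    rw [red_eq_castHom, h2, map_intCast, (intCast_zmod_eq_zero_iff y).2 hy'] at h3
    exact h3 rfl
  · obtain ⟨u₀, hu₀⟩ := isUnit_intCast_zmod_sq hy'
    rw [Fintype.sum_eq_single u₀]
    · obtain ⟨j, hj⟩ := exists_rep_eq (N := p ^ 2) (x := u₀.1) hu₀.symm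
      rw [hA.coefAt_eq_of hq one_ne_zero (s' := -y / p) (-j), ← mul_assoc, chi,
        red_eq_castHom p (n := 1), hu₀,
        map_intCast (ZMod.castHom _ (ZMod p)), ← map_mul, mul_comm (b : ZMod p), hred]
      rw [hj]; push_cast; field_simp; ring
    · intro u hu
      by_contra h
      exact hu (Units.ext ((key u (right_ne_zero_of_mul h)).trans hu₀.symm))

lemma coefAt_self_self_ne_zero (hA : IsCoefFun A) {a b g : ℤ} (u : (ZMod (p ^ 2))ˣ)
    (h : coefAt A p (rep u.1 / p) p (p ^ 4 * a) (p ^ 2 * b) g ≠ 0) :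
    (a : ZMod (p ^ 2)) * (u : ZMod (p ^ 2)) ^ 2 - (b : ZMod (p ^ 2)) * (u : ZMod (p ^ 2)) + g = 0 := by
  have hq : (p : ℚ) ≠ 0 := natCast_prime_ne_zero p ℚ
  obtain ⟨-, -, c, -, -, -, -, -, hc⟩ := hA.coefAt_integral hq hq h
  have h1 : (p : ℤ) ^ 2 ∣ a * u.1.val ^ 2 - b * u.1.val + g := by
    refine ⟨c, ?_⟩
    have : (a : ℚ) * u.1.val ^ 2 - b * u.1.val + g = p ^ 2 * c := by
      rw [← hc]; simp only [rep]; field_simp; ring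
    exact_mod_cast this
  rw [← intCast_zmod_sq_eq_zero_iff] at h1
  push_cast at h1
  rwa [ZMod.natCast_zmod_val] at h1

/-- Integrality of `S` restricts `x` to the roots of the quadratic congruence, where `b x - a x²`
may be replaced by `g`. -/
lemma sum_χ_coefAt_self_self (hA : IsCoefFun A) (a b g : ℤ) :
    ∑ x : (ZMod (p ^ 2))ˣ, (∑ z : (ZMod p)ˣ with z ≠ 1,
          χ p (red p x.1 * z * (1 - z) * (b - a * red p x.1 - z * a * red p x.1))) *
        coefAt A p (rep x.1 / p) p (p ^ 4 * a) (p ^ 2 * b) g =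
      ∑ x ∈ Finset.univ.filter (fun x : (ZMod (p ^ 2))ˣ =>
          (a : ZMod (p ^ 2)) * (x : ZMod (p ^ 2)) ^ 2 - (b : ZMod (p ^ 2)) * (x : ZMod (p ^ 2)) + g = 0),
        ∑ z : (ZMod p)ˣ with z ≠ 1, χ p (z * (1 - z) * (g - z * a * red p x.1 ^ 2)) *
        coefAt A p (rep x.1 / p) p (p ^ 4 * a) (p ^ 2 * b) g := by
  rw [Finset.sum_filter]
  refine Finset.sum_congr rfl fun x _ => ?_
  split_ifs with hx
  · rw [Finset.sum_mul]
    refine Finset.sum_congr rfl fun z _ => ?_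
    congr 2
    have h := congrArg (ZMod.castHom (dvd_pow_self p two_ne_zero) (ZMod p)) hx
    simp only [map_add, map_sub, map_mul, map_pow, map_intCast, map_zero] at h
    rw [← red_eq_castHom p (n := 1) x.1] at h
    linear_combination (z * (1 - z) : ZMod p) * (-h)
  · rw [not_ne_iff.1 (mt (coefAt_self_self_ne_zero hA x) hx), mul_zero]

/-- Both conditions come from integrality of `S`, through the identity `4a (a x² - b x + g) = (b - 2
a x)² + (4ag - b²)`. -/
lemma dvd_of_coefAt_sq_self_ne_zero (hA : IsCoefFun A) {a b g : ℤ} (x : (ZMod p)ˣ)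
    (h : coefAt A (p ^ 2) (rep x.1) p (p ^ 4 * a) (p ^ 2 * b) g ≠ 0) :
    (2 : ZMod p) * a * (x : ZMod p) = b ∧ (p : ℤ) ^ 2 ∣ 4 * a * g - b ^ 2 := by
  have hq : (p : ℚ) ≠ 0 := natCast_prime_ne_zero p ℚ
  obtain ⟨-, b', c, -, -, -, -, hb, hc⟩ := hA.coefAt_integral (pow_ne_zero 2 hq) hq h
  have h1 : b - 2 * a * (x.1.val : ℤ) = p * b' := by
    have : (b : ℚ) - 2 * a * x.1.val = p * b' := by
      rw [← hb]; simp only [rep]; field_simp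
    exact_mod_cast this
  refine ⟨?_, 4 * a * c - b' ^ 2, ?_⟩
  · have h2 := congrArg (Int.cast : ℤ → ZMod p) h1
    push_cast at h2
    rw [ZMod.natCast_zmod_val, CharP.cast_eq_zero, zero_mul, sub_eq_zero] at h2
    exact h2.symm
  · have h2 : a * (x.1.val : ℤ) ^ 2 - b * x.1.val + g = p ^ 2 * c := by
      have : (a : ℚ) * x.1.val ^ 2 - b * x.1.val + g = p ^ 2 * c := by
        rw [← hc]; simp only [rep]; field_simp; ring
      exact_mod_cast this
    linear_combination 4 * a * h2 - (b - 2 * a * (x.1.val : ℤ) + p * b') * h1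

lemma dvd_of_coefAt_sq_sq_ne_zero (hA : IsCoefFun A) {a b g : ℤ} (x : (ZMod (p ^ 2))ˣ)
    (h : coefAt A (p ^ 2) (rep x.1) (p ^ 2) (p ^ 4 * a) (p ^ 2 * b) g ≠ 0) :
    (2 : ZMod (p ^ 2)) * (a : ZMod (p ^ 2)) * (x : ZMod (p ^ 2)) = b ∧ (p : ℤ) ^ 4 ∣ 4 * a * g - b ^ 2 := by
  have hq : (p : ℚ) ≠ 0 := natCast_prime_ne_zero p ℚ
  obtain ⟨-, b', c, -, -, -, -, hb, hc⟩ :=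
    hA.coefAt_integral (pow_ne_zero 2 hq) (pow_ne_zero 2 hq) h
  have h1 : b - 2 * a * (x.1.val : ℤ) = p ^ 2 * b' := by
    have : (b : ℚ) - 2 * a * x.1.val = p ^ 2 * b' := by
      rw [← hb]; simp only [rep]; field_simp
    exact_mod_cast this
  refine ⟨?_, 4 * a * c - b' ^ 2, ?_⟩
  · have h2 : (p : ℤ) ^ 2 ∣ b - 2 * a * (x.1.val : ℤ) := ⟨b', h1⟩
    rw [← intCast_zmod_sq_eq_zero_iff] at h2
    push_cast at h2
    rw [ZMod.natCast_zmod_val, sub_eq_zero] at h2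
    exact h2.symm
  · have h2 : a * (x.1.val : ℤ) ^ 2 - b * x.1.val + g = p ^ 4 * c := by
      have : (a : ℚ) * x.1.val ^ 2 - b * x.1.val + g = p ^ 4 * c := by
        rw [← hc]; simp only [rep]; field_simp; ring
      exact_mod_cast this
    linear_combination 4 * a * h2 - (b - 2 * a * (x.1.val : ℤ) + p ^ 2 * b') * h1

end

/-! ### The coefficient function of a cusp form, and the support of its twist -/

section

/-- The extension by zero of a family of Fourier coefficients, as a function of the entries of
`[α, m/2; m/2, γ]`. -/
def coefExt (N : ℕ) (a : Matrix (Fin 2) (Fin 2) ℚ → ℂ) (α m γ : ℚ) : ℂ :=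
  open Classical in if symMat α m γ ∈ APlus N then a (symMat α m γ) else 0

variable {N k : ℕ} {F : Matrix (Fin 2) (Fin 2) ℂ → ℂ} {a : Matrix (Fin 2) (Fin 2) ℚ → ℂ}

lemma mem_of_coefExt_ne_zero {α m γ : ℚ} (h : coefExt N a α m γ ≠ 0) : symMat α m γ ∈ APlus N := by
  by_contra h'
  exact h (if_neg h')

lemma symMat_mem_APlus {α m γ : ℚ} (h : symMat α m γ ∈ APlus N) :
    ∃ x y z : ℤ, α = x ∧ m = y ∧ γ = z ∧ (N : ℤ) ∣ x ∧ 0 < x ∧ 0 < (symMat α m γ).det := by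
  obtain ⟨x, y, z, h1, h2, h3, h4⟩ := h
  obtain ⟨rfl, rfl, rfl⟩ := symMat_injective h1
  exact ⟨x, y, z, rfl, rfl, rfl, h2, h3, h4⟩

lemma hasSum_coefExt (ha : HasFourierExpansion N F a) {Z : Matrix (Fin 2) (Fin 2) ℂ}
    (hZ : Z ∈ siegelH2) :
    HasSum (fun x : ℚ × ℚ × ℚ => coefExt N a x.1 x.2.1 x.2.2 * qexp x.1 x.2.1 x.2.2 Z) (F Z) := by
  rw [← hasSum_APlus_iff (N := N) (fun α m γ h => mem_of_coefExt_ne_zero h) hZ]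
  refine (ha Z hZ).congr_fun fun S => ?_
  rw [coefExt, eq_symMat_of_mem_APlus S.2, if_pos S.2]

/-- For `U = [1, n; 0, 1]` the matrix `diag(U, ᵗU⁻¹)` lies in the paramodular group of every level.
-/
lemma slashQP_translate (hF : IsParamodularCuspForm N k F) (n : ℤ)
    {Z : Matrix (Fin 2) (Fin 2) ℂ} (hZ : Z ∈ siegelH2) :
    slashQP k F 0 0 0 !![1, (n : ℚ); 0, 1] Z = F Z := by
  have hinv : (!![1, (n : ℚ); 0, 1] : Matrix (Fin 2) (Fin 2) ℚ)⁻¹ = !![1, -(n : ℚ); 0, 1] := by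
    refine inv_eq_right_inv ?_
    ext i j
    fin_cases i <;> fin_cases j <;> simp [mul_apply, Fin.sum_univ_two]
  have h0 : (!![0, 0; 0, 0] : Matrix (Fin 2) (Fin 2) ℚ) = 0 := by
    ext i j
    fin_cases i <;> fin_cases j <;> rfl
  have hT : (!![1, (n : ℚ); 0, 1]⁻¹ : Matrix (Fin 2) (Fin 2) ℚ)ᵀ = !![1, 0; -(n : ℚ), 1] := by
    rw [hinv]
    ext i j
    fin_cases i <;> fin_cases j <;> rfl
  have hUT : (!![1, (n : ℚ); 0, 1] : Matrix (Fin 2) (Fin 2) ℚ)ᵀ = !![1, 0; (n : ℚ), 1] := by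
    ext i j
    fin_cases i <;> fin_cases j <;> rfl
  rw [slashQP, h0, fromBlocks_one, Matrix.one_mul]
  refine hF.invariant _ ⟨?_, !![1, n; 0, 1], 0, 0, !![1, 0; -n, 1], ?_⟩ Z hZ
  · rw [SymplecticGroup.mem_iff, J, fromBlocks_transpose, fromBlocks_multiply, fromBlocks_multiply,
      hT]
    have h1 : (!![1, (n : ℚ); 0, 1] : Matrix (Fin 2) (Fin 2) ℚ) * (!![1, 0; -(n : ℚ), 1])ᵀ = 1 := by
      ext i j
      fin_cases i <;> fin_cases j <;> simp [mul_apply, Fin.sum_univ_two]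
    have h2 : (!![1, 0; -(n : ℚ), 1] : Matrix (Fin 2) (Fin 2) ℚ) * (!![1, (n : ℚ); 0, 1])ᵀ = 1 := by
      rw [hUT]
      ext i j
      fin_cases i <;> fin_cases j <;> simp [mul_apply, Fin.sum_univ_two]
    simp only [Matrix.mul_zero, Matrix.zero_mul, Matrix.mul_one, Matrix.mul_neg, Matrix.neg_mul,
      add_zero, zero_add, h1, h2, transpose_zero, neg_zero]
  · rw [hT]
    congr 1 <;> ext i j <;> fin_cases i <;> fin_cases j <;> simp

/-- Slashing by `diag(U, ᵗU⁻¹)` fixes `F` and permutes its expansion by `S ↦ S[U]`; uniqueness of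
coefficients gives the invariance. -/
lemma isCoefFun_coefExt (hF : IsParamodularCuspForm N k F) (ha : HasFourierExpansion N F a) :
    IsCoefFun (coefExt N a) := by
  have hint : ∀ α m γ, coefExt N a α m γ ≠ 0 → ∃ x y z : ℤ, α = x ∧ m = y ∧ γ = z := by
    intro α m γ h
    obtain ⟨x, y, z, h1, h2, h3, -⟩ := symMat_mem_APlus (mem_of_coefExt_ne_zero h)
    exact ⟨x, y, z, h1, h2, h3⟩
  refine ⟨hint, fun α m γ n => ?_⟩
  have hQP : ∀ α m γ : ℚ, coefQP (coefExt N a) k α m γ 0 0 0 1 (n : ℚ) 1 =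
      coefExt N a α (m - 2 * α * n) (γ - m * n + α * n ^ 2) := by
    intro α m γ
    simp [coefQP, coefAt, e_zero]
  rw [← coef_eq_of_hasSum (c := fun α m γ => coefQP (coefExt N a) k α m γ 0 0 0 1 (n : ℚ) 1)
    (c' := coefExt N a) ?_ hint ?_ (fun Z hZ => hasSum_coefExt ha hZ), hQP]
  · congr 1 <;> ring
  · intro α m γ h
    rw [hQP] at h
    obtain ⟨x, y, z, h1, h2, h3⟩ := hint _ _ _ h
    refine ⟨x, y + 2 * x * n, z + (y + 2 * x * n) * n - x * n ^ 2, h1, ?_, ?_⟩ <;> push_cast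
    · linear_combination h2 + 2 * n * h1
    · linear_combination h3 + n * h2 + n ^ 2 * h1
  · intro Z hZ
    have := hasSum_slashQP (fun Z hZ => hasSum_coefExt ha hZ) k 0 0 0 (s := n) one_ne_zero
      one_ne_zero hZ
    rwa [slashQP_translate hF n hZ] at this

/-- Returns from the extension by zero to the given family. Positivity passes from `T` to `S` since
the determinant changes by a square and the upper left entry by `r⁻²`. -/
lemma coefAt_coefExt {r t : ℚ} (hr : r ≠ 0) (ht : t ≠ 0) (s : ℚ) {α m γ : ℚ}
    (hdet : 0 < (symMat α m γ).det) (hα : 0 < α) (x y z : ℤ) (hx : α / r ^ 2 = x)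
    (hy : m / (r * t) - 2 * α * s / (r ^ 2 * t) = y)
    (hz : γ / t ^ 2 - m * s / (r * t ^ 2) + α * s ^ 2 / (r ^ 2 * t ^ 2) = z) (hN : (N : ℤ) ∣ x) :
    coefAt (coefExt N a) r s t α m γ =
      a (subst (symMat α m γ) !![r⁻¹, -s / (r * t); 0, t⁻¹]) := by
  have h : symMat (α / r ^ 2) (m / (r * t) - 2 * α * s / (r ^ 2 * t))
      (γ / t ^ 2 - m * s / (r * t ^ 2) + α * s ^ 2 / (r ^ 2 * t ^ 2)) =
      subst (symMat α m γ) !![r⁻¹, -s / (r * t); 0, t⁻¹] := by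
    ext i j
    fin_cases i <;> fin_cases j <;>
      simp [symMat, subst, mul_apply, Fin.sum_univ_two] <;> field_simp <;> ring
  rw [coefAt, coefExt, if_pos, h]
  refine ⟨x, y, z, ?_, hN, ?_, ?_⟩
  · rw [hx, hy, hz]; rfl
  · have : (0 : ℚ) < x := by rw [← hx]; positivity
    exact_mod_cast this
  · rw [h, subst, det_mul, det_mul, det_transpose]
    have h1 : (!![r⁻¹, -s / (r * t); 0, t⁻¹] : Matrix (Fin 2) (Fin 2) ℚ).det ≠ 0 := by
      simp [det_fin_two, hr, ht]
    have := mul_pos hdet (sq_pos_of_ne_zero h1)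
    linarith

lemma coefAt_ne_zero_mem {r s t α m γ : ℚ} (hr : r ≠ 0) (ht : t ≠ 0)
    (h : coefAt (coefExt N a) r s t α m γ ≠ 0) :
    ∃ x : ℤ, α = r ^ 2 * x ∧ (N : ℤ) ∣ x ∧ 0 < x ∧ 0 < (symMat α m γ).det := by
  obtain ⟨x, y, z, hx, -, -, hN, hpos, hdet⟩ := symMat_mem_APlus (mem_of_coefExt_ne_zero h)
  refine ⟨x, by rw [← hx]; field_simp, hN, hpos, ?_⟩
  have h1 : (symMat α m γ).det = (r * t) ^ 2 * (symMat (α / r ^ 2)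
      (m / (r * t) - 2 * α * s / (r ^ 2 * t))
      (γ / t ^ 2 - m * s / (r * t ^ 2) + α * s ^ 2 / (r ^ 2 * t ^ 2))).det := by
    simp only [symMat, det_fin_two_of]; field_simp; ring
  rw [h1]
  have := mul_ne_zero hr ht
  positivity

variable (p : ℕ) [Fact p.Prime]

lemma twistSum_mul (Φ : ℚ → ℚ → ℚ → ℚ → ℚ → ℚ → ℂ) (x : ℂ) :
    twistSum p (fun q₁ q₂ q₃ r s t => Φ q₁ q₂ q₃ r s t * x) = twistSum p Φ * x := by
  simp only [twistSum, add_mul]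
  refine (congrArg₂ (· + ·)
    (congrArg₂ (· + ·) (congrArg₂ (· + ·) (congrArg₂ (· + ·)
    (congrArg₂ (· + ·) (congrArg₂ (· + ·) (congrArg₂ (· + ·)
    (congrArg₂ (· + ·) (congrArg₂ (· + ·) (congrArg₂ (· + ·)
    (congrArg₂ (· + ·) (congrArg₂ (· + ·) (congrArg₂ (· + ·) ?_ ?_) ?_) ?_) ?_) ?_) ?_) ?_) ?_) ?_) ?_) ?_) ?_) ?_)
  · simp only [twistSum1, Finset.sum_mul, mul_assoc]
  · simp only [twistSum2, Finset.sum_mul, mul_assoc]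
  · simp only [twistSum3, Finset.sum_mul, mul_assoc]
  · simp only [twistSum4, Finset.sum_mul, mul_assoc]
  · simp only [twistSum5, Finset.sum_mul, mul_assoc]
  · simp only [twistSum6, Finset.sum_mul, mul_assoc]
  · simp only [twistSum7, Finset.sum_mul, mul_assoc]
  · simp only [twistSum8, Finset.sum_mul, mul_assoc]
  · simp only [twistSum9, Finset.sum_mul, mul_assoc]
  · simp only [twistSum10, Finset.sum_mul, mul_assoc]
  · simp only [twistSum11, Finset.sum_mul, mul_assoc]
  · simp only [twistSum12, Finset.sum_mul, mul_assoc]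
  · simp only [twistSum13, Finset.sum_mul, mul_assoc]
  · simp only [twistSum14, Finset.sum_mul, mul_assoc]

lemma hasSum_twist (ha : HasFourierExpansion N F a) {Z : Matrix (Fin 2) (Fin 2) ℂ}
    (hZ : Z ∈ siegelH2) :
    HasSum (fun x : ℚ × ℚ × ℚ => twistSum p (coefQP (coefExt N a) k x.1 x.2.1 x.2.2) *
      qexp x.1 x.2.1 x.2.2 Z) (twist p k F Z) := by
  rw [twist_eq_twistSum]
  have hp : (p : ℚ) ≠ 0 := natCast_prime_ne_zero p ℚ
  refine (hasSum_twistSum p (Φ := fun (x : ℚ × ℚ × ℚ) q₁ q₂ q₃ r s t =>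
    coefQP (coefExt N a) k x.1 x.2.1 x.2.2 q₁ q₂ q₃ r s t * qexp x.1 x.2.1 x.2.2 Z)
    ?_).congr_fun fun x => ?_
  · rintro q₁ q₂ q₃ r s t ⟨i, rfl⟩ ht
    exact hasSum_slashQP (fun Z hZ => hasSum_coefExt ha hZ) k q₁ q₂ q₃ (pow_ne_zero i hp) ht hZ
  · rw [twistSum_mul]

variable {p}

lemma twistSum_ne_zero_support (hp : p ≠ 2) {A : ℚ → ℚ → ℚ → ℂ} (hA : IsCoefFun A) (k : ℕ)
    {α m γ : ℚ} (h : twistSum p (coefQP A k α m γ) ≠ 0) :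
    ∃ a b g : ℤ, α = p ^ 4 * a ∧ m = b ∧ γ = g := by
  have key : ∀ {j : ℕ} {c : ℚ → ℚ → ℚ → ℂ} {f : ℤ → ℤ → ℤ → ℂ}, IsTwistCoef p j c f →
      c α m γ ≠ 0 → ∃ a b g : ℤ, α = p ^ 4 * a ∧ m = b ∧ γ = g := by
    intro j c f hc hne
    obtain ⟨a, b, g, h1, h2, h3⟩ := hc.support α m γ hne
    exact ⟨a, p ^ j * b, g, h1, by rw [h2]; push_cast; rfl, h3⟩
  by_contra hcon
  have hz : ∀ {j : ℕ} {c : ℚ → ℚ → ℚ → ℂ} {f : ℤ → ℤ → ℤ → ℂ}, IsTwistCoef p j c f →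
      c α m γ = 0 := fun hc => not_ne_iff.1 (mt (key hc) hcon)
  refine h ?_
  rw [twistSum, hz (isTwistCoef1 hp hA k), hz (isTwistCoef2 hp hA k), hz (isTwistCoef3 hp hA k),
    hz (isTwistCoef4 hp hA k), hz (isTwistCoef5 hp hA k), hz (isTwistCoef6 hp hA k),
    hz (isTwistCoef7 hp hA k), hz (isTwistCoef8 hp hA k), hz (isTwistCoef9 hp hA k),
    hz (isTwistCoef10 hp hA k), hz (isTwistCoef11 hp hA k), hz (isTwistCoef12 hp hA k),
    hz (isTwistCoef13 hp hA k), hz (isTwistCoef14 hp hA k)]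
  simp only [add_zero]

/-- A nonzero coefficient of the twist requires some nonzero `a(S)` with `T = S[P]`. Then `α` is
`r²` times a multiple of `N`, with `r` a power of `p`; combined with `p⁴ ∣ α` and `p ∤ N` this gives
`N p⁴ ∣ α`. -/
lemma symMat_mem_APlus_of_twistSum_ne_zero (hp : p ≠ 2) (hpN : ¬ p ∣ N)
    (hA : IsCoefFun (coefExt N a)) (k : ℕ) {α m γ : ℚ}
    (h : twistSum p (coefQP (coefExt N a) k α m γ) ≠ 0) : symMat α m γ ∈ APlus (N * p ^ 4) := by
  have hq : (p : ℚ) ≠ 0 := natCast_prime_ne_zero p ℚ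
  obtain ⟨x, b, g, rfl, rfl, rfl⟩ := twistSum_ne_zero_support hp hA k h
  have hex : ∃ (i : ℕ) (s t : ℚ), t ≠ 0 ∧ coefAt (coefExt N a) (p ^ i) s t (p ^ 4 * x) b g ≠ 0 := by
    by_contra hcon
    push Not at hcon
    refine h (twistSum_eq_zero p ?_)
    rintro q₁ q₂ q₃ r s t ⟨i, rfl⟩ ht
    rw [coefQP, hcon i s t ht, zero_mul, mul_zero]
  obtain ⟨i, s, t, ht, hne⟩ := hex
  obtain ⟨y, hy, hN, hpos, hdet⟩ := coefAt_ne_zero_mem (pow_ne_zero i hq) ht hne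
  have hy' : (p : ℤ) ^ 4 * x = ((p : ℤ) ^ i) ^ 2 * y := by exact_mod_cast hy
  have hpp : (0 : ℤ) < p := by exact_mod_cast (Fact.out : p.Prime).pos
  refine ⟨p ^ 4 * x, b, g, ?_, ?_, ?_, hdet⟩
  · rw [symMat, halfMat]; push_cast; rfl
  · have hcop : IsCoprime (N : ℤ) ((p : ℤ) ^ 4) := by
      refine IsCoprime.pow_right (Nat.isCoprime_iff_coprime.2 ?_)
      exact (Nat.coprime_comm.1 ((Nat.Prime.coprime_iff_not_dvd Fact.out).2 hpN))
    push_cast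
    refine hcop.mul_dvd ?_ (dvd_mul_right _ _)
    rw [hy']
    exact hN.mul_left _
  · rw [hy']; positivity

end

/-! ### Assembling the operators according to the power of `p` dividing `m` -/

section

variable {p : ℕ} [Fact p.Prime] {A : ℚ → ℚ → ℚ → ℂ}

lemma IsTwistCoef.eq_zero {j : ℕ} {c : ℚ → ℚ → ℚ → ℂ} {f : ℤ → ℤ → ℤ → ℂ}
    (h : IsTwistCoef p j c f) {m : ℤ} (hm : ¬ (p : ℤ) ^ j ∣ m) (α γ : ℚ) : c α m γ = 0 := by
  by_contra hne
  obtain ⟨a, b, g, -, hb, -⟩ := h.support _ _ _ hne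
  exact hm ⟨b, by exact_mod_cast hb⟩

/-- Applies a formula established for `pʲ ∣ m` when `m` is divisible by a higher power. -/
lemma IsTwistCoef.eval_mul {j i : ℕ} {c : ℚ → ℚ → ℚ → ℂ} {f : ℤ → ℤ → ℤ → ℂ}
    (h : IsTwistCoef p j c f) (a b g : ℤ) :
    c (p ^ 4 * a) (p ^ (j + i) * b) g = gaussW p * f a (p ^ i * b) g := by
  rw [← h.eval]
  congr 1
  push_cast
  ring

lemma χ_intCast_mul_prime (b : ℤ) : χ p ((p * b : ℤ) : ZMod p) = 0 := by
  rw [(intCast_zmod_eq_zero_iff _).2 (dvd_mul_right _ _), MulChar.map_zero]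

/-- The Fourier coefficient of the twist when `p ∤ m`. -/
lemma twistSum_coefQP_of_not_dvd (hp : p ≠ 2) (hA : IsCoefFun A) (k : ℕ) (a g : ℤ) {m : ℤ}
    (hm : ¬ (p : ℤ) ∣ m) :
    twistSum p (coefQP A k (p ^ 4 * a) m g) = gaussW p * ((p : ℂ) ^ (1 - (k : ℤ)) * χ p m *
      ∑ x : (ZMod p)ˣ, χ p x * coefAt A 1 (rep x.1 / p ^ 2) ((p : ℚ)⁻¹) (p ^ 4 * a) m g) := by
  have h1 : ¬ (p : ℤ) ^ 1 ∣ m := by rwa [pow_one]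
  have h2 : ¬ (p : ℤ) ^ 2 ∣ m := fun h => hm ((dvd_pow_self _ two_ne_zero).trans h)
  have h11 := (isTwistCoef11 hp hA k).eval a m g
  simp only [pow_zero, one_mul] at h11
  rw [← h11, twistSum]
  have e1 := (isTwistCoef1 hp hA k).eq_zero h1 (p ^ 4 * a) g
  have e2 := (isTwistCoef2 hp hA k).eq_zero h2 (p ^ 4 * a) g
  have e3 := (isTwistCoef3 hp hA k).eq_zero h2 (p ^ 4 * a) g
  have e4 := (isTwistCoef4 hp hA k).eq_zero h1 (p ^ 4 * a) g
  have e5 := (isTwistCoef5 hp hA k).eq_zero h2 (p ^ 4 * a) g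
  have e6 := (isTwistCoef6 hp hA k).eq_zero h2 (p ^ 4 * a) g
  have e7 := (isTwistCoef7 hp hA k).eq_zero h1 (p ^ 4 * a) g
  have e8 := (isTwistCoef8 hp hA k).eq_zero h2 (p ^ 4 * a) g
  have e9 := (isTwistCoef9 hp hA k).eq_zero h2 (p ^ 4 * a) g
  have e10 := (isTwistCoef10 hp hA k).eq_zero h2 (p ^ 4 * a) g
  have e12 := (isTwistCoef12 hp hA k).eq_zero h1 (p ^ 4 * a) g
  have e13 := (isTwistCoef13 hp hA k).eq_zero h2 (p ^ 4 * a) g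
  have e14 := (isTwistCoef14 hp hA k).eq_zero h1 (p ^ 4 * a) g
  rw [e1, e2, e3, e4, e5, e6, e7, e8, e9, e10, e12, e13, e14]
  simp only [add_zero, zero_add]

/-- The Fourier coefficient of the twist when `p ∥ m`. -/
lemma twistSum_coefQP_of_dvd_of_not_sq_dvd (hp : p ≠ 2) (hA : IsCoefFun A) (k : ℕ) (a g : ℤ)
    {b : ℤ} (hb : ¬ (p : ℤ) ∣ b) {y : ℤ} (hy : y * b ≡ -g [ZMOD (p : ℤ) ^ 2]) :
    twistSum p (coefQP A k (p ^ 4 * a) (p * b) g) = gaussW p * (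
      (p : ℂ)⁻¹ * (∑ x : (ZMod p)ˣ, ∑ y : (ZMod p)ˣ, χ p (x * y * (b * x - g)) *
        coefAt A 1 ((rep x.1 + rep y.1) / p) 1 (p ^ 4 * a) (p * b) g) +
      (p : ℂ)⁻¹ * (∑ x : (ZMod p)ˣ, ∑ z : (ZMod p)ˣ with z ≠ 1,
        χ p (x * z * (1 - z) * (x * z * a - b)) *
        coefAt A p (rep x.1 / p ^ 2) ((p : ℚ)⁻¹) (p ^ 4 * a) (p * b) g) -
      (p : ℂ)⁻¹ * χ p a * coefAt A (p ^ 2) 0 (((p : ℚ) ^ 2)⁻¹) (p ^ 4 * a) (p * b) g +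
      (p : ℂ) ^ ((k : ℤ) - 2) * χ p (-a : ℤ) * (∑ x : (ZMod (p ^ 2))ˣ,
        coefAt A p (rep x.1 / p ^ 2) 1 (p ^ 4 * a) (p * b) g) +
      (p : ℂ) ^ ((k : ℤ) - 2) * χ p (-g) *
        coefAt A 1 (-y / p) p (p ^ 4 * a) (p * b) g) := by
  have hpz : (p : ℤ) ≠ 0 := natCast_prime_ne_zero p ℤ
  have h2 : ¬ (p : ℤ) ^ 2 ∣ (p * b : ℤ) := by
    rwa [sq, mul_dvd_mul_iff_left hpz]
  have hcast : ((p * b : ℤ) : ℚ) = (p : ℚ) * b := by push_cast; rfl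
  have e2 := (isTwistCoef2 hp hA k).eq_zero h2 (p ^ 4 * a) g
  have e3 := (isTwistCoef3 hp hA k).eq_zero h2 (p ^ 4 * a) g
  have e5 := (isTwistCoef5 hp hA k).eq_zero h2 (p ^ 4 * a) g
  have e6 := (isTwistCoef6 hp hA k).eq_zero h2 (p ^ 4 * a) g
  have e8 := (isTwistCoef8 hp hA k).eq_zero h2 (p ^ 4 * a) g
  have e9 := (isTwistCoef9 hp hA k).eq_zero h2 (p ^ 4 * a) g
  have e10 := (isTwistCoef10 hp hA k).eq_zero h2 (p ^ 4 * a) g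
  have e13 := (isTwistCoef13 hp hA k).eq_zero h2 (p ^ 4 * a) g
  have e1 := (isTwistCoef1 hp hA k).eval a b g
  have e4 := (isTwistCoef4 hp hA k).eval a b g
  have e7 := (isTwistCoef7 hp hA k).eval a b g
  have e11 := (isTwistCoef11 hp hA k).eval_mul (i := 1) a b g
  have e12 := (isTwistCoef12 hp hA k).eval a b g
  have e14 := (isTwistCoef14 hp hA k).eval a b g
  have hram : ramanujan p b = -1 :=
    ramanujan_of_ne_zero (mt (intCast_zmod_eq_zero_iff b).1 hb)
  rw [hcast] at e2 e3 e5 e6 e8 e9 e10 e13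
  -- Operator 11 disappears here, carrying the factor `χ(p b) = 0`.
  simp only [zero_add, pow_one, χ_intCast_mul_prime, mul_zero, zero_mul] at e1 e4 e7 e11 e12 e14
  rw [twistSum, e1, e2, e3, e4, e5, e6, e7, e8, e9, e10, e11, e12, e13, e14, hram]
  have h7 := sum_chi_coefAt_one_self hA (a := a) hb hy
  rw [pow_one] at h7
  rw [mul_assoc _ (χ p b), h7]
  simp only [Finset.sum_mul]
  ring

/-- The Fourier coefficient of the twist when `p² ∣ m`. -/
lemma twistSum_coefQP_of_sq_dvd (hp : p ≠ 2) (hA : IsCoefFun A) (k : ℕ) (a b g : ℤ) :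
    twistSum p (coefQP A k (p ^ 4 * a) (p ^ 2 * b) g) = gaussW p * (
      ((1 - (p : ℂ)⁻¹) * χ p g * coefAt A 1 0 1 (p ^ 4 * a) (p ^ 2 * b) g -
      (p : ℂ)⁻¹ * χ p g * (∑ x : (ZMod p)ˣ, coefAt A 1 (rep x.1 / p) 1 (p ^ 4 * a) (p ^ 2 * b) g) +
      (p : ℂ) ^ ((k : ℤ) - 3) * (∑ u : (ZMod p)ˣ, (∑ x : (ZMod p)ˣ with x ≠ 1,
        ∑ y : (ZMod p)ˣ with y ≠ 1,
          χ p (y * (1 - x) * (a * ((y - x) / (1 - y)) * (u : ZMod p) ^ 2 + b * u -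
            g * (x : ZMod p)⁻¹))) * coefAt A p (rep u.1 / p) 1 (p ^ 4 * a) (p ^ 2 * b) g) +
      (p : ℂ) ^ ((k : ℤ) - 3) * (χ p g * (p * χ p (b ^ 2 - 4 * a * g) - ramanujan p a) -
        χ p (-a) * ramanujan p b) * coefAt A p 0 1 (p ^ 4 * a) (p ^ 2 * b) g +
      (p : ℂ) ^ ((k : ℤ) - 3) * χ p (-a) * (∑ x : ZMod p, ramanujan p (b - x * a) *
        coefAt A p (rep x / p) 1 (p ^ 4 * a) (p ^ 2 * b) g) +
      (p : ℂ) ^ (2 * (k : ℤ) - 4) * (∑ x ∈ Finset.univ.filter (fun x : (ZMod (p ^ 2))ˣ =>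
          (a : ZMod (p ^ 2)) * (x : ZMod (p ^ 2)) ^ 2 - (b : ZMod (p ^ 2)) * (x : ZMod (p ^ 2)) +
            g = 0),
        ∑ z : (ZMod p)ˣ with z ≠ 1, χ p (z * (1 - z) * (g - z * a * red p x.1 ^ 2)) *
        coefAt A p (rep x.1 / p) p (p ^ 4 * a) (p ^ 2 * b) g) -
      (p : ℂ)⁻¹ * χ p a * (∑ x : (ZMod p)ˣ,
        coefAt A p (rep x.1 / p ^ 2) ((p : ℚ)⁻¹) (p ^ 4 * a) (p ^ 2 * b) g) +
      (p : ℂ) ^ ((k : ℤ) - 3) * χ p a * (p * χ p (b ^ 2 - 4 * a * g) - ramanujan p g) *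
        coefAt A (p ^ 2) 0 ((p : ℚ)⁻¹) (p ^ 4 * a) (p ^ 2 * b) g +
      (1 - (p : ℂ)⁻¹) * χ p a * coefAt A (p ^ 2) 0 (((p : ℚ) ^ 2)⁻¹) (p ^ 4 * a) (p ^ 2 * b) g) +
      (p : ℂ) ^ (2 * (k : ℤ) - 4) * (χ p a * if ¬ (p : ℤ) ∣ b ∧ (p : ℤ) ∣ 4 * a * g - b ^ 2 then
        ramanujan p (((4 * a * g - b ^ 2) / p : ℤ)) else 0) *
        coefAt A (p ^ 2) 0 1 (p ^ 4 * a) (p ^ 2 * b) g +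
      ((p : ℂ) ^ (3 * (k : ℤ) - 5) * (χ p a * χ p (-((4 * a * g - b ^ 2) / p ^ 2) : ℤ)) *
        (∑ x : (ZMod p)ˣ, coefAt A (p ^ 2) (rep x.1) p (p ^ 4 * a) (p ^ 2 * b) g) +
      (p : ℂ) ^ (4 * (k : ℤ) - 6) * χ p a *
        (∑ x : (ZMod (p ^ 2))ˣ, coefAt A (p ^ 2) (rep x.1) (p ^ 2) (p ^ 4 * a) (p ^ 2 * b) g))) := by
  have hc : (p : ℂ) ≠ 0 := natCast_prime_ne_zero p ℂ
  have e1 := (isTwistCoef1 hp hA k).eval_mul (i := 1) a b g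
  have e2 := (isTwistCoef2 hp hA k).eval a b g
  have e3 := (isTwistCoef3 hp hA k).eval a b g
  have e4 := (isTwistCoef4 hp hA k).eval_mul (i := 1) a b g
  have e5 := (isTwistCoef5 hp hA k).eval a b g
  have e6 := (isTwistCoef6 hp hA k).eval a b g
  have e7 := (isTwistCoef7 hp hA k).eval_mul (i := 1) a b g
  have e8 := (isTwistCoef8 hp hA k).eval a b g
  have e9 := (isTwistCoef9 hp hA k).eval a b g
  have e10 := (isTwistCoef10 hp hA k).eval a b g
  have e11 := (isTwistCoef11 hp hA k).eval_mul (i := 2) a b g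
  have e12 := (isTwistCoef12 hp hA k).eval_mul (i := 1) a b g
  have e13 := (isTwistCoef13 hp hA k).eval a b g
  have e14 := (isTwistCoef14 hp hA k).eval_mul (i := 1) a b g
  have hcast1 : (p : ℚ) ^ 1 * ((p ^ 1 * b : ℤ) : ℚ) = p ^ 2 * b := by push_cast; ring
  have hcast2 : (p : ℚ) ^ 0 * ((p ^ 2 * b : ℤ) : ℚ) = p ^ 2 * b := by push_cast; ring
  have hcast3 : ((p ^ 1 * b : ℤ) : ZMod p) = 0 := by push_cast; simp
  have hcast4 : ((p ^ 2 * b : ℤ) : ZMod p) = 0 := by push_cast; simp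
  have e1' := sum_sum_χ_coefAt_one hp hA b g (p ^ 4 * a) (p ^ 2 * b) g
  have h0 : ((p * b : ℤ) : ZMod p) = 0 := (intCast_zmod_eq_zero_iff _).2 (dvd_mul_right _ _)
  simp only [h0, zero_mul] at e1'
  -- Operator 4 contributes nothing: either `χ(-a) = 0`, or `a u ≡ p b` modulo `p²` has no unit
  -- solution `u`.
  have e4' : χ p (-a : ℤ) * ∑ u : (ZMod (p ^ 2))ˣ,
      coefAt A p (rep u.1 / p ^ 2) 1 (p ^ 4 * a) (p ^ 2 * b) g = 0 := by
    by_cases ha : (p : ℤ) ∣ a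
    · rw [(intCast_zmod_eq_zero_iff _).2 ((dvd_neg (a := (p : ℤ))).2 ha), MulChar.map_zero, zero_mul]
    · have := sum_coefAt_self_one_eq_zero hA b g ha
      rw [show (p : ℚ) ^ 1 * ((p * b : ℤ) : ℚ) = p ^ 2 * b by push_cast; ring] at this
      rw [this, mul_zero]
  -- With the linear term gone, the argument is `a (1 - z)` times the square of `x z`, and `∑ χ(1 -
  -- z) = -1`.
  have e12' : ∀ x : (ZMod p)ˣ, ∑ z : (ZMod p)ˣ with z ≠ 1,
      χ p (x * z * (1 - z) * (x * z * a - (0 : ZMod p))) = -χ p a := by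
    intro x
    have h2 : ∀ z : (ZMod p)ˣ, χ p (x * z * (1 - z) * (x * z * a - (0 : ZMod p))) =
        χ p a * χ p (1 - z) := by
      intro z
      rw [← map_mul]
      refine Eq.trans ?_ (χ_mul_sq _ (mul_ne_zero x.ne_zero z.ne_zero))
      congr 1
      ring
    rw [Finset.sum_congr rfl fun z _ => h2 z, ← Finset.mul_sum, sum_units_ne_one_χ_one_sub hp]
    ring
  -- Multiples of `p` inside `χ` remove operators 7 and 11, and the Ramanujan sum of operator 14
  -- becomes `p - 1`.
  simp only [Nat.reduceAdd, hcast1, hcast2, hcast3, hcast4, MulChar.map_zero, mul_zero, zero_mul,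
    ramanujan_zero, e12'] at e1 e4 e7 e11 e12 e14
  rw [twistSum, e1, e2, e3, e4, e5, e6, e7, e8, e9, e10, e11, e12, e13, e14,
    sum_sum_χ_quadratic hp, sum_χ_coefAt_self_self hA, mul_assoc _ (χ p (-a : ℤ)), e4', e1']
  rw [Int.cast_neg]
  simp only [neg_mul, Finset.sum_neg_distrib, ← Finset.mul_sum]
  have hp1 : (p : ℂ)⁻¹ * ((p : ℂ) - 1) = 1 - (p : ℂ)⁻¹ := by field_simp
  linear_combination (gaussW p * χ p g * coefAt A 1 0 1 (p ^ 4 * a) (p ^ 2 * b) g +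
    gaussW p * χ p a * coefAt A (p ^ 2) 0 (((p : ℚ) ^ 2)⁻¹) (p ^ 4 * a) (p ^ 2 * b) g) * hp1

end

/-! ### Integrality of `T[P⁻¹]` for the matrices `P` that occur -/

section

variable {p : ℕ} [Fact p.Prime] {N : ℕ} {f : Matrix (Fin 2) (Fin 2) ℚ → ℂ} {a b g : ℤ}

/-- For `r = pⁱ` with `i ≤ 2`, the upper left entry `α / r² = p^(4 - 2i) a` inherits divisibility by
`N`, so only the other two entries of `S` need a check for each `P`. -/
lemma coefAt_coefExt_of_integral (hN : (N : ℤ) ∣ a) (ha : 0 < a) {m : ℚ}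
    (hdet : 0 < (symMat (p ^ 4 * a) m g).det) {i : ℕ} (hi : i ≤ 2) {r t : ℚ} (hr : r = p ^ i)
    (ht : t ≠ 0) (s : ℚ) {P : Matrix (Fin 2) (Fin 2) ℚ} (y z : ℤ)
    (hy : m / (r * t) - 2 * (p ^ 4 * a) * s / (r ^ 2 * t) = y)
    (hz : g / t ^ 2 - m * s / (r * t ^ 2) + p ^ 4 * a * s ^ 2 / (r ^ 2 * t ^ 2) = z)
    (hP : P = !![r⁻¹, -s / (r * t); 0, t⁻¹]) :
    coefAt (coefExt N f) r s t (p ^ 4 * a) m g = f (subst (symMat (p ^ 4 * a) m g) P) := by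
  have hq : (p : ℚ) ≠ 0 := natCast_prime_ne_zero p ℚ
  have hp0 : (0 : ℚ) < p := by exact_mod_cast (Fact.out : p.Prime).pos
  have ha' : (0 : ℚ) < a := by exact_mod_cast ha
  have hr0 : r ≠ 0 := hr ▸ pow_ne_zero i hq
  rw [hP]
  refine coefAt_coefExt hr0 ht s hdet (by positivity) (p ^ (4 - 2 * i) * a) y z ?_
    hy hz (hN.mul_left _)
  push_cast
  have : (p : ℚ) ^ 4 = p ^ (4 - 2 * i) * r ^ 2 := by
    rw [hr, ← pow_mul, ← pow_add]; congr 1; omega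
  rw [this]
  field_simp

lemma coefAt_coefExt_one_inv (hN : (N : ℤ) ∣ a) (ha : 0 < a) {m : ℚ} (hm : m = b)
    (hdet : 0 < (symMat (p ^ 4 * a) m g).det) {n : ℕ} (u : ZMod n) :
    coefAt (coefExt N f) 1 (rep u / p ^ 2) (p : ℚ)⁻¹ (p ^ 4 * a) m g =
      f (subst (symMat (p ^ 4 * a) m g) !![1, -rep u / p; 0, (p : ℚ)]) := by
  have hq : (p : ℚ) ≠ 0 := natCast_prime_ne_zero p ℚ
  simp only [rep_eq_intCast]
  refine coefAt_coefExt_of_integral hN ha hdet (i := 0) (by norm_num) (by simp) (inv_ne_zero hq) _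
    (b * p - 2 * p ^ 3 * a * u.val)
    (g * p ^ 2 - b * u.val + a * p ^ 2 * u.val ^ 2) ?_ ?_ ?_
  · rw [hm]; push_cast; field_simp
  · rw [hm]; push_cast; field_simp
  · simp; field_simp

lemma coefAt_coefExt_one_add_one (hN : (N : ℤ) ∣ a) (ha : 0 < a) {m : ℚ} (hm : m = p * b)
    (hdet : 0 < (symMat (p ^ 4 * a) m g).det) {n : ℕ} (u v : ZMod n) :
    coefAt (coefExt N f) 1 ((rep u + rep v) / p) 1 (p ^ 4 * a) m g =
      f (subst (symMat (p ^ 4 * a) m g) !![1, -(rep u + rep v) / p; 0, 1]) := by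
  have hq : (p : ℚ) ≠ 0 := natCast_prime_ne_zero p ℚ
  simp only [rep_eq_intCast]
  refine coefAt_coefExt_of_integral hN ha hdet (i := 0) (by norm_num) (by simp) one_ne_zero _
    (p * b - 2 * p ^ 3 * a * (u.val + v.val))
    (g - b * (u.val + v.val) + a * p ^ 2 * (u.val + v.val) ^ 2) ?_ ?_ ?_
  · rw [hm]; push_cast; field_simp
  · rw [hm]; push_cast; field_simp
  · simp; ring

lemma coefAt_coefExt_one_one (hN : (N : ℤ) ∣ a) (ha : 0 < a) {m : ℚ} (hm : m = p * b)
    (hdet : 0 < (symMat (p ^ 4 * a) m g).det) {n : ℕ} (u : ZMod n) :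
    coefAt (coefExt N f) 1 (rep u / p) 1 (p ^ 4 * a) m g =
      f (subst (symMat (p ^ 4 * a) m g) !![1, -rep u / p; 0, 1]) := by
  have hq : (p : ℚ) ≠ 0 := natCast_prime_ne_zero p ℚ
  simp only [rep_eq_intCast]
  refine coefAt_coefExt_of_integral hN ha hdet (i := 0) (by norm_num) (by simp) one_ne_zero _
    (p * b - 2 * p ^ 3 * a * u.val)
    (g - b * u.val + a * p ^ 2 * u.val ^ 2) ?_ ?_ ?_
  · rw [hm]; push_cast; field_simp
  · rw [hm]; push_cast; field_simp
  · simp; field_simp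

lemma coefAt_coefExt_self_inv (hN : (N : ℤ) ∣ a) (ha : 0 < a) {m : ℚ} (hm : m = p * b)
    (hdet : 0 < (symMat (p ^ 4 * a) m g).det) {n : ℕ} (u : ZMod n) :
    coefAt (coefExt N f) p (rep u / p ^ 2) (p : ℚ)⁻¹ (p ^ 4 * a) m g =
      f (subst (symMat (p ^ 4 * a) m g) !![(p : ℚ)⁻¹, -rep u / p ^ 2; 0, (p : ℚ)]) := by
  have hq : (p : ℚ) ≠ 0 := natCast_prime_ne_zero p ℚ
  simp only [rep_eq_intCast]
  refine coefAt_coefExt_of_integral hN ha hdet (i := 1) (by norm_num) (by simp) (inv_ne_zero hq) _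
    (p * b - 2 * p * a * u.val)
    (g * p ^ 2 - b * u.val + a * u.val ^ 2) ?_ ?_ ?_
  · rw [hm]; push_cast; field_simp
  · rw [hm]; push_cast; field_simp
  · simp; field_simp

lemma coefAt_coefExt_sq_inv_sq (hN : (N : ℤ) ∣ a) (ha : 0 < a) {m : ℚ} (hm : m = b)
    (hdet : 0 < (symMat (p ^ 4 * a) m g).det) :
    coefAt (coefExt N f) (p ^ 2) 0 ((p : ℚ) ^ 2)⁻¹ (p ^ 4 * a) m g =
      f (subst (symMat (p ^ 4 * a) m g) !![((p : ℚ) ^ 2)⁻¹, 0; 0, (p : ℚ) ^ 2]) := by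
  have hq : (p : ℚ) ≠ 0 := natCast_prime_ne_zero p ℚ
  refine coefAt_coefExt_of_integral hN ha hdet (i := 2) (by norm_num) (by simp) (inv_ne_zero (pow_ne_zero 2 hq)) _
    (b)
    (g * p ^ 4) ?_ ?_ ?_
  · rw [hm]; field_simp; ring
  · rw [hm]; push_cast; field_simp; ring
  · simp

lemma coefAt_coefExt_sq_inv (hN : (N : ℤ) ∣ a) (ha : 0 < a) {m : ℚ} (hm : m = p * b)
    (hdet : 0 < (symMat (p ^ 4 * a) m g).det) :
    coefAt (coefExt N f) (p ^ 2) 0 (p : ℚ)⁻¹ (p ^ 4 * a) m g =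
      f (subst (symMat (p ^ 4 * a) m g) !![((p : ℚ) ^ 2)⁻¹, 0; 0, (p : ℚ)]) := by
  have hq : (p : ℚ) ≠ 0 := natCast_prime_ne_zero p ℚ
  refine coefAt_coefExt_of_integral hN ha hdet (i := 2) (by norm_num) (by simp) (inv_ne_zero hq) _
    (b)
    (g * p ^ 2) ?_ ?_ ?_
  · rw [hm]; field_simp; ring
  · rw [hm]; push_cast; field_simp; ring
  · simp

lemma coefAt_coefExt_sq_one (hN : (N : ℤ) ∣ a) (ha : 0 < a) {m : ℚ} (hm : m = p ^ 2 * b)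
    (hdet : 0 < (symMat (p ^ 4 * a) m g).det) :
    coefAt (coefExt N f) (p ^ 2) 0 1 (p ^ 4 * a) m g =
      f (subst (symMat (p ^ 4 * a) m g) !![((p : ℚ) ^ 2)⁻¹, 0; 0, 1]) := by
  have hq : (p : ℚ) ≠ 0 := natCast_prime_ne_zero p ℚ
  refine coefAt_coefExt_of_integral hN ha hdet (i := 2) (by norm_num) (by simp) one_ne_zero _
    (b)
    (g) ?_ ?_ ?_
  · rw [hm]; field_simp; ring
  · rw [hm]; field_simp; ring
  · simp

lemma coefAt_coefExt_self_one_zero (hN : (N : ℤ) ∣ a) (ha : 0 < a) {m : ℚ} (hm : m = p * b)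
    (hdet : 0 < (symMat (p ^ 4 * a) m g).det) :
    coefAt (coefExt N f) p 0 1 (p ^ 4 * a) m g =
      f (subst (symMat (p ^ 4 * a) m g) !![(p : ℚ)⁻¹, 0; 0, 1]) := by
  have hq : (p : ℚ) ≠ 0 := natCast_prime_ne_zero p ℚ
  refine coefAt_coefExt_of_integral hN ha hdet (i := 1) (by norm_num) (by simp) one_ne_zero _
    (b)
    (g) ?_ ?_ ?_
  · rw [hm]; field_simp; ring
  · rw [hm]; field_simp; ring
  · simp

lemma coefAt_coefExt_self_one (hN : (N : ℤ) ∣ a) (ha : 0 < a) {m : ℚ} (hm : m = p ^ 2 * b)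
    (hdet : 0 < (symMat (p ^ 4 * a) m g).det) {n : ℕ} (u : ZMod n) :
    coefAt (coefExt N f) p (rep u / p) 1 (p ^ 4 * a) m g =
      f (subst (symMat (p ^ 4 * a) m g) !![(p : ℚ)⁻¹, -rep u / p ^ 2; 0, 1]) := by
  have hq : (p : ℚ) ≠ 0 := natCast_prime_ne_zero p ℚ
  simp only [rep_eq_intCast]
  refine coefAt_coefExt_of_integral hN ha hdet (i := 1) (by norm_num) (by simp) one_ne_zero _
    (p * b - 2 * p * a * u.val)
    (g - b * u.val + a * u.val ^ 2) ?_ ?_ ?_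
  · rw [hm]; push_cast; field_simp
  · rw [hm]; push_cast; field_simp
  · simp; field_simp

lemma coefAt_coefExt_self_one_of_modEq (hN : (N : ℤ) ∣ a) (ha : 0 < a) {m : ℚ} (hm : m = p * b)
    (hdet : 0 < (symMat (p ^ 4 * a) m g).det) {x : ℤ} (hx : x * a ≡ b [ZMOD (p : ℤ) ^ 2]) :
    coefAt (coefExt N f) p (x / p ^ 2) 1 (p ^ 4 * a) m g =
      f (subst (symMat (p ^ 4 * a) m g) !![(p : ℚ)⁻¹, -(x : ℚ) / p ^ 3; 0, 1]) := by
  have hq : (p : ℚ) ≠ 0 := natCast_prime_ne_zero p ℚ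
  obtain ⟨w, hw⟩ := hx.dvd
  have hw' : (b : ℚ) - x * a = p ^ 2 * w := by exact_mod_cast hw
  refine coefAt_coefExt_of_integral hN ha hdet (i := 1) (by norm_num) (by simp) one_ne_zero _
    (b - 2 * a * x)
    (g - x * w) ?_ ?_ ?_
  · rw [hm]; push_cast; field_simp
  · rw [hm]; push_cast; field_simp; linear_combination -x * hw'
  · simp; field_simp

lemma coefAt_coefExt_one_self_of_modEq (hN : (N : ℤ) ∣ a) (ha : 0 < a) {m : ℚ} (hm : m = p * b)
    (hdet : 0 < (symMat (p ^ 4 * a) m g).det) {y : ℤ} (hy : y * b ≡ -g [ZMOD (p : ℤ) ^ 2]) :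
    coefAt (coefExt N f) 1 (-y / p) p (p ^ 4 * a) m g =
      f (subst (symMat (p ^ 4 * a) m g) !![1, (y : ℚ) / p ^ 2; 0, (p : ℚ)⁻¹]) := by
  have hq : (p : ℚ) ≠ 0 := natCast_prime_ne_zero p ℚ
  obtain ⟨w, hw⟩ := hy.dvd
  have hw' : -(g : ℚ) - y * b = p ^ 2 * w := by exact_mod_cast hw
  refine coefAt_coefExt_of_integral hN ha hdet (i := 0) (by norm_num) (by simp) hq _
    (b + 2 * p ^ 2 * a * y)
    (-w + a * y ^ 2) ?_ ?_ ?_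
  · rw [hm]; push_cast; field_simp; ring
  · rw [hm]; push_cast; field_simp; linear_combination -hw'
  · simp; field_simp

lemma coefAt_coefExt_self_self (hN : (N : ℤ) ∣ a) (ha : 0 < a) {m : ℚ} (hm : m = p ^ 2 * b)
    (hdet : 0 < (symMat (p ^ 4 * a) m g).det) {n : ℕ} (u : ZMod n)
    (hu : (p : ℤ) ^ 2 ∣ a * u.val ^ 2 - b * u.val + g) :
    coefAt (coefExt N f) p (rep u / p) p (p ^ 4 * a) m g =
      f (subst (symMat (p ^ 4 * a) m g) !![(p : ℚ)⁻¹, -rep u / p ^ 3; 0, (p : ℚ)⁻¹]) := by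
  have hq : (p : ℚ) ≠ 0 := natCast_prime_ne_zero p ℚ
  obtain ⟨w, hw⟩ := hu
  have hw' : (a : ℚ) * u.val ^ 2 - b * u.val + g = p ^ 2 * w := by exact_mod_cast hw
  simp only [rep_eq_intCast]
  refine coefAt_coefExt_of_integral hN ha hdet (i := 1) (by norm_num) (by simp) hq _
    (b - 2 * a * u.val)
    (w) ?_ ?_ ?_
  · rw [hm]; push_cast; field_simp
  · rw [hm]; push_cast; field_simp; linear_combination hw'
  · simp; field_simp

lemma coefAt_coefExt_sq_self (hN : (N : ℤ) ∣ a) (ha : 0 < a) {m : ℚ} (hm : m = p ^ 2 * b)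
    (hdet : 0 < (symMat (p ^ 4 * a) m g).det) {n : ℕ} (u : ZMod n)
    (hu : (p : ℤ) ∣ b - 2 * a * u.val) (hu' : (p : ℤ) ^ 2 ∣ a * u.val ^ 2 - b * u.val + g) :
    coefAt (coefExt N f) (p ^ 2) (rep u) p (p ^ 4 * a) m g =
      f (subst (symMat (p ^ 4 * a) m g) !![((p : ℚ) ^ 2)⁻¹, -rep u / p ^ 3; 0, (p : ℚ)⁻¹]) := by
  have hq : (p : ℚ) ≠ 0 := natCast_prime_ne_zero p ℚ
  obtain ⟨v, hv⟩ := hu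
  obtain ⟨w, hw⟩ := hu'
  have hv' : (b : ℚ) - 2 * a * u.val = p * v := by exact_mod_cast hv
  have hw' : (a : ℚ) * u.val ^ 2 - b * u.val + g = p ^ 2 * w := by exact_mod_cast hw
  simp only [rep_eq_intCast]
  refine coefAt_coefExt_of_integral hN ha hdet (i := 2) (by norm_num) (by simp) hq _
    (v)
    (w) ?_ ?_ ?_
  · rw [hm]; push_cast; field_simp; linear_combination hv'
  · rw [hm]; push_cast; field_simp; linear_combination hw'
  · simp; field_simp

lemma coefAt_coefExt_sq_sq (hN : (N : ℤ) ∣ a) (ha : 0 < a) {m : ℚ} (hm : m = p ^ 2 * b)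
    (hdet : 0 < (symMat (p ^ 4 * a) m g).det) {n : ℕ} (u : ZMod n)
    (hu : (p : ℤ) ^ 2 ∣ b - 2 * a * u.val) (hu' : (p : ℤ) ^ 4 ∣ a * u.val ^ 2 - b * u.val + g) :
    coefAt (coefExt N f) (p ^ 2) (rep u) (p ^ 2) (p ^ 4 * a) m g =
      f (subst (symMat (p ^ 4 * a) m g) !![((p : ℚ) ^ 2)⁻¹, -rep u / p ^ 4; 0, ((p : ℚ) ^ 2)⁻¹]) := by
  have hq : (p : ℚ) ≠ 0 := natCast_prime_ne_zero p ℚ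
  obtain ⟨v, hv⟩ := hu
  obtain ⟨w, hw⟩ := hu'
  have hv' : (b : ℚ) - 2 * a * u.val = p ^ 2 * v := by exact_mod_cast hv
  have hw' : (a : ℚ) * u.val ^ 2 - b * u.val + g = p ^ 4 * w := by exact_mod_cast hw
  simp only [rep_eq_intCast]
  refine coefAt_coefExt_of_integral hN ha hdet (i := 2) (by norm_num) (by simp) (pow_ne_zero 2 hq) _
    (v)
    (w) ?_ ?_ ?_
  · rw [hm]; push_cast; field_simp; linear_combination hv'
  · rw [hm]; push_cast; field_simp; linear_combination hw'
  · simp; field_simp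

lemma coefAt_coefExt_one_zero_one (hN : (N : ℤ) ∣ a) (ha : 0 < a) {m : ℚ} (hm : m = p * b)
    (hdet : 0 < (symMat (p ^ 4 * a) m g).det) :
    coefAt (coefExt N f) 1 0 1 (p ^ 4 * a) m g = f (symMat (p ^ 4 * a) m g) := by
  have := coefAt_coefExt_one_one (f := f) hN ha hm hdet (0 : ZMod p)
  simpa [rep, subst, ← Matrix.one_fin_two] using this

lemma coefAt_coefExt_self_self_of_eq (hN : (N : ℤ) ∣ a) (ha : 0 < a) {m : ℚ} (hm : m = p ^ 2 * b)
    (hdet : 0 < (symMat (p ^ 4 * a) m g).det) {u : (ZMod (p ^ 2))ˣ}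
    (hu : (a : ZMod (p ^ 2)) * (u : ZMod (p ^ 2)) ^ 2 - (b : ZMod (p ^ 2)) * (u : ZMod (p ^ 2)) +
      g = 0) :
    coefAt (coefExt N f) p (rep u.1 / p) p (p ^ 4 * a) m g =
      f (subst (symMat (p ^ 4 * a) m g) !![(p : ℚ)⁻¹, -rep u.1 / p ^ 3; 0, (p : ℚ)⁻¹]) := by
  refine coefAt_coefExt_self_self hN ha hm hdet u.1 ?_
  rw [← intCast_zmod_sq_eq_zero_iff]
  push_cast
  rwa [ZMod.natCast_zmod_val]

end

/-! ### The cases `p ∤ m` and `p ∥ m` -/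

section

variable {p : ℕ} [Fact p.Prime] {N k : ℕ} {f : Matrix (Fin 2) (Fin 2) ℚ → ℂ} {a b g : ℤ}

lemma halfMat_eq_symMat (α m γ : ℤ) : halfMat α m γ = symMat α m γ := rfl

lemma twistSum_coefExt_of_not_dvd (hp : p ≠ 2) (hA : IsCoefFun (coefExt N f)) (hN : (N : ℤ) ∣ a)
    (ha : 0 < a) {m : ℤ} (hdet : 0 < (halfMat (p ^ 4 * a) m g).det) (hm : ¬ (p : ℤ) ∣ m) :
    twistSum p (coefQP (coefExt N f) k ((p ^ 4 * a : ℤ) : ℚ) m g) =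
      gaussW p * ((p : ℂ) ^ (1 - (k : ℤ)) * χ p m * ∑ x : (ZMod p)ˣ, χ p x *
        f (subst (halfMat (p ^ 4 * a) m g) !![1, -rep x.1 / p; 0, (p : ℚ)])) := by
  rw [halfMat_eq_symMat] at hdet ⊢
  push_cast at hdet ⊢
  rw [twistSum_coefQP_of_not_dvd hp hA k a g hm]
  simp only [coefAt_coefExt_one_inv hN ha rfl hdet]

lemma twistSum_coefExt_of_dvd_of_not_sq_dvd_of_not_dvd (hp : p ≠ 2) (hA : IsCoefFun (coefExt N f))
    (hN : (N : ℤ) ∣ a) (ha : 0 < a) (hdet : 0 < (halfMat (p ^ 4 * a) (p * b) g).det)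
    (hb : ¬ (p : ℤ) ∣ b) (hpa : ¬ (p : ℤ) ∣ a) {x y : ℤ} (hx : x * a ≡ b [ZMOD (p : ℤ) ^ 2])
    (hy : y * b ≡ -g [ZMOD (p : ℤ) ^ 2]) :
    twistSum p (coefQP (coefExt N f) k ((p ^ 4 * a : ℤ) : ℚ) ((p * b : ℤ) : ℚ) g) = gaussW p * (
      (p : ℂ)⁻¹ * ∑ c : (ZMod p)ˣ, ∑ d : (ZMod p)ˣ, χ p (c * d * (b * c - g)) *
        f (subst (halfMat (p ^ 4 * a) (p * b) g) !![1, -(rep c.1 + rep d.1) / p; 0, 1]) +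
      (p : ℂ)⁻¹ * ∑ c : (ZMod p)ˣ, ∑ z : (ZMod p)ˣ with z ≠ 1,
        χ p (c * z * (1 - z) * (c * z * a - b)) *
        f (subst (halfMat (p ^ 4 * a) (p * b) g)
          !![(p : ℚ)⁻¹, -rep c.1 / p ^ 2; 0, (p : ℚ)]) -
      (p : ℂ)⁻¹ * χ p a * f (subst (halfMat (p ^ 4 * a) (p * b) g)
        !![((p : ℚ) ^ 2)⁻¹, 0; 0, (p : ℚ) ^ 2]) +
      (p : ℂ) ^ ((k : ℤ) - 2) * χ p (-a : ℤ) * f (subst (halfMat (p ^ 4 * a) (p * b) g)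
        !![(p : ℚ)⁻¹, -(x : ℚ) / p ^ 3; 0, 1]) +
      (p : ℂ) ^ ((k : ℤ) - 2) * χ p (-g) * f (subst (halfMat (p ^ 4 * a) (p * b) g)
        !![1, (y : ℚ) / p ^ 2; 0, (p : ℚ)⁻¹])) := by
  rw [halfMat_eq_symMat] at hdet ⊢
  have hm : ((p : ℚ) * b) = ((p * b : ℤ) : ℚ) := by push_cast; rfl
  have hsum := sum_coefAt_self_one hA g hpa hb hx
  rw [pow_one] at hsum
  push_cast at hdet ⊢
  rw [twistSum_coefQP_of_dvd_of_not_sq_dvd hp hA k a g hb hy, hsum,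
    coefAt_coefExt_sq_inv_sq hN ha hm hdet, coefAt_coefExt_self_one_of_modEq hN ha rfl hdet hx,
    coefAt_coefExt_one_self_of_modEq hN ha rfl hdet hy]
  simp only [coefAt_coefExt_one_add_one hN ha rfl hdet, coefAt_coefExt_self_inv hN ha rfl hdet,
    Int.cast_neg]

/-- When `p ∣ a` the last factor is the constant `-b`, and the sum of `χ(z (1 - z))` is `-χ(-1)`;
the two signs `χ(-1)` cancel. -/
lemma sum_χ_of_dvd (hp : p ≠ 2) (hpa : (p : ℤ) ∣ a) (b : ℤ) (c : (ZMod p)ˣ) :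
    ∑ z : (ZMod p)ˣ with z ≠ 1, χ p (c * z * (1 - z) * (c * z * a - b)) = -χ p b * χ p c := by
  have h : ∀ z : (ZMod p)ˣ, χ p (c * z * (1 - z) * (c * z * a - b)) =
      χ p (-1 : ZMod p) * (χ p b * χ p c) * χ p (z * (1 - z)) := by
    intro z
    rw [(intCast_zmod_eq_zero_iff a).2 hpa]
    simp only [← map_mul]
    congr 1
    ring
  rw [Finset.sum_congr rfl fun z _ => h z, ← Finset.mul_sum, sum_units_ne_one_χ_mul_one_sub hp]
  have h1 : χ p (-1 : ZMod p) * χ p (-1) = 1 := by rw [← map_mul]; simp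
  linear_combination -(χ p b * χ p c) * h1

lemma twistSum_coefExt_of_dvd_of_not_sq_dvd_of_dvd (hp : p ≠ 2) (hA : IsCoefFun (coefExt N f))
    (hN : (N : ℤ) ∣ a) (ha : 0 < a) (hdet : 0 < (halfMat (p ^ 4 * a) (p * b) g).det)
    (hb : ¬ (p : ℤ) ∣ b) (hpa : (p : ℤ) ∣ a) {y : ℤ} (hy : y * b ≡ -g [ZMOD (p : ℤ) ^ 2]) :
    twistSum p (coefQP (coefExt N f) k ((p ^ 4 * a : ℤ) : ℚ) ((p * b : ℤ) : ℚ) g) = gaussW p * (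
      (p : ℂ)⁻¹ * ∑ c : (ZMod p)ˣ, ∑ d : (ZMod p)ˣ, χ p (c * d * (b * c - g)) *
        f (subst (halfMat (p ^ 4 * a) (p * b) g) !![1, -(rep c.1 + rep d.1) / p; 0, 1]) +
      (p : ℂ) ^ ((k : ℤ) - 2) * χ p (-g) * f (subst (halfMat (p ^ 4 * a) (p * b) g)
        !![1, (y : ℚ) / p ^ 2; 0, (p : ℚ)⁻¹]) -
      (p : ℂ)⁻¹ * χ p b * ∑ c : (ZMod p)ˣ, χ p c *
        f (subst (halfMat (p ^ 4 * a) (p * b) g)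
          !![(p : ℚ)⁻¹, -rep c.1 / p ^ 2; 0, (p : ℚ)])) := by
  have h0 : (a : ZMod p) = 0 := (intCast_zmod_eq_zero_iff a).2 hpa
  rw [halfMat_eq_symMat] at hdet ⊢
  push_cast at hdet ⊢
  rw [twistSum_coefQP_of_dvd_of_not_sq_dvd hp hA k a g hb hy,
    coefAt_coefExt_one_self_of_modEq hN ha rfl hdet hy]
  simp only [coefAt_coefExt_one_add_one hN ha rfl hdet, coefAt_coefExt_self_inv hN ha rfl hdet,
    ← Finset.sum_mul, sum_χ_of_dvd hp hpa]
  simp only [Int.cast_neg, h0, neg_zero, MulChar.map_zero, mul_zero, zero_mul, sub_zero, add_zero]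
  simp only [neg_mul, Finset.sum_neg_distrib, mul_assoc, ← Finset.mul_sum]
  ring

end

/-! ### The case `p² ∣ m`, `p⁴ ∥ α` -/

section

variable {p : ℕ} [Fact p.Prime] {N k : ℕ} {f : Matrix (Fin 2) (Fin 2) ℚ → ℂ} {a b g : ℤ}

lemma natCast_prime_pow_mul_ediv (n : ℕ) (c : ℤ) : ((p : ℤ) ^ n * c) / (p : ℤ) ^ n = c :=
  Int.mul_ediv_cancel_left _ (pow_ne_zero n (natCast_prime_ne_zero p ℤ))

lemma disc_eq (q a b g : ℤ) :
    4 * (q ^ 4 * a) * g - (q ^ 2 * b) ^ 2 = q ^ 4 * (4 * a * g - b ^ 2) := by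
  ring

lemma pow_add_dvd_pow_mul_iff (i j : ℕ) (c : ℤ) :
    (p : ℤ) ^ (i + j) ∣ (p : ℤ) ^ i * c ↔ (p : ℤ) ^ j ∣ c := by
  rw [pow_add, mul_dvd_mul_iff_left (pow_ne_zero i (natCast_prime_ne_zero p ℤ))]

lemma pow_mul_ediv_pow_add (i j : ℕ) (c : ℤ) :
    (p : ℤ) ^ i * c / (p : ℤ) ^ (i + j) = c / (p : ℤ) ^ j := by
  rw [pow_add, Int.mul_ediv_mul_of_pos]
  have : 0 < (p : ℤ) := by exact_mod_cast (Fact.out : p.Prime).pos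
  positivity

/-- The condition `p ∤ a` enters through the value `-1` of the Ramanujan sum at `a`, which accounts
for the summand `+χ(γ)` in the coefficient of `diag(p⁻¹, 1)`. -/
lemma bCoeff_eq (hN : (N : ℤ) ∣ a) (ha : 0 < a)
    (hdet : 0 < (symMat (p ^ 4 * a) (p ^ 2 * b) g).det) (hpa : ¬ (p : ℤ) ∣ a) :
    bCoeff p k f (p ^ 4 * a) (p ^ 2 * b) g =
      (1 - (p : ℂ)⁻¹) * χ p g * coefAt (coefExt N f) 1 0 1 (p ^ 4 * a) (p ^ 2 * b) g -
      (p : ℂ)⁻¹ * χ p g * (∑ x : (ZMod p)ˣ,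
        coefAt (coefExt N f) 1 (rep x.1 / p) 1 (p ^ 4 * a) (p ^ 2 * b) g) +
      (p : ℂ) ^ ((k : ℤ) - 3) * (∑ u : (ZMod p)ˣ, (∑ x : (ZMod p)ˣ with x ≠ 1,
        ∑ y : (ZMod p)ˣ with y ≠ 1,
          χ p (y * (1 - x) * (a * ((y - x) / (1 - y)) * (u : ZMod p) ^ 2 + b * u -
            g * (x : ZMod p)⁻¹))) *
        coefAt (coefExt N f) p (rep u.1 / p) 1 (p ^ 4 * a) (p ^ 2 * b) g) +
      (p : ℂ) ^ ((k : ℤ) - 3) * (χ p g * (p * χ p (b ^ 2 - 4 * a * g) - ramanujan p a) -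
        χ p (-a) * ramanujan p b) *
        coefAt (coefExt N f) p 0 1 (p ^ 4 * a) (p ^ 2 * b) g +
      (p : ℂ) ^ ((k : ℤ) - 3) * χ p (-a) * (∑ x : ZMod p, ramanujan p (b - x * a) *
        coefAt (coefExt N f) p (rep x / p) 1 (p ^ 4 * a) (p ^ 2 * b) g) +
      (p : ℂ) ^ (2 * (k : ℤ) - 4) * (∑ x ∈ Finset.univ.filter (fun x : (ZMod (p ^ 2))ˣ =>
          (a : ZMod (p ^ 2)) * (x : ZMod (p ^ 2)) ^ 2 - (b : ZMod (p ^ 2)) * (x : ZMod (p ^ 2)) +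
            g = 0),
        ∑ z : (ZMod p)ˣ with z ≠ 1, χ p (z * (1 - z) * (g - z * a * red p x.1 ^ 2)) *
        coefAt (coefExt N f) p (rep x.1 / p) p (p ^ 4 * a) (p ^ 2 * b) g) -
      (p : ℂ)⁻¹ * χ p a * (∑ x : (ZMod p)ˣ,
        coefAt (coefExt N f) p (rep x.1 / p ^ 2) ((p : ℚ)⁻¹) (p ^ 4 * a) (p ^ 2 * b) g) +
      (p : ℂ) ^ ((k : ℤ) - 3) * χ p a * (p * χ p (b ^ 2 - 4 * a * g) - ramanujan p g) *
        coefAt (coefExt N f) (p ^ 2) 0 ((p : ℚ)⁻¹) (p ^ 4 * a) (p ^ 2 * b) g +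
      (1 - (p : ℂ)⁻¹) * χ p a *
        coefAt (coefExt N f) (p ^ 2) 0 (((p : ℚ) ^ 2)⁻¹) (p ^ 4 * a) (p ^ 2 * b) g := by
  have hm1 : ((p : ℚ) ^ 2 * b) = p * ((p * b : ℤ) : ℚ) := by push_cast; ring
  have hm2 : ((p : ℚ) ^ 2 * b) = ((p ^ 2 * b : ℤ) : ℚ) := by push_cast; ring
  have hram : ramanujan p (a : ZMod p) = -1 :=
    ramanujan_of_ne_zero (mt (intCast_zmod_eq_zero_iff a).1 hpa)
  rw [Finset.sum_congr rfl fun u h => Finset.sum_congr rfl fun z _ => by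
      rw [coefAt_coefExt_self_self_of_eq hN ha rfl hdet (Finset.mem_filter.1 h).2],
    coefAt_coefExt_one_zero_one hN ha hm1 hdet, hram, coefAt_coefExt_sq_inv_sq hN ha hm2 hdet, coefAt_coefExt_sq_inv hN ha hm1 hdet,
    coefAt_coefExt_self_one_zero hN ha hm1 hdet]
  simp only [coefAt_coefExt_one_one hN ha hm1 hdet, coefAt_coefExt_self_one hN ha rfl hdet,
    coefAt_coefExt_self_inv hN ha hm1 hdet]
  simp only [bCoeff, natCast_prime_pow_mul_ediv, disc_eq, W_one_eq, halfMat_eq_symMat,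
    Finset.sum_mul]
  push_cast
  have h1 : χ p (-(4 * a * g - b ^ 2 : ZMod p)) = χ p (b ^ 2 - 4 * a * g) := by
    congr 1; ring
  have h2 : χ p (-(4 * a * g - b ^ 2 : ZMod p) * g) = χ p g * χ p (b ^ 2 - 4 * a * g) := by
    rw [← map_mul]; congr 1; ring
  simp only [h1, h2, ZMod.natCast_zmod_val]
  ring

/-- If `p ∣ 4ag - b²` then `χ(ga) = χ(4ag) = χ(b²)`, which is `1` exactly when `p ∤ b`. This matches
the two forms of the condition. -/
lemma cCoeff_eq (hp : p ≠ 2) (hN : (N : ℤ) ∣ a) (ha : 0 < a)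
    (hdet : 0 < (symMat (p ^ 4 * a) (p ^ 2 * b) g).det) :
    cCoeff p k f (p ^ 4 * a) (p ^ 2 * b) g =
      (p : ℂ) ^ (2 * (k : ℤ) - 4) * (χ p a * if ¬ (p : ℤ) ∣ b ∧ (p : ℤ) ∣ 4 * a * g - b ^ 2 then
        ramanujan p (((4 * a * g - b ^ 2) / p : ℤ)) else 0) *
        coefAt (coefExt N f) (p ^ 2) 0 1 (p ^ 4 * a) (p ^ 2 * b) g := by
  have h5 : (p : ℤ) ^ 5 ∣ (p : ℤ) ^ 4 * (4 * a * g - b ^ 2) ↔ (p : ℤ) ∣ 4 * a * g - b ^ 2 := by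
    rw [pow_add_dvd_pow_mul_iff 4 1, pow_one]
  have h5' : (p : ℤ) ^ 4 * (4 * a * g - b ^ 2) / (p : ℤ) ^ 5 = (4 * a * g - b ^ 2) / p := by
    rw [pow_mul_ediv_pow_add 4 1, pow_one]
  have h2 : (2 : ZMod p) ≠ 0 := Ring.two_ne_zero (by rwa [ZMod.ringChar_zmod_n])
  have hiff : (p : ℤ) ∣ 4 * a * g - b ^ 2 → (χ p ((g : ZMod p) * a) = 1 ↔ ¬ (p : ℤ) ∣ b) := by
    intro h
    rw [← intCast_zmod_eq_zero_iff] at h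
    push_cast at h
    have h3 : χ p ((g : ZMod p) * a) = χ p ((b : ZMod p) ^ 2) := by
      rw [← χ_mul_sq _ h2]
      congr 1
      linear_combination h
    rw [h3, ← intCast_zmod_eq_zero_iff]
    by_cases hb : (b : ZMod p) = 0
    · simp [hb, MulChar.map_zero]
    · have := χ_mul_sq (1 : ZMod p) hb
      rw [one_mul, map_one] at this
      simp [this, hb]
  rw [coefAt_coefExt_sq_one hN ha rfl hdet]
  simp only [cCoeff, natCast_prime_pow_mul_ediv, disc_eq, h5, h5', W_one_eq, halfMat_eq_symMat]
  by_cases hE : (p : ℤ) ∣ 4 * a * g - b ^ 2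
  · by_cases hb : (p : ℤ) ∣ b
    · rw [if_neg (fun h => (hiff hE).1 h.2 hb), if_neg (fun h => h.1 hb)]
      ring
    · rw [if_pos ⟨hE, (hiff hE).2 hb⟩, if_pos ⟨hb, hE⟩]
      push_cast
      ring
  · rw [if_neg (fun h => hE h.1), if_neg (fun h => hE h.2)]
    ring

/-- From `4a (a u² - b u + g) = (4ag - b²) + (b - 2 a u)²` with `4a` prime to `p`. It provides the
integral lower right entry of `S` when the linear congruence is solved. -/
lemma sq_mul_dvd_of_dvd_disc (hp : p ≠ 2) (hpa : ¬ (p : ℤ) ∣ a) {n : ℕ} {u : ℤ}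
    (hE : (p : ℤ) ^ (2 * n) ∣ 4 * a * g - b ^ 2) (hu : (p : ℤ) ^ n ∣ b - 2 * a * u) :
    (p : ℤ) ^ (2 * n) ∣ a * u ^ 2 - b * u + g := by
  have hpp : Prime (p : ℤ) := Nat.prime_iff_prime_int.1 Fact.out
  have h2 : ¬ (p : ℤ) ∣ 2 := by
    intro h
    have h : p ∣ 2 := by exact_mod_cast h
    exact hp ((Nat.prime_dvd_prime_iff_eq Fact.out Nat.prime_two).1 h)
  have h4 : ¬ (p : ℤ) ∣ 2 ^ 2 * a := fun h =>
    (hpp.dvd_or_dvd h).elim (fun h => h2 (hpp.dvd_of_dvd_pow h)) hpa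
  refine ((((Prime.coprime_iff_not_dvd hpp).2 h4).pow_left).dvd_of_dvd_mul_left ?_)
  have h3 : 2 ^ 2 * a * (a * u ^ 2 - b * u + g) = (4 * a * g - b ^ 2) + (b - 2 * a * u) ^ 2 := by
    ring
  rw [h3]
  refine dvd_add hE ?_
  rw [mul_comm 2 n, pow_mul]
  exact pow_dvd_pow_of_dvd hu 2

/-- The contributions of operators 9 and 10 exclude each other: if `p⁴ ∣ 4ag - b²` the factor `χ` of
the first is zero, and otherwise no matrix `S` in the second is integral. Integrality also confines
each sum to solutions of `2 a u = b`. -/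
lemma dCoeff_eq (hp : p ≠ 2) (hA : IsCoefFun (coefExt N f)) (hN : (N : ℤ) ∣ a) (ha : 0 < a)
    (hdet : 0 < (symMat (p ^ 4 * a) (p ^ 2 * b) g).det) (hpa : ¬ (p : ℤ) ∣ a) :
    dCoeff p k f (p ^ 4 * a) (p ^ 2 * b) g =
      (p : ℂ) ^ (3 * (k : ℤ) - 5) * (χ p a * χ p (-((4 * a * g - b ^ 2) / p ^ 2) : ℤ)) *
        (∑ x : (ZMod p)ˣ,
          coefAt (coefExt N f) (p ^ 2) (rep x.1) p (p ^ 4 * a) (p ^ 2 * b) g) +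
      (p : ℂ) ^ (4 * (k : ℤ) - 6) * χ p a * (∑ x : (ZMod (p ^ 2))ˣ,
          coefAt (coefExt N f) (p ^ 2) (rep x.1) (p ^ 2) (p ^ 4 * a) (p ^ 2 * b) g) := by
  have hpz : (p : ℤ) ≠ 0 := natCast_prime_ne_zero p ℤ
  have h8 : (p : ℤ) ^ 8 ∣ (p : ℤ) ^ 4 * (4 * a * g - b ^ 2) ↔ (p : ℤ) ^ 4 ∣ 4 * a * g - b ^ 2 :=
    pow_add_dvd_pow_mul_iff 4 4 _
  have h6 : (p : ℤ) ^ 6 ∣ (p : ℤ) ^ 4 * (4 * a * g - b ^ 2) ↔ (p : ℤ) ^ 2 ∣ 4 * a * g - b ^ 2 :=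
    pow_add_dvd_pow_mul_iff 4 2 _
  have h6' : (p : ℤ) ^ 4 * (4 * a * g - b ^ 2) / (p : ℤ) ^ 6 = (4 * a * g - b ^ 2) / (p : ℤ) ^ 2 :=
    pow_mul_ediv_pow_add 4 2 _
  simp only [dCoeff, natCast_prime_pow_mul_ediv, disc_eq, h8, h6, h6', halfMat_eq_symMat]
  push_cast
  have hzero : ¬ (p : ℤ) ^ 4 ∣ 4 * a * g - b ^ 2 → ∑ x : (ZMod (p ^ 2))ˣ,
      coefAt (coefExt N f) (p ^ 2) (rep x.1) (p ^ 2) (p ^ 4 * a) (p ^ 2 * b) g = 0 := by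
    refine fun h => Finset.sum_eq_zero fun x _ => ?_
    by_contra hne
    exact h (dvd_of_coefAt_sq_sq_ne_zero hA x hne).2
  split_ifs with hE4 hE2
  · obtain ⟨c, hc⟩ := hE4
    have h1 : (((4 * a * g - b ^ 2) / (p : ℤ) ^ 2 : ℤ) : ZMod p) = 0 := by
      rw [intCast_zmod_eq_zero_iff, hc, show (p : ℤ) ^ 4 * c = p ^ 2 * (p ^ 2 * c) by ring,
        natCast_prime_pow_mul_ediv]
      exact ((dvd_pow_self _ two_ne_zero)).mul_right c
    rw [h1, neg_zero, MulChar.map_zero, mul_zero, mul_zero, zero_mul, zero_add]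
    congr 1
    rw [Finset.sum_filter]
    refine Finset.sum_congr rfl fun u _ => ?_
    split_ifs with hu
    · have hu' : (p : ℤ) ^ 2 ∣ b - 2 * a * (u.1.val : ℤ) := by
        rw [← intCast_zmod_sq_eq_zero_iff]
        push_cast
        rw [ZMod.natCast_zmod_val, sub_eq_zero]
        exact hu.symm
      exact (coefAt_coefExt_sq_sq hN ha rfl hdet u.1 hu'
        (sq_mul_dvd_of_dvd_disc (n := 2) hp hpa ⟨c, hc⟩ hu')).symm
    · by_contra hne
      exact hu (dvd_of_coefAt_sq_sq_ne_zero hA u (Ne.symm hne)).1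
  · rw [hzero hE4, mul_zero, add_zero, ← mul_assoc]
    congr 1
    rw [Finset.sum_filter]
    refine Finset.sum_congr rfl fun u _ => ?_
    split_ifs with hu
    · have hu' : (p : ℤ) ∣ b - 2 * a * (u.1.val : ℤ) := by
        rw [← intCast_zmod_eq_zero_iff]
        push_cast
        rw [ZMod.natCast_zmod_val, sub_eq_zero]
        exact hu.symm
      exact (coefAt_coefExt_sq_self hN ha rfl hdet u.1 hu'
        (sq_mul_dvd_of_dvd_disc (n := 1) hp hpa hE2 (by rwa [pow_one]))).symm
    · by_contra hne
      exact hu (dvd_of_coefAt_sq_self_ne_zero hA u (Ne.symm hne)).1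
  · have h9 : ∑ x : (ZMod p)ˣ,
        coefAt (coefExt N f) (p ^ 2) (rep x.1) p (p ^ 4 * a) (p ^ 2 * b) g = 0 := by
      refine Finset.sum_eq_zero fun x _ => ?_
      by_contra hne
      exact hE2 (dvd_of_coefAt_sq_self_ne_zero hA x hne).2
    rw [hzero hE4, h9, mul_zero, mul_zero, add_zero]

lemma twistSum_coefExt_of_sq_dvd_of_not_dvd (hp : p ≠ 2) (hA : IsCoefFun (coefExt N f))
    (hN : (N : ℤ) ∣ a) (ha : 0 < a) (hdet : 0 < (halfMat (p ^ 4 * a) (p ^ 2 * b) g).det)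
    (hpa : ¬ (p : ℤ) ∣ a) :
    twistSum p (coefQP (coefExt N f) k ((p ^ 4 * a : ℤ) : ℚ) ((p ^ 2 * b : ℤ) : ℚ) g) =
      gaussW p * (bCoeff p k f (p ^ 4 * a) (p ^ 2 * b) g +
        cCoeff p k f (p ^ 4 * a) (p ^ 2 * b) g + dCoeff p k f (p ^ 4 * a) (p ^ 2 * b) g) := by
  rw [halfMat_eq_symMat] at hdet
  push_cast at hdet ⊢
  rw [twistSum_coefQP_of_sq_dvd hp hA, bCoeff_eq hN ha hdet hpa, cCoeff_eq hp hN ha hdet,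
    dCoeff_eq hp hA hN ha hdet hpa]

end

/-! ### The case `p² ∣ m`, `p⁵ ∣ α`, and the expansion of the twist -/

section

variable {p : ℕ} [Fact p.Prime] {N k : ℕ} {f : Matrix (Fin 2) (Fin 2) ℚ → ℂ} {a b g : ℤ}

/-- The vanishing of `χ(a)` removes operators 5, 6, 9, 10, 12, 13 and 14. In operators 2 and 8 the
dependence on `y` and on `z` splits off as `χ(y)` and `χ(z (1 - z))`, with sums `-1` and `-χ(-1)`;
the Ramanujan sum at `a` in operator 3 is now `p - 1`. -/
lemma twistSum_coefExt_of_sq_dvd_of_dvd (hp : p ≠ 2) (hA : IsCoefFun (coefExt N f))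
    (hN : (N : ℤ) ∣ a) (ha : 0 < a) (hdet : 0 < (halfMat (p ^ 4 * a) (p ^ 2 * b) g).det)
    (hpa : (p : ℤ) ∣ a) :
    twistSum p (coefQP (coefExt N f) k ((p ^ 4 * a : ℤ) : ℚ) ((p ^ 2 * b : ℤ) : ℚ) g) =
      gaussW p * (
        (1 - (p : ℂ)⁻¹) * χ p g * f (halfMat (p ^ 4 * a) (p ^ 2 * b) g) -
        (p : ℂ)⁻¹ * χ p g * ∑ u : (ZMod p)ˣ,
          f (subst (halfMat (p ^ 4 * a) (p ^ 2 * b) g) !![1, -rep u.1 / p; 0, 1]) -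
        (p : ℂ) ^ ((k : ℤ) - 3) * ∑ u : (ZMod p)ˣ, ∑ x : (ZMod p)ˣ with x ≠ 1,
          χ p ((1 - x) * (b * u - g * (x : ZMod p)⁻¹)) *
            f (subst (halfMat (p ^ 4 * a) (p ^ 2 * b) g)
              !![(p : ℚ)⁻¹, -rep u.1 / p ^ 2; 0, 1]) +
        (p : ℂ) ^ ((k : ℤ) - 3) * χ p g *
          (1 - p + p * χ p (-(4 * a * g - b ^ 2) : ℤ)) *
            f (subst (halfMat (p ^ 4 * a) (p ^ 2 * b) g) !![(p : ℚ)⁻¹, 0; 0, 1]) -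
        (p : ℂ) ^ (2 * (k : ℤ) - 4) * χ p (-g) *
          ∑ u ∈ Finset.univ.filter (fun u : (ZMod (p ^ 2))ˣ =>
              (a : ZMod (p ^ 2)) * (u : ZMod (p ^ 2)) ^ 2 -
                (b : ZMod (p ^ 2)) * (u : ZMod (p ^ 2)) + g = 0),
            f (subst (halfMat (p ^ 4 * a) (p ^ 2 * b) g)
              !![(p : ℚ)⁻¹, -rep u.1 / p ^ 3; 0, (p : ℚ)⁻¹])) := by
  rw [halfMat_eq_symMat] at hdet ⊢
  push_cast at hdet ⊢
  have h0 : (a : ZMod p) = 0 := (intCast_zmod_eq_zero_iff a).2 hpa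
  have h3 : ∀ u x : (ZMod p)ˣ, ∑ y : (ZMod p)ˣ with y ≠ 1,
      χ p (y * (1 - x) * (a * ((y - x) / (1 - y)) * (u : ZMod p) ^ 2 + b * u -
        g * (x : ZMod p)⁻¹)) = -χ p ((1 - x) * (b * u - g * (x : ZMod p)⁻¹)) := by
    intro u x
    have h : ∀ y : (ZMod p)ˣ,
        χ p (y * (1 - x) * (a * ((y - x) / (1 - y)) * (u : ZMod p) ^ 2 + b * u -
          g * (x : ZMod p)⁻¹)) = χ p y * χ p ((1 - x) * (b * u - g * (x : ZMod p)⁻¹)) := by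
      intro y
      rw [← map_mul, h0]
      congr 1
      ring
    rw [Finset.sum_congr rfl fun y _ => h y, ← Finset.sum_mul, sum_units_ne_one_χ hp]
    ring
  have h8 : ∀ u : (ZMod (p ^ 2))ˣ, ∑ z : (ZMod p)ˣ with z ≠ 1,
      χ p (z * (1 - z) * (g - z * a * red p u.1 ^ 2)) = -χ p (-g) := by
    intro u
    have h : ∀ z : (ZMod p)ˣ, χ p (z * (1 - z) * (g - z * a * red p u.1 ^ 2)) =
        χ p g * χ p (z * (1 - z)) := by
      intro z
      rw [← map_mul, h0]
      congr 1
      ring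
    rw [Finset.sum_congr rfl fun y _ => h y, ← Finset.mul_sum, sum_units_ne_one_χ_mul_one_sub hp,
      mul_neg, ← map_mul, mul_neg, mul_one]
  have hm1 : ((p : ℚ) ^ 2 * b) = p * ((p * b : ℤ) : ℚ) := by push_cast; ring
  have hE : χ p (-(4 * a * g - b ^ 2 : ZMod p)) = χ p (b ^ 2 - 4 * a * g) := by
    congr 1; ring
  rw [twistSum_coefQP_of_sq_dvd hp hA,
    Finset.sum_congr rfl fun u h => Finset.sum_congr rfl fun z _ => by
      rw [coefAt_coefExt_self_self_of_eq hN ha rfl hdet (Finset.mem_filter.1 h).2],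
    coefAt_coefExt_one_zero_one hN ha hm1 hdet, coefAt_coefExt_self_one_zero hN ha hm1 hdet]
  simp only [coefAt_coefExt_one_one hN ha hm1 hdet, coefAt_coefExt_self_one hN ha rfl hdet,
    ← Finset.sum_mul, h3, h8, hE]
  simp only [h0, neg_zero, MulChar.map_zero, mul_zero, zero_mul, add_zero, sub_zero,
    ramanujan_zero, neg_mul, Finset.sum_neg_distrib, ← Finset.mul_sum]
  simp only [Finset.sum_mul]
  ring

/-- The coefficients of the Fourier expansion of the twist, divided by the Gauss sum. -/
def twistCoef (p : ℕ) [Fact p.Prime] (N k : ℕ) (f : Matrix (Fin 2) (Fin 2) ℚ → ℂ)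
    (S : Matrix (Fin 2) (Fin 2) ℚ) : ℂ :=
  (gaussW p)⁻¹ * twistSum p (coefQP (coefExt N f) k (S 0 0) (2 * S 0 1) (S 1 1))

lemma twistCoef_eq_of_twistSum_eq (hp : p ≠ 2) {α m γ : ℤ} {v : ℂ}
    (h : twistSum p (coefQP (coefExt N f) k α m γ) = gaussW p * v) :
    twistCoef p N k f (halfMat α m γ) = v := by
  have h1 : (2 : ℚ) * (m / 2) = m := by ring
  have h2 : twistCoef p N k f (halfMat α m γ) =
      (gaussW p)⁻¹ * twistSum p (coefQP (coefExt N f) k α m γ) := by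
    simp [twistCoef, halfMat, h1]
  rw [h2, h, inv_mul_cancel_left₀ (gaussW_ne_zero hp)]

lemma hasFourierExpansion_twist (hp : p ≠ 2) (hpN : ¬ p ∣ N)
    {F : Matrix (Fin 2) (Fin 2) ℂ → ℂ} (hF : IsParamodularCuspForm N k F)
    (hf : HasFourierExpansion N F f) :
    HasFourierExpansion (N * p ^ 4) (twist p k F) fun S => gaussW p * twistCoef p N k f S := by
  intro Z hZ
  simp only [twistCoef, mul_inv_cancel_left₀ (gaussW_ne_zero hp)]
  exact (hasSum_APlus_iff (fun α m γ h => symMat_mem_APlus_of_twistSum_ne_zero hp hpN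
    (isCoefFun_coefExt hF hf) k h) hZ).2 (hasSum_twist p hf hZ)

lemma exists_of_halfMat_mem_APlus {α m γ : ℤ} (h : halfMat α m γ ∈ APlus (N * p ^ 4)) :
    ∃ a : ℤ, α = p ^ 4 * a ∧ (N : ℤ) ∣ a ∧ 0 < a ∧ 0 < (halfMat (p ^ 4 * a) m γ).det := by
  obtain ⟨x, y, z, h1, -, -, ⟨j, hj⟩, h3, h4⟩ := symMat_mem_APlus h
  obtain rfl : α = x := by exact_mod_cast h1
  have hp0 : 0 < (p : ℤ) ^ 4 := by
    have : 0 < (p : ℤ) := by exact_mod_cast (Fact.out : p.Prime).pos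
    positivity
  have hα : α = p ^ 4 * (N * j) := by rw [hj]; push_cast; ring
  refine ⟨N * j, hα, dvd_mul_right _ _, ?_, hα ▸ h4⟩
  rw [hα] at h3
  exact pos_of_mul_pos_right h3 hp0.le

end

end Paramodular

end

/-! ### The five cases together -/

theorem theorem3p1 (N k p : ℕ) (hN : 0 < N) (hk : 0 < k) [Fact p.Prime] (hp2 : p ≠ 2)
    (hpN : ¬ p ∣ N) (F : Matrix (Fin 2) (Fin 2) ℂ → ℂ)
    (hF : Paramodular.IsParamodularCuspForm N k F)
    (a : Matrix (Fin 2) (Fin 2) ℚ → ℂ) (ha : Paramodular.HasFourierExpansion N F a) :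
    ∃ aχ : Matrix (Fin 2) (Fin 2) ℚ → ℂ,
      Paramodular.HasFourierExpansion (N * p ^ 4) (Paramodular.twist p k F)
        (fun S => Paramodular.W p (Paramodular.χ p) 1 * aχ S) ∧
      ∀ α m γ : ℤ, Paramodular.halfMat α m γ ∈ Paramodular.APlus (N * p ^ 4) →
        -- (i)
        (¬ (p : ℤ) ∣ m → (p : ℤ) ^ 4 ∣ α →
          aχ (Paramodular.halfMat α m γ) =
            (p : ℂ) ^ (1 - (k : ℤ)) * Paramodular.χ p m *
              ∑ b : (ZMod p)ˣ, Paramodular.χ p b *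
                a (Paramodular.subst (Paramodular.halfMat α m γ)
                  !![1, -Paramodular.rep b.1 / p; 0, (p : ℚ)])) ∧
        -- (ii)
        ((p : ℤ) ∣ m → ¬ (p : ℤ) ^ 2 ∣ m → (p : ℤ) ^ 4 ∣ α → ¬ (p : ℤ) ^ 5 ∣ α →
          ∀ x y : ℤ, x * (α / (p : ℤ) ^ 4) ≡ m / (p : ℤ) [ZMOD (p : ℤ) ^ 2] →
            y * (m / (p : ℤ)) ≡ -γ [ZMOD (p : ℤ) ^ 2] →
          aχ (Paramodular.halfMat α m γ) =
            (p : ℂ)⁻¹ * ∑ c : (ZMod p)ˣ, ∑ b : (ZMod p)ˣ,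
              Paramodular.χ p (c * b * ((m / (p : ℤ) : ℤ) * c - γ)) *
                a (Paramodular.subst (Paramodular.halfMat α m γ)
                  !![1, -(Paramodular.rep c.1 + Paramodular.rep b.1) / p; 0, 1])
            + (p : ℂ)⁻¹ * ∑ c : (ZMod p)ˣ, ∑ z : (ZMod p)ˣ with z ≠ 1,
              Paramodular.χ p (c * z * (1 - z) *
                  (c * z * (α / (p : ℤ) ^ 4 : ℤ) - (m / (p : ℤ) : ℤ))) *
                a (Paramodular.subst (Paramodular.halfMat α m γ)
                  !![(p : ℚ)⁻¹, -Paramodular.rep c.1 / p ^ 2; 0, (p : ℚ)])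
            - (p : ℂ)⁻¹ * Paramodular.χ p (α / (p : ℤ) ^ 4 : ℤ) *
                a (Paramodular.subst (Paramodular.halfMat α m γ)
                  !![((p : ℚ) ^ 2)⁻¹, 0; 0, (p : ℚ) ^ 2])
            + (p : ℂ) ^ ((k : ℤ) - 2) * Paramodular.χ p (-(α / (p : ℤ) ^ 4) : ℤ) *
                a (Paramodular.subst (Paramodular.halfMat α m γ)
                  !![(p : ℚ)⁻¹, -(x : ℚ) / p ^ 3; 0, 1])
            + (p : ℂ) ^ ((k : ℤ) - 2) * Paramodular.χ p (-γ) *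
                a (Paramodular.subst (Paramodular.halfMat α m γ)
                  !![1, (y : ℚ) / p ^ 2; 0, (p : ℚ)⁻¹])) ∧
        -- (iii)
        ((p : ℤ) ∣ m → ¬ (p : ℤ) ^ 2 ∣ m → (p : ℤ) ^ 5 ∣ α →
          ∀ y : ℤ, y * (m / (p : ℤ)) ≡ -γ [ZMOD (p : ℤ) ^ 2] →
          aχ (Paramodular.halfMat α m γ) =
            (p : ℂ)⁻¹ * ∑ c : (ZMod p)ˣ, ∑ b : (ZMod p)ˣ,
              Paramodular.χ p (c * b * ((m / (p : ℤ) : ℤ) * c - γ)) *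
                a (Paramodular.subst (Paramodular.halfMat α m γ)
                  !![1, -(Paramodular.rep c.1 + Paramodular.rep b.1) / p; 0, 1])
            + (p : ℂ) ^ ((k : ℤ) - 2) * Paramodular.χ p (-γ) *
                a (Paramodular.subst (Paramodular.halfMat α m γ)
                  !![1, (y : ℚ) / p ^ 2; 0, (p : ℚ)⁻¹])
            - (p : ℂ)⁻¹ * Paramodular.χ p (m / (p : ℤ) : ℤ) * ∑ c : (ZMod p)ˣ,
                Paramodular.χ p c *
                  a (Paramodular.subst (Paramodular.halfMat α m γ)
                    !![(p : ℚ)⁻¹, -Paramodular.rep c.1 / p ^ 2; 0, (p : ℚ)])) ∧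
        -- (iv)
        ((p : ℤ) ^ 2 ∣ m → (p : ℤ) ^ 4 ∣ α → ¬ (p : ℤ) ^ 5 ∣ α →
          aχ (Paramodular.halfMat α m γ) =
            Paramodular.bCoeff p k a α m γ + Paramodular.cCoeff p k a α m γ +
              Paramodular.dCoeff p k a α m γ) ∧
        -- (v)
        ((p : ℤ) ^ 2 ∣ m → (p : ℤ) ^ 5 ∣ α →
          aχ (Paramodular.halfMat α m γ) =
            (1 - (p : ℂ)⁻¹) * Paramodular.χ p γ * a (Paramodular.halfMat α m γ)
            - (p : ℂ)⁻¹ * Paramodular.χ p γ * ∑ b : (ZMod p)ˣ,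
                a (Paramodular.subst (Paramodular.halfMat α m γ)
                  !![1, -Paramodular.rep b.1 / p; 0, 1])
            - (p : ℂ) ^ ((k : ℤ) - 3) * ∑ b : (ZMod p)ˣ, ∑ x : (ZMod p)ˣ with x ≠ 1,
                Paramodular.χ p ((1 - x) *
                    ((m / (p : ℤ) ^ 2 : ℤ) * b - γ * (x : ZMod p)⁻¹)) *
                  a (Paramodular.subst (Paramodular.halfMat α m γ)
                    !![(p : ℚ)⁻¹, -Paramodular.rep b.1 / p ^ 2; 0, 1])
            + (p : ℂ) ^ ((k : ℤ) - 3) * Paramodular.χ p γ *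
                (1 - p + p * Paramodular.χ p
                  (-((4 * α * γ - m ^ 2) / (p : ℤ) ^ 4) : ℤ)) *
                a (Paramodular.subst (Paramodular.halfMat α m γ)
                  !![(p : ℚ)⁻¹, 0; 0, 1])
            - (p : ℂ) ^ (2 * (k : ℤ) - 4) * Paramodular.χ p (-γ) *
                ∑ b ∈ Finset.univ.filter (fun b : (ZMod (p ^ 2))ˣ =>
                    (α / (p : ℤ) ^ 4 : ℤ) * (b : ZMod (p ^ 2)) ^ 2 -
                      (m / (p : ℤ) ^ 2 : ℤ) * (b : ZMod (p ^ 2)) + γ = 0),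
                  a (Paramodular.subst (Paramodular.halfMat α m γ)
                    !![(p : ℚ)⁻¹, -Paramodular.rep b.1 / p ^ 3; 0, (p : ℚ)⁻¹])) := by
  have hA := Paramodular.isCoefFun_coefExt hF ha
  have hpz : (p : ℤ) ≠ 0 := Paramodular.natCast_prime_ne_zero p ℤ
  refine ⟨Paramodular.twistCoef p N k a, Paramodular.hasFourierExpansion_twist hp2 hpN hF ha,
    fun α m γ hmem => ?_⟩
  -- From here on `α` stands for the original `α p⁻⁴`, and in the last four cases `b` for `m`
  -- divided by the power of `p` at hand.
  obtain ⟨α, rfl, hN', hα, hdet⟩ := Paramodular.exists_of_halfMat_mem_APlus hmem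
  have h5 : (p : ℤ) ^ 5 ∣ (p : ℤ) ^ 4 * α ↔ (p : ℤ) ∣ α := by
    rw [Paramodular.pow_add_dvd_pow_mul_iff 4 1, pow_one]
  have hsq : ∀ {b : ℤ}, (p : ℤ) ^ 2 ∣ p * b ↔ (p : ℤ) ∣ b := fun {b} => by
    rw [sq, mul_dvd_mul_iff_left hpz]
  rw [h5, Paramodular.natCast_prime_pow_mul_ediv]
  refine ⟨fun hm _ => ?_, ?_, ?_, ?_, ?_⟩
  · exact Paramodular.twistCoef_eq_of_twistSum_eq hp2
      (Paramodular.twistSum_coefExt_of_not_dvd hp2 hA hN' hα hdet hm)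
  · rintro ⟨b, rfl⟩ hb - hpα x y hx hy
    rw [Int.mul_ediv_cancel_left b hpz] at hx hy ⊢
    exact Paramodular.twistCoef_eq_of_twistSum_eq hp2
      (Paramodular.twistSum_coefExt_of_dvd_of_not_sq_dvd_of_not_dvd hp2 hA hN' hα hdet
        (mt hsq.2 hb) hpα hx hy)
  · rintro ⟨b, rfl⟩ hb hpα y hy
    rw [Int.mul_ediv_cancel_left b hpz] at hy ⊢
    exact Paramodular.twistCoef_eq_of_twistSum_eq hp2
      (Paramodular.twistSum_coefExt_of_dvd_of_not_sq_dvd_of_dvd hp2 hA hN' hα hdet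
        (mt hsq.2 hb) hpα hy)
  · rintro ⟨b, rfl⟩ - hpα
    exact Paramodular.twistCoef_eq_of_twistSum_eq hp2
      (Paramodular.twistSum_coefExt_of_sq_dvd_of_not_dvd hp2 hA hN' hα hdet hpα)
  · rintro ⟨b, rfl⟩ hpα
    rw [Paramodular.natCast_prime_pow_mul_ediv, Paramodular.disc_eq,
      Paramodular.natCast_prime_pow_mul_ediv]
    exact Paramodular.twistCoef_eq_of_twistSum_eq hp2
      (Paramodular.twistSum_coefExt_of_sq_dvd_of_dvd hp2 hA hN' hα hdet hpα)
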